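/- **Setting.** Let $n\ge 1$. Let $\mathcal Z$ be the commutative ring generated by $z_{i,a}, z_{\bar i,a}$ ($1\le i\le n$, $a\in\mathbb C$) with relations $z_{i,a}z_{\bar i,a-2n+2i-4}=z_{i-1,a}z_{\overline{i-1},a-2n+2i-4}$ for $1\le i\le n$, where $z_{0,a}=z_{\bar 0,a}=1$. In the noncommutative power series in $X$ over $\mathcal Z$ with $Xz_{i,a}=z_{i,a-2}X$ and $Xz_{\bar i,a}=z_{\bar i,a-2}X$, put $$H_a=\Big\{\prod_{1\le k\le n}^{\rightarrow}(1-z_{\bar k,a}X)^{-1}\Big\}(1-z_{n,a}Xz_{\bar n,a}X)^{-1}\Big\{\prod_{1\le k\le n}^{\leftarrow}(1-z_{k,a}X)^{-1}\Big\}=\sum_{r\ge0}h_{r,a}X^r,$$ where $\prod^{\rightarrow}A_k=A_1\cdots A_n$, $\prod^{\leftarrow}A_k=A_n\cdots A_1$, and $h_{r,a}=0$ for $r<0$. For partitions $\mu\subset\lambda$, with $l=l(\lambda)$ the number of nonzero parts of $\lambda$, let $$\chi_{\lambda/\mu,a}=\det\big(h_{\lambda_i-\mu_j-i+j,\;a+2(\lambda_i-i)}\big)_{1\le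 i,j\le l}.$$ **Paths.** A path goes by unit east and north steps in $\mathbb Z^2$ from height $-n-1$ to height $n+1$, with no east step at height $\pm(n+1)$ and an even number of east steps at height $0$. The weight $z_a^p$ of a path $p$ is the product over its east steps $s$, starting at $(x,y)$, of $z_{L(s),a+2x}$, where $L(s)=n+1+y$ if $y<0$, $L(s)=\overline{n+1-y}$ if $y>0$, and $L(s)$ runs through $\bar n,n,\bar n,n,\dots$ for the successive east steps at height $0$. Let $\mathfrak P$ be the set of all tuples $p=(p_1,\dots,p_l)$ for which there is a permutation $\sigma$ (unique, since the points below are distinct) such that $p_i$ goes from $u_i=(\mu_i+1-i,-n-1)$ to $v_{\sigma(i)}$, where $v_i=(\lambda_i+1-i,n+1)$. Put $z_a^p=\prod_i z_a^{p_i}$. Two paths $p_i,p_j$ with a common point are *specially intersecting* if they meet only at height $0$ and the difference of the horizontal positions of their leftmost points at height $0$ is odd; otherwise they are *ordinarily intersecting*. **Units.** Let $p\in\mathfrak P$. For $0\le r\le n$ and $1\le i\le l$ let $\alpha_i(-r)$ be the horizontal position of the leftmost point of $p_i$ at height $-r$, and $\beta_i(r)$ that of the rightmost point at height $r$ of the path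 ending at $v_i$. Let $\alpha_i^*(r)=\alpha_{i-r}(-r)-1-r$ if $i-r\ge1$, and $+\infty$ otherwise; $\beta_i^*(-r)=\beta_{i+r}(r)+1+r$ if $i+r\le l$, and $-\infty$ otherwise. Let also $\alpha_0(-r)=\alpha_0^*(r)=+\infty$ and $\beta_{l+1}(r)=\beta_{l+1}^*(-r)=-\infty$. A unit square $U=[b,b+1]\times[r,r+1]$ (*upper*, of height $r$), resp. $U=[b,b+1]\times[-r-1,-r]$ (*lower*, of height $-r$), with $b\in\mathbb Z$, $0\le r\le n$, is a - I-unit, if for some $0\le i\le l$: $\alpha_i^*(r)\le b<b+1\le\beta_{i+1}(r)$, resp. $\alpha_i(-r)\le b<b+1\le\beta_{i+1}^*(-r)$; - II-unit, if for some $0\le i\le l$: $\beta_{i+1}(r)\le b<b+1\le\alpha_i^*(r)$, resp. $\beta_{i+1}^*(-r)\le b<b+1\le\alpha_i(-r)$. We then say that $U$ is a I-unit (II-unit) *at* $i$. A II-unit is *boundary* if it is a II-unit at some $i$ such that $i\le r$ or $i=l$ or $r=n$ (upper $U$), resp. $i=0$ or $i\ge l-r$ or $r=n$ (lower $U$). Two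 unit squares are adjacent if the upper-left or lower-right vertex of one is a vertex of the other. **Regions.** A I-region is a class, for the equivalence relation generated by adjacency among the I-units, which contains a unit of height $0$. A II-region is a class, for the equivalence relation generated by adjacency among the II-units, which contains a unit of height $0$ and no boundary II-unit. For a I-region (resp. II-region) $V$ let $n(V)$ be the number of $1\le i\le l-1$ such that $\alpha_i(0)-\beta_{i+1}(0)$ is even and $\le0$ (resp. even and $>0$) and $V$ contains a unit of height $0$ which is a I-unit (resp. II-unit) at $i$. The region $V$ is *odd* if $n(V)$ is odd. Let $P_2(\lambda/\mu)$ be the set of all $p\in\mathfrak P$ such that no pair $(p_i,p_j)$, $i\ne j$, is ordinarily intersecting and $p$ has no odd I-region and no odd II-region. **Theorem.** If $\lambda/\mu$ satisfies the positivity condition $\max_j(\lambda'_j-\mu'_j)\le n+1$, where $\lambda',\mu'$ are the conjugate partitions, then for every $a\in\mathbb C$ the set $P_2(\lambda/\mu)$ is finite and $$\chi_{\lambda/\mu,a}=\sum_{p\in P_2(\lambda/\mu)}z_a^p .$$ -/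

import Mathlib

/-! ## The commutative ring `𝒵` -/

namespace TypeC

/-- The polynomial `z_{i,a}`: a free generator for `1 ≤ i ≤ n`, and `1` for `i = 0`
(the remaining values of `i` are never used). Generators are indexed by
`Bool × Fin n × ℂ`; the Boolean is `false` for unbarred and `true` for barred letters. -/
noncomputable def zPoly (n : ℕ) (i : ℕ) (a : ℂ) : MvPolynomial (Bool × Fin n × ℂ) ℤ :=
  if h : 1 ≤ i ∧ i ≤ n then MvPolynomial.X (false, ⟨i - 1, by omega⟩, a) else 1

/-- The polynomial `z_{ī,a}`: a free generator for `1 ≤ i ≤ n`, and `1` for `i = 0`. -/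
noncomputable def zbarPoly (n : ℕ) (i : ℕ) (a : ℂ) : MvPolynomial (Bool × Fin n × ℂ) ℤ :=
  if h : 1 ≤ i ∧ i ≤ n then MvPolynomial.X (true, ⟨i - 1, by omega⟩, a) else 1

/-- The ideal of the relations
`z_{i,a} z_{ī,a-2n+2i-4} = z_{i-1,a} z_{\overline{i-1},a-2n+2i-4}`, `i = 1, …, n`. -/
noncomputable def relIdeal (n : ℕ) : Ideal (MvPolynomial (Bool × Fin n × ℂ) ℤ) :=
  Ideal.span {q | ∃ (i : ℕ) (a : ℂ), 1 ≤ i ∧ i ≤ n ∧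
    q = zPoly n i a * zbarPoly n i (a - 2 * n + 2 * i - 4)
      - zPoly n (i - 1) a * zbarPoly n (i - 1) (a - 2 * n + 2 * i - 4)}

/-- The ring `𝒵`. -/
abbrev ZRing (n : ℕ) : Type := MvPolynomial (Bool × Fin n × ℂ) ℤ ⧸ relIdeal n

/-- `z_{i,a} ∈ 𝒵`. -/
noncomputable def z (n : ℕ) (i : ℕ) (a : ℂ) : ZRing n := Ideal.Quotient.mk _ (zPoly n i a)

/-- `z_{ī,a} ∈ 𝒵`. -/
noncomputable def zbar (n : ℕ) (i : ℕ) (a : ℂ) : ZRing n := Ideal.Quotient.mk _ (zbarPoly n i a)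

/-- The substitution `a ↦ a - 2` on polynomials. -/
noncomputable def shiftPoly (n : ℕ) :
    MvPolynomial (Bool × Fin n × ℂ) ℤ →+* MvPolynomial (Bool × Fin n × ℂ) ℤ :=
  (MvPolynomial.rename (fun t : Bool × Fin n × ℂ => (t.1, t.2.1, t.2.2 - 2))).toRingHom

theorem shiftPoly_zPoly (n i : ℕ) (a : ℂ) : shiftPoly n (zPoly n i a) = zPoly n i (a - 2) := by
  unfold zPoly shiftPoly
  split_ifs <;> simp

theorem shiftPoly_zbarPoly (n i : ℕ) (a : ℂ) :
    shiftPoly n (zbarPoly n i a) = zbarPoly n i (a - 2) := by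
  unfold zbarPoly shiftPoly
  split_ifs <;> simp

theorem relIdeal_le_comap (n : ℕ) : relIdeal n ≤ (relIdeal n).comap (shiftPoly n) := by
  refine Ideal.span_le.2 ?_
  rintro q ⟨i, a, h1, h2, rfl⟩
  refine Ideal.subset_span ⟨i, a - 2, h1, h2, ?_⟩
  have e : a - 2 * (n : ℂ) + 2 * i - 4 - 2 = a - 2 - 2 * n + 2 * i - 4 := by ring
  simp only [map_sub, map_mul, shiftPoly_zPoly, shiftPoly_zbarPoly, e]

/-- The ring endomorphism of `𝒵` with `z_{i,a} ↦ z_{i,a-2}`, `z_{ī,a} ↦ z_{ī,a-2}`. -/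
noncomputable def shift (n : ℕ) : ZRing n →+* ZRing n :=
  Ideal.quotientMap (relIdeal n) (shiftPoly n) (relIdeal_le_comap n)

theorem shift_z (n i : ℕ) (a : ℂ) : shift n (z n i a) = z n i (a - 2) := by
  simp [shift, z, shiftPoly_zPoly]

theorem shift_zbar (n i : ℕ) (a : ℂ) : shift n (zbar n i a) = zbar n i (a - 2) := by
  simp [shift, zbar, shiftPoly_zbarPoly]

end TypeC

/-! ## Noncommutative power series -/

/-- Power series `∑ f_k X^k` over a commutative ring `R`, coefficients on the left, with the
commutation rule `X r = τ(r) X` for a ring endomorphism `τ`. -/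
@[ext]
structure SkewSeries {R : Type*} [CommRing R] (τ : R →+* R) where
  /-- the coefficient `f_k` of `X^k` -/
  coeff : ℕ → R

namespace SkewSeries

variable {R : Type*} [CommRing R] {τ : R →+* R}

instance : Zero (SkewSeries τ) := ⟨⟨fun _ => 0⟩⟩
instance : One (SkewSeries τ) := ⟨⟨fun k => if k = 0 then 1 else 0⟩⟩
instance : Add (SkewSeries τ) := ⟨fun f g => ⟨fun k => f.coeff k + g.coeff k⟩⟩
instance : Neg (SkewSeries τ) := ⟨fun f => ⟨fun k => -f.coeff k⟩⟩
instance : Sub (SkewSeries τ) := ⟨fun f g => ⟨fun k => f.coeff k - g.coeff k⟩⟩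
/-- `(∑ f_i X^i) (∑ g_j X^j) = ∑ f_i τ^i(g_j) X^(i+j)`. -/
instance : Mul (SkewSeries τ) :=
  ⟨fun f g => ⟨fun k => ∑ q ∈ Finset.HasAntidiagonal.antidiagonal k,
    f.coeff q.1 * (⇑τ)^[q.1] (g.coeff q.2)⟩⟩

theorem coeff_zero (k : ℕ) : (0 : SkewSeries τ).coeff k = 0 := rfl
theorem coeff_one (k : ℕ) : (1 : SkewSeries τ).coeff k = if k = 0 then 1 else 0 := rfl
theorem coeff_add (f g : SkewSeries τ) (k : ℕ) : (f + g).coeff k = f.coeff k + g.coeff k := rfl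
theorem coeff_neg (f : SkewSeries τ) (k : ℕ) : (-f).coeff k = -f.coeff k := rfl
theorem coeff_sub (f g : SkewSeries τ) (k : ℕ) : (f - g).coeff k = f.coeff k - g.coeff k := rfl
theorem coeff_mul (f g : SkewSeries τ) (k : ℕ) : (f * g).coeff k =
    ∑ q ∈ Finset.HasAntidiagonal.antidiagonal k, f.coeff q.1 * (⇑τ)^[q.1] (g.coeff q.2) := rfl

theorem skew_mul_assoc (f g h : SkewSeries τ) : f * g * h = f * (g * h) := by
  ext k
  simp only [coeff_mul, ← RingHom.coe_pow, map_sum, map_mul, Finset.sum_mul, Finset.mul_sum,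
    Finset.sum_sigma']
  refine Finset.sum_nbij' (fun x => ⟨(x.2.1, x.2.2 + x.1.2), (x.2.2, x.1.2)⟩)
    (fun x => ⟨(x.1.1 + x.2.1, x.2.2), (x.1.1, x.2.1)⟩) ?_ ?_ ?_ ?_ ?_
  · rintro ⟨⟨a, b⟩, ⟨c, d⟩⟩ hx
    simp only [Finset.mem_sigma, Finset.HasAntidiagonal.mem_antidiagonal, and_true] at hx ⊢
    omega
  · rintro ⟨⟨a, b⟩, ⟨c, d⟩⟩ hx
    simp only [Finset.mem_sigma, Finset.HasAntidiagonal.mem_antidiagonal, and_true] at hx ⊢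
    omega
  · rintro ⟨⟨a, b⟩, ⟨c, d⟩⟩ hx
    simp only [Finset.mem_sigma, Finset.HasAntidiagonal.mem_antidiagonal] at hx
    obtain ⟨_, rfl⟩ := hx; rfl
  · rintro ⟨⟨a, b⟩, ⟨c, d⟩⟩ hx
    simp only [Finset.mem_sigma, Finset.HasAntidiagonal.mem_antidiagonal] at hx
    obtain ⟨_, rfl⟩ := hx; rfl
  · rintro ⟨⟨a, b⟩, ⟨c, d⟩⟩ hx
    simp only [Finset.mem_sigma, Finset.HasAntidiagonal.mem_antidiagonal] at hx
    obtain ⟨_, rfl⟩ := hx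
    simp only [pow_add, RingHom.mul_def, RingHom.comp_apply, mul_assoc]

theorem skew_one_mul (f : SkewSeries τ) : 1 * f = f := by
  ext k
  rw [coeff_mul, Finset.sum_eq_single (0, k)]
  · simp [coeff_one]
  · rintro ⟨a, b⟩ h1 h2
    have : a ≠ 0 := by
      rintro rfl; exact h2 (by simpa using h1)
    simp [coeff_one, this]
  · simp

theorem skew_mul_one (f : SkewSeries τ) : f * 1 = f := by
  ext k
  simp only [coeff_mul, ← RingHom.coe_pow]
  rw [Finset.sum_eq_single (k, 0)]
  · simp [coeff_one]
  · rintro ⟨a, b⟩ h1 h2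
    have : b ≠ 0 := by
      rintro rfl; exact h2 (by simpa using h1)
    simp [coeff_one, this]
  · simp

instance : Ring (SkewSeries τ) where
  add_assoc f g h := by ext k; simp only [coeff_add]; ring
  zero_add f := by ext k; simp only [coeff_add, coeff_zero]; ring
  add_zero f := by ext k; simp only [coeff_add, coeff_zero]; ring
  add_comm f g := by ext k; simp only [coeff_add]; ring
  neg_add_cancel f := by ext k; simp only [coeff_add, coeff_neg, coeff_zero]; ring
  sub_eq_add_neg f g := by ext k; simp only [coeff_add, coeff_neg, coeff_sub]; ring
  nsmul := nsmulRec
  zsmul := zsmulRec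
  mul_assoc := skew_mul_assoc
  one_mul := skew_one_mul
  mul_one := skew_mul_one
  left_distrib f g h := by
    ext k
    simp only [coeff_mul, coeff_add, ← RingHom.coe_pow, map_add, mul_add, Finset.sum_add_distrib]
  right_distrib f g h := by
    ext k; simp only [coeff_mul, coeff_add, add_mul, Finset.sum_add_distrib]
  zero_mul f := by ext k; simp [coeff_mul, coeff_zero]
  mul_zero f := by ext k; simp [coeff_mul, coeff_zero]

/-- The constant series `r`. -/
def C (r : R) : SkewSeries τ := ⟨fun k => if k = 0 then r else 0⟩

/-- The variable `X`. -/
def X : SkewSeries τ := ⟨fun k => if k = 1 then 1 else 0⟩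

/-- The defining commutation rule `X r = τ(r) X`. -/
theorem X_mul_C (r : R) : (X : SkewSeries τ) * C r = C (τ r) * X := by
  ext k
  rw [coeff_mul, coeff_mul]
  rcases Nat.lt_trichotomy k 1 with hk | rfl | hk
  · obtain rfl : k = 0 := by omega
    simp [X, C]
  · simp [X, C, Finset.Nat.antidiagonal_succ]
  · rw [Finset.sum_eq_zero, Finset.sum_eq_zero]
    · rintro ⟨a, b⟩ h
      have h : a + b = k := by simpa using h
      by_cases ha : a = 0
      · have : b ≠ 1 := by omega
        simp [X, C, this]
      · simp [C, ha]
    · rintro ⟨a, b⟩ h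
      have h : a + b = k := by simpa using h
      by_cases ha : a = 1
      · have : b ≠ 0 := by omega
        simp [X, C, this]
      · simp [X, ha]

/-- A series with constant term `1` is invertible, so `Ring.inverse` is its true inverse. -/
theorem isUnit_of_coeff_zero (f : SkewSeries τ) (hf : f.coeff 0 = 1) : IsUnit f := by
  have key : ∀ f : SkewSeries τ, f.coeff 0 = 1 →
      ∃ g : SkewSeries τ, g.coeff 0 = 1 ∧ f * g = 1 := by
    intro f hf
    obtain ⟨c, hc⟩ : ∃ c : ℕ → R, ∀ m, c m = if m = 0 then 1 else
        -∑ i : Fin m, f.coeff (m - i) * (⇑τ)^[m - (i : ℕ)] (c i) := by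
      refine ⟨WellFounded.fix (C := fun _ => R) Nat.lt_wfRel.wf (fun m ih => if m = 0 then 1 else
        -∑ i : Fin m, f.coeff (m - i) * (⇑τ)^[m - (i : ℕ)] (ih i i.2)), fun m => ?_⟩
      rw [WellFounded.fix_eq]
    refine ⟨⟨c⟩, by change c 0 = 1; rw [hc]; simp, ?_⟩
    ext m
    rw [coeff_mul, coeff_one, Finset.Nat.sum_antidiagonal_eq_sum_range_succ_mk,
      ← Finset.sum_range_reflect, Finset.sum_range_succ]
    by_cases hm : m = 0
    · subst hm; simp [hf, hc 0]
    · have e1 : ∑ j ∈ Finset.range m, f.coeff (m + 1 - 1 - j) *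
          (⇑τ)^[m + 1 - 1 - j] (c (m - (m + 1 - 1 - j)))
          = ∑ i : Fin m, f.coeff (m - i) * (⇑τ)^[m - (i : ℕ)] (c i) := by
        rw [Finset.sum_range]
        refine Finset.sum_congr rfl fun i _ => ?_
        have hi : m - (m - (i : ℕ)) = i := by omega
        rw [Nat.add_sub_cancel, hi]
      dsimp only
      rw [e1]
      simp [hf, hc m, hm]
  obtain ⟨g, hg, hfg⟩ := key f hf
  obtain ⟨k, -, hgk⟩ := key g hg
  have : f = k := by
    calc f = f * (g * k) := by rw [hgk, mul_one]
      _ = k := by rw [← mul_assoc, hfg, one_mul]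
  exact ⟨⟨f, g, hfg, by rw [this]; exact hgk⟩, rfl⟩

end SkewSeries

namespace TypeC

/-! ## The Jacobi–Trudi determinant -/

open SkewSeries in
/-- The generating series `H_a(z, X)`. The list `ofFn` runs through `k = 1, …, n`, so that the
first product is `A_1 ⋯ A_n` and the last one, being reversed, is `A_n ⋯ A_1`. -/
noncomputable def H (n : ℕ) (a : ℂ) : SkewSeries (shift n) :=
  (List.ofFn fun k : Fin n => Ring.inverse (1 - C (zbar n (k + 1) a) * X)).prod
    * Ring.inverse (1 - C (z n n a) * X * C (zbar n n a) * X)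
    * (List.ofFn fun k : Fin n => Ring.inverse (1 - C (z n (k + 1) a) * X)).reverse.prod

/-- `h_{r,a}`, the coefficient of `X^r` in `H_a(z, X)`, and `0` for `r < 0`. -/
noncomputable def h (n : ℕ) (r : ℤ) (a : ℂ) : ZRing n :=
  if 0 ≤ r then (H n a).coeff r.toNat else 0

/-- The length `l(λ)`. -/
def len (lam : YoungDiagram) : ℕ := lam.colLen 0

/-- The Jacobi–Trudi determinant
`χ_{λ/μ,a} = det (h_{λ_i - μ_j - i + j, a + 2(λ_i - i)})_{1 ≤ i,j ≤ l(λ)}`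
(the indices `i`, `j` below start from `0`). -/
noncomputable def chi (n : ℕ) (lam mu : YoungDiagram) (a : ℂ) : ZRing n :=
  Matrix.det (Matrix.of fun i j : Fin (len lam) =>
    h n ((lam.rowLen i : ℤ) - mu.rowLen j - i + j) (a + 2 * ((lam.rowLen i : ℂ) - (i + 1))))

/-- The depth `d(λ/μ) = max_j (λ'_j - μ'_j)`. -/
def depth (lam mu : YoungDiagram) : ℕ :=
  (Finset.range (lam.rowLen 0)).sup fun j => lam.colLen j - mu.colLen j

/-! ## Paths -/

/-- A path of type `C_n`: a lattice path with east and north unit steps from a point of height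
`-n-1` to a point of height `n+1`, without east steps at height `±(n+1)` and with an even number
of east steps at height `0`. It is recorded by the horizontal position `left y` of its leftmost
point at each height `y`; its east steps at height `y` lead from `(left y, y)` to
`(left (y+1), y)`, and then it goes north. The function `left` is extended to all heights by
constants. -/
@[ext]
structure Path (n : ℕ) where
  /-- horizontal position of the leftmost point at a given height -/
  left : ℤ → ℤ
  mono : Monotone left
  left_of_le : ∀ y : ℤ, y ≤ -n → left y = left (-n)
  left_of_ge : ∀ y : ℤ, n + 1 ≤ y → left y = left (n + 1)
  even_zero : Even (left 1 - left 0)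

namespace Path

variable {n : ℕ}

/-- Horizontal position of the rightmost point at a given height. -/
def right (p : Path n) (y : ℤ) : ℤ := p.left (y + 1)

/-- The initial point. -/
def source (p : Path n) : ℤ × ℤ := (p.left (-n - 1), -n - 1)

/-- The final point. -/
def target (p : Path n) : ℤ × ℤ := (p.right (n + 1), n + 1)

/-- The lattice points on the path. -/
def points (p : Path n) : Set (ℤ × ℤ) :=
  {w | -(n : ℤ) - 1 ≤ w.2 ∧ w.2 ≤ n + 1 ∧ p.left w.2 ≤ w.1 ∧ w.1 ≤ p.right w.2}

/-- The variable `z_{L_a(s)}` for the `h`-labelling `L_a` of the east step `s` of `p` from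
`(x, y)` to `(x+1, y)`. At height `0` the labels `n̄, n, n̄, n, …` alternate. -/
noncomputable def stepWeight (p : Path n) (a : ℂ) (x y : ℤ) : ZRing n :=
  if y < 0 then z n (n + 1 + y).toNat (a + 2 * x)
  else if 0 < y then zbar n (n + 1 - y).toNat (a + 2 * x)
  else if Even (x - p.left 0) then zbar n n (a + 2 * x)
  else z n n (a + 2 * x)

/-- The weight `z_a^p`, the product over all east steps. -/
noncomputable def weight (p : Path n) (a : ℂ) : ZRing n :=
  ∏ y ∈ Finset.Icc (-(n : ℤ)) n, ∏ x ∈ Finset.Ico (p.left y) (p.right y), p.stepWeight a x y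

/-- The two paths have a common point. -/
def Intersecting (p q : Path n) : Prop := (p.points ∩ q.points).Nonempty

/-- Specially intersecting pairs. -/
def SpeciallyIntersecting (p q : Path n) : Prop :=
  p.Intersecting q ∧ (∀ w ∈ p.points ∩ q.points, w.2 = 0) ∧ Odd (p.left 0 - q.left 0)

/-- Ordinarily intersecting pairs. -/
def OrdinarilyIntersecting (p q : Path n) : Prop :=
  p.Intersecting q ∧ ¬ p.SpeciallyIntersecting q

end Path

/-- The set `𝔓(u_μ, v_λ)`: pairs of a permutation `σ` and a tuple of paths `p_i` from
`u_i = (μ_i + 1 - i, -n-1)` to `v_{σ(i)}`, where `v_i = (λ_i + 1 - i, n+1)`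
(the indices below start from `0`). -/
def pathTuples (n : ℕ) (lam mu : YoungDiagram) :
    Set (Equiv.Perm (Fin (len lam)) × (Fin (len lam) → Path n)) :=
  {t | ∀ i : Fin (len lam),
    (t.2 i).source = ((mu.rowLen i : ℤ) - i, -(n : ℤ) - 1) ∧
    (t.2 i).target = ((lam.rowLen (t.1 i) : ℤ) - (t.1 i : ℕ), (n : ℤ) + 1)}

/-! ## Lower and upper paths, duals -/

/-- Integers with `±∞`. -/
abbrev ExtInt : Type := WithBot (WithTop ℤ)

/-- An integer as an extended integer. -/
def ExtInt.ofInt (x : ℤ) : ExtInt := ((x : WithTop ℤ) : WithBot (WithTop ℤ))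

/-- An `l`-tuple of lower paths and an `l`-tuple of upper paths, recorded by the horizontal
positions that matter: `alpha i r` is the leftmost position of the lower path number `i` at
height `-r`, and `beta i r` is the rightmost position of the upper path number `i` at height
`r` (here `i` starts from `0`). -/
structure LowerUpper (l : ℕ) where
  alpha : Fin l → ℕ → ℤ
  beta : Fin l → ℕ → ℤ

/-- The pair `π(p) = (α; β)` obtained from a tuple of paths by removing the east steps at height
`0`: `α_i` is the lower half of `p_i`, which starts at `u_i`, and `β_i` is the upper half of the
path that ends at `v_i`. -/
def lowerUpper {n l : ℕ} (t : Equiv.Perm (Fin l) × (Fin l → Path n)) : LowerUpper l where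
  alpha i r := (t.2 i).left (-(r : ℤ))
  beta i r := (t.2 (t.1.symm i)).right (r : ℤ)

namespace LowerUpper

variable {l : ℕ}

/-- `α_i(-r)` for `1 ≤ i ≤ l`, and `+∞` for `i = 0`. -/
def lower (D : LowerUpper l) (i r : ℕ) : ExtInt :=
  if hi : 1 ≤ i ∧ i ≤ l then .ofInt (D.alpha ⟨i - 1, by omega⟩ r) else ⊤

/-- `β_i(r)` for `1 ≤ i ≤ l`, and `-∞` for `i = l + 1`. -/
def upper (D : LowerUpper l) (i r : ℕ) : ExtInt :=
  if hi : 1 ≤ i ∧ i ≤ l then .ofInt (D.beta ⟨i - 1, by omega⟩ r) else ⊥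

/-- `α_i^*(r)`, which is `α_{i-r}(-r) - 1 - r` if `i - r ≥ 1` and `+∞` if `i - r ≤ 0`. -/
def lowerDual (D : LowerUpper l) (i r : ℕ) : ExtInt :=
  if hi : r + 1 ≤ i ∧ i ≤ l then .ofInt (D.alpha ⟨i - r - 1, by omega⟩ r - 1 - r) else ⊤

/-- `β_i^*(-r)`, which is `β_{i+r}(r) + 1 + r` if `i + r ≤ l` and `-∞` if `i + r ≥ l + 1`. -/
def upperDual (D : LowerUpper l) (i r : ℕ) : ExtInt :=
  if hi : 1 ≤ i ∧ i + r ≤ l then .ofInt (D.beta ⟨i + r - 1, by omega⟩ r + 1 + r) else ⊥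

end LowerUpper

/-! ## Units -/

/-- A unit square with vertices in `ℤ²`, given by its lower-left vertex. -/
@[ext]
structure Square where
  x : ℤ
  y : ℤ

namespace Square

/-- The four vertices. -/
def vertices (U : Square) : Set (ℤ × ℤ) :=
  {(U.x, U.y), (U.x + 1, U.y), (U.x, U.y + 1), (U.x + 1, U.y + 1)}

/-- `U ⊂ S_+ = ℝ × [0, n+1]`. -/
def InPlus (n : ℕ) (U : Square) : Prop := 0 ≤ U.y ∧ U.y ≤ n

/-- `U ⊂ S_- = ℝ × [-n-1, 0]`. -/
def InMinus (n : ℕ) (U : Square) : Prop := -(n : ℤ) - 1 ≤ U.y ∧ U.y ≤ -1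

/-- The number `r` with `ht(U) = r` for `U ⊂ S_+` (height of the lower edge) and
`ht(U) = -r` for `U ⊂ S_-` (height of the upper edge). -/
def rank (U : Square) : ℕ := if 0 ≤ U.y then U.y.toNat else (-(U.y + 1)).toNat

/-- The upper-left or the lower-right vertex of `U` is also a vertex of `U'`. -/
def Adjacent (U U' : Square) : Prop :=
  (U.x, U.y + 1) ∈ U'.vertices ∨ (U.x + 1, U.y) ∈ U'.vertices

end Square

/-- The two types of units and regions. -/
inductive Kind
  | I
  | II

/-- `U` is a I-unit (resp. II-unit) of `(α; β)` by virtue of the index `i`. -/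
def UnitAt (n : ℕ) {l : ℕ} (D : LowerUpper l) : Kind → ℕ → Square → Prop
  | .I, i, U => i ≤ l ∧
      ((U.InPlus n ∧ D.lowerDual i U.rank ≤ .ofInt U.x ∧
          .ofInt (U.x + 1) ≤ D.upper (i + 1) U.rank) ∨
       (U.InMinus n ∧ D.lower i U.rank ≤ .ofInt U.x ∧
          .ofInt (U.x + 1) ≤ D.upperDual (i + 1) U.rank))
  | .II, i, U => i ≤ l ∧
      ((U.InPlus n ∧ D.upper (i + 1) U.rank ≤ .ofInt U.x ∧
          .ofInt (U.x + 1) ≤ D.lowerDual i U.rank) ∨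
       (U.InMinus n ∧ D.upperDual (i + 1) U.rank ≤ .ofInt U.x ∧
          .ofInt (U.x + 1) ≤ D.lower i U.rank))

/-- The set of all I-units (resp. II-units) of `(α; β)`. -/
def units (n : ℕ) {l : ℕ} (D : LowerUpper l) (k : Kind) : Set Square :=
  {U | ∃ i, UnitAt n D k i U}

/-- Boundary II-units. -/
def IsBoundary (n : ℕ) {l : ℕ} (D : LowerUpper l) (U : Square) : Prop :=
  ∃ i, UnitAt n D .II i U ∧
    ((U.InPlus n ∧ (i ≤ U.rank ∨ i = l ∨ U.rank = n)) ∨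
     (U.InMinus n ∧ (i = 0 ∨ l ≤ i + U.rank ∨ U.rank = n)))

/-! ## Regions -/

/-- The connected component of the unit `U`: its class for the equivalence relation generated by
adjacency on the I-units (resp. II-units). -/
def component (n : ℕ) {l : ℕ} (D : LowerUpper l) (k : Kind) (U : Square) : Set Square :=
  {U' | Relation.EqvGen
    (fun A B => A ∈ units n D k ∧ B ∈ units n D k ∧ A.Adjacent B) U U'}

/-- `V` (as a set of units) is a I-region (resp. II-region) of `(α; β)`. -/
def IsRegion (n : ℕ) {l : ℕ} (D : LowerUpper l) (k : Kind) (V : Set Square) : Prop :=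
  (∃ U ∈ units n D k, V = component n D k U) ∧
  (∃ U ∈ V, U.rank = 0) ∧
  (k = .II → ∀ U ∈ V, ¬ IsBoundary n D U)

/-- For an integer `h = α_i(0) - β_{i+1}(0)`: the pair `(α_i, β_{i+1})` is an even overlap
(`k = I`), resp. an even hole (`k = II`). -/
def EvenGap : Kind → ℤ → Prop
  | .I, h => Even h ∧ h ≤ 0
  | .II, h => Even h ∧ 0 < h

/-- The number `n(V)` of the even overlaps (resp. even holes) `(α_i, β_{i+1})` which intersect
`V` at height `0`, i.e. have one of their units of height `0` in `V`. (The infinite pairs with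
`i = 0` and `i = l` are neither even nor odd.) -/
noncomputable def evenCount (n : ℕ) {l : ℕ} (D : LowerUpper l) (k : Kind) (V : Set Square) : ℕ :=
  Set.ncard {i : ℕ | ∃ hi : 1 ≤ i ∧ i < l,
    EvenGap k (D.alpha ⟨i - 1, by omega⟩ 0 - D.beta ⟨i, hi.2⟩ 0) ∧
    ∃ U ∈ V, U.rank = 0 ∧ UnitAt n D k i U}

/-- `V` is an odd I-region (resp. II-region) of `(α; β)`. -/
def IsOddRegion (n : ℕ) {l : ℕ} (D : LowerUpper l) (k : Kind) (V : Set Square) : Prop :=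
  IsRegion n D k V ∧ Odd (evenCount n D k V)

/-! ## The set `P₂(λ/μ)` -/

/-- `P₁(λ/μ)`: the path tuples without ordinarily intersecting pairs. -/
def P1 (n : ℕ) (lam mu : YoungDiagram) :
    Set (Equiv.Perm (Fin (len lam)) × (Fin (len lam) → Path n)) :=
  {t | t ∈ pathTuples n lam mu ∧ ∀ i j, i ≠ j → ¬ (t.2 i).OrdinarilyIntersecting (t.2 j)}

/-- `P₂(λ/μ)`: the elements of `P₁(λ/μ)` without odd I- or II-regions. -/
def P2 (n : ℕ) (lam mu : YoungDiagram) :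
    Set (Equiv.Perm (Fin (len lam)) × (Fin (len lam) → Path n)) :=
  {t | t ∈ P1 n lam mu ∧ ∀ k V, ¬ IsOddRegion n (lowerUpper t) k V}

/-- The weight `z_a^p = ∏ z_a^{p_i}` of a tuple of paths. -/
noncomputable def tupleWeight {n l : ℕ} (t : Equiv.Perm (Fin l) × (Fin l → Path n)) (a : ℂ) :
    ZRing n :=
  ∏ i, (t.2 i).weight a

end TypeC

namespace TypeC

/-! ## Matching the two rows at height zero -/

/-- The segments `[P (k+1) + 1, Q (σ k)]` have even length, and those of equal parity are
disjoint. -/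
structure Matched {l : ℕ} (P Q : ℕ → ℤ) (σ : Equiv.Perm (Fin l)) : Prop where
  le : ∀ k : Fin l, P (k + 1) + 1 ≤ Q (σ k)
  even : ∀ k : Fin l, Even (Q (σ k) - (P (k + 1) + 1))
  disj : ∀ k k' : Fin l, k ≠ k' → Even (P (k + 1) - P (k' + 1)) → P (k + 1) ≤ P (k' + 1) →
    Q (σ k) < P (k' + 1) + 1

/-- The smaller entry of the `i`-th pair `(P i, Q i)`, with the convention `P 0 = ∞`. -/
def pairMin (P Q : ℕ → ℤ) (i : ℕ) : ℤ := if i = 0 then Q 0 else min (P i) (Q i)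

/-- The larger entry of the `i`-th pair `(P i, Q i)`, with the convention `Q l = -∞`. -/
def pairMax (l : ℕ) (P Q : ℕ → ℤ) (i : ℕ) : ℤ := if i = l then P l else max (P i) (Q i)

/-- Consecutive pairs `(P i, Q i)` are separated by an odd positive distance. -/
def OddSeparated (l : ℕ) (P Q : ℕ → ℤ) : Prop :=
  ∀ i < l, pairMax l P Q (i + 1) < pairMin P Q i ∧ Odd (pairMin P Q i - pairMax l P Q (i + 1))

theorem exists_initial_segment {l : ℕ} {f : ℕ → ℤ} (hf : ∀ i j, i < j → j < l → f j < f i)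
    (x : ℤ) : ∃ m ≤ l, ∀ j < l, x ≤ f j ↔ j < m := by
  induction l with
  | zero => exact ⟨0, le_rfl, by simp⟩
  | succ l ih =>
    obtain ⟨m, hm, h⟩ := ih fun i j hij hj => hf i j hij (by omega)
    by_cases hx : x ≤ f l
    · refine ⟨l + 1, le_rfl, fun j hj => ⟨fun _ => hj, fun _ => ?_⟩⟩
      rcases Nat.lt_succ_iff_lt_or_eq.1 hj with h1 | rfl
      · exact hx.trans (hf j l h1 (by omega)).le
      · exact hx
    · refine ⟨m, by omega, fun j hj => ?_⟩
      rcases Nat.lt_succ_iff_lt_or_eq.1 hj with h1 | rfl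
      · exact h j h1
      · exact ⟨fun h => absurd h hx, fun h => absurd h (by omega)⟩

theorem card_filter_fin_lt {l m : ℕ} (hm : m ≤ l) :
    (Finset.univ.filter fun j : Fin l => (j : ℕ) < m).card = m := by
  rw [Fin.card_filter_val_lt]; omega

/-- The segments that contain `x`. -/
def cover {l : ℕ} (P Q : ℕ → ℤ) (σ : Equiv.Perm (Fin l)) (x : ℤ) : Finset (Fin l) :=
  Finset.univ.filter fun k => P (k + 1) < x ∧ x ≤ Q (σ k)

theorem mem_cover {l : ℕ} {P Q : ℕ → ℤ} {σ : Equiv.Perm (Fin l)} {x : ℤ} {k : Fin l} :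
    k ∈ cover P Q σ x ↔ P (k + 1) < x ∧ x ≤ Q (σ k) := by
  simp [cover]

namespace Matched

variable {l : ℕ} {P Q : ℕ → ℤ} {σ : Equiv.Perm (Fin l)}

theorem card_cover (h : Matched P Q σ) {x : ℤ} {m m' : ℕ} (hm : m ≤ l) (hm' : m' ≤ l)
    (hQ : ∀ j < l, x ≤ Q j ↔ j < m) (hP : ∀ j < l, x ≤ P (j + 1) ↔ j < m') :
    (cover P Q σ x).card + m' = m := by
  have e1 : (Finset.univ.filter fun k : Fin l => x ≤ Q (σ k)).card = m := by
    rw [← card_filter_fin_lt hm]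
    refine Finset.card_bij (fun k _ => σ k) ?_ (fun _ _ _ _ h => σ.injective h) ?_
    · intro k hk
      simpa [← hQ _ (σ k).2] using hk
    · intro j hj
      refine ⟨σ.symm j, ?_, by simp⟩
      simpa [hQ _ j.2] using hj
  have e2 : (Finset.univ.filter fun k : Fin l => x ≤ P (k + 1)).card = m' := by
    rw [← card_filter_fin_lt hm']
    congr 1
    ext k
    simp [hP _ k.2]
  rw [← e1, ← e2, ← Finset.card_union_of_disjoint]
  · congr 1
    ext k
    simp only [cover, Finset.mem_union, Finset.mem_filter, Finset.mem_univ, true_and]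
    have := h.le k
    omega
  · rw [Finset.disjoint_left]
    intro k hk hk'
    simp only [cover, Finset.mem_filter, Finset.mem_univ, true_and] at hk hk'
    omega

theorem odd_of_cover (h : Matched P Q σ) {x : ℤ} {k k' : Fin l} (hk : k ∈ cover P Q σ x)
    (hk' : k' ∈ cover P Q σ x) (hne : k ≠ k') : Odd (P (k + 1) - P (k' + 1)) := by
  rw [mem_cover] at hk hk'
  rw [← Int.not_even_iff_odd]
  intro he
  rcases le_total (P (k + 1)) (P (k' + 1)) with h1 | h1
  · have := h.disj k k' hne he h1
    omega
  · have := h.disj k' k hne.symm (by rw [← neg_sub]; exact he.neg) h1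
    omega

theorem card_cover_le (h : Matched P Q σ) (x : ℤ) : (cover P Q σ x).card ≤ 2 := by
  by_contra! hc
  obtain ⟨a, b, c, ha, hb, hc, hab, hac, hbc⟩ := Finset.two_lt_card_iff.1 hc
  have h1 := h.odd_of_cover ha hb hab
  have h2 := h.odd_of_cover ha hc hac
  have h3 := h.odd_of_cover hb hc hbc
  rw [Int.odd_iff] at h1 h2 h3
  omega

variable (hP : ∀ i j, 1 ≤ i → i < j → j ≤ l → P j < P i) (hQ : ∀ i j, i < j → j < l → Q j < Q i)

include hP hQ

theorem exists_card_cover (h : Matched P Q σ) (x : ℤ) : ∃ m m' : ℕ, m ≤ l ∧ m' ≤ l ∧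
    (∀ j < l, x ≤ Q j ↔ j < m) ∧ (∀ j < l, x ≤ P (j + 1) ↔ j < m') ∧
    (cover P Q σ x).card + m' = m := by
  obtain ⟨m, hm, h1⟩ := exists_initial_segment hQ x
  obtain ⟨m', hm', h2⟩ := exists_initial_segment (f := fun j => P (j + 1)) (l := l)
    (fun i j hij hj => hP _ _ (by omega) (by omega) (by omega)) x
  exact ⟨m, m', hm, hm', h1, h2, h.card_cover hm hm' h1 h2⟩

theorem lt_same (h : Matched P Q σ) {j : ℕ} (hj : j < l) : P (j + 1) < Q j := by
  obtain ⟨m, m', hm, hm', h1, h2, hc⟩ := h.exists_card_cover hP hQ (P (j + 1) + 1)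
  have hmem : (⟨j, hj⟩ : Fin l) ∈ cover P Q σ (P (j + 1) + 1) := by
    rw [mem_cover]
    exact ⟨by simp, h.le ⟨j, hj⟩⟩
  have := Finset.card_pos.2 ⟨_, hmem⟩
  have e : m' = j := by
    apply le_antisymm
    · by_contra! hlt
      have := (h2 j hj).2 hlt
      omega
    · by_contra! hlt
      have h3 : ¬ (P (j + 1) + 1 ≤ P (m' + 1)) := fun h4 => by
        have := (h2 m' (by omega)).1 h4
        omega
      have := hP (m' + 1) (j + 1) (by omega) (by omega) (by omega)
      omega
  have := (h1 j hj).2 (by omega)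
  omega

theorem le_next (h : Matched P Q σ) {i : ℕ} (hi : 1 ≤ i) (hil : i + 1 < l) : Q (i + 1) ≤ P i := by
  by_contra! hlt
  obtain ⟨m, m', hm, hm', h1, h2, hc⟩ := h.exists_card_cover hP hQ (P i + 1)
  have := h.card_cover_le (P i + 1)
  have e1 := (h1 (i + 1) hil).1 (by omega)
  have e2 : m' ≤ i - 1 := by
    by_contra! h3
    have := (h2 (i - 1) (by omega)).2 h3
    rw [Nat.sub_add_cancel hi] at this
    omega
  omega

theorem oddSeparated (h : Matched P Q σ) : OddSeparated l P Q := by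
  intro i hi
  obtain ⟨s, hs⟩ : ∃ s, s = pairMin P Q i := ⟨_, rfl⟩
  obtain ⟨M, hM⟩ : ∃ M, M = pairMax l P Q (i + 1) := ⟨_, rfl⟩
  have s1 : i ≠ 0 → s ≤ P i := fun h0 => by simp [hs, pairMin, h0]
  have s2 : s ≤ Q i := by
    by_cases h0 : i = 0 <;> simp [hs, pairMin, h0]
  have s3 : s = Q i ∨ (i ≠ 0 ∧ s = P i ∧ P i < Q i) := by
    by_cases h0 : i = 0
    · simp [hs, pairMin, h0]
    · simp only [hs, pairMin, h0, if_false]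
      omega
  have M1 : P (i + 1) ≤ M := by
    by_cases h0 : i + 1 = l
    · simp [hM, pairMax, h0]
    · simp [hM, pairMax, h0]
  have M2 : i + 1 < l → Q (i + 1) ≤ M := fun h0 => by
    simp [hM, pairMax, h0.ne]
  have M3 : M = P (i + 1) ∨ (i + 1 < l ∧ M = Q (i + 1) ∧ P (i + 1) < Q (i + 1)) := by
    by_cases h0 : i + 1 = l
    · simp [hM, pairMax, h0]
    · simp only [hM, pairMax, h0, if_false]
      omega
  have o1 := h.lt_same hP hQ hi
  have o2 : i ≠ 0 → i + 1 < l → Q (i + 1) ≤ P i := fun h0 h1 => h.le_next hP hQ (by omega) h1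
  have o3 : i ≠ 0 → P (i + 1) < P i := fun h0 => hP _ _ (by omega) (by omega) (by omega)
  have o4 : i + 1 < l → Q (i + 1) < Q i := fun h0 => hQ _ _ (by omega) h0
  have hMs : M ≤ s := by
    rcases s3 with e | ⟨h0, e, h1⟩ <;> rcases M3 with e' | ⟨h2, e', h3⟩
    · omega
    · have := o4 h2; omega
    · have := o3 h0; omega
    · have := o2 h0 h2; omega
  -- the positions of the other entries
  have pPlow : ∀ j < l, P (j + 1) < s → i ≤ j := fun j hj h1 => by
    by_contra! h2
    rcases Nat.lt_or_ge (j + 1) i with h3 | h3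
    · have := hP (j + 1) i (by omega) h3 (by omega)
      have := s1 (by omega)
      omega
    · obtain rfl : j + 1 = i := by omega
      have := s1 (by omega)
      omega
  have pPle : ∀ j < l, i ≤ j → P (j + 1) ≤ P (i + 1) := fun j hj h1 => by
    rcases h1.eq_or_lt with rfl | h1
    · exact le_rfl
    · exact (hP _ _ (by omega) (by omega) (by omega)).le
  -- the segment running through the gap
  obtain ⟨k, k1, k2, k3, k4⟩ : ∃ k : Fin l, P (k + 1) < s ∧ P (k + 1) < M + 1 ∧ s ≤ Q (σ k) ∧
      M + 1 ≤ Q (σ k) := by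
    rcases hMs.lt_or_eq with hlt | heq
    · obtain ⟨m, m', hm, hm', h1, h2, hc⟩ := h.exists_card_cover hP hQ s
      have e1 : i + 1 ≤ m := (h1 i hi).1 s2
      have e2 : m' ≤ i := by
        by_contra! h3
        have := (h2 i hi).2 h3
        omega
      obtain ⟨k, hk⟩ := Finset.card_pos.1 (show 0 < (cover P Q σ s).card by omega)
      rw [mem_cover] at hk
      have := pPle k k.2 (pPlow k k.2 hk.1)
      exact ⟨k, hk.1, by omega, hk.2, by omega⟩
    · have hi0 : i ≠ 0 ∧ s = P i ∧ P i < Q i := by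
        rcases s3 with e | h3
        · exfalso
          rcases M3 with e' | ⟨h2, e', h3⟩
          · omega
          · have := o4 h2; omega
        · exact h3
      obtain ⟨m, m', hm, hm', h1, h2, hc⟩ := h.exists_card_cover hP hQ (s + 1)
      have e1 : i + 1 ≤ m := (h1 i hi).1 (by omega)
      have e2 : m' ≤ i - 1 := by
        by_contra! h3
        have := (h2 (i - 1) (by omega)).2 h3
        rw [Nat.sub_add_cancel (by omega)] at this
        omega
      obtain ⟨k, hk, hk'⟩ := Finset.exists_mem_ne (show 1 < (cover P Q σ (s + 1)).card by omega)
        (⟨i - 1, by omega⟩ : Fin l)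
      rw [mem_cover] at hk
      have : P (k + 1) ≠ s := fun h3 => by
        rcases lt_trichotomy ((k : ℕ) + 1) i with h4 | h4 | h4
        · have := hP _ _ (by omega) h4 (by omega)
          omega
        · exact hk' (Fin.ext (by simp; omega))
        · have := hP _ _ (by omega) h4 (by have := k.2; omega)
          omega
      exact ⟨k, by omega, by omega, by omega, by omega⟩
  have top : Even (P (k + 1) + 1 - s) := by
    rcases s3 with e | ⟨h0, e, h1⟩
    · by_cases hk : σ k = ⟨i, hi⟩
      · have := h.even k
        rw [hk] at this
        rw [e, ← neg_sub]
        exact this.neg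
      · exfalso
        obtain ⟨m, m', hm, hm', h1, h2, hc⟩ := h.exists_card_cover hP hQ s
        have e1 : m ≤ i + 1 := by
          by_contra! h3
          have := (h1 (i + 1) (by omega)).2 h3
          have := o4 (by omega)
          omega
        have e2 : i ≤ m' := by
          rcases Nat.eq_zero_or_pos i with h3 | h3
          · omega
          · have := (h2 (i - 1) (by omega)).1 (by
              rw [Nat.sub_add_cancel h3]; exact s1 (by omega))
            omega
        have hk1 : k ∈ cover P Q σ s := mem_cover.2 ⟨k1, k3⟩
        have hk2 : σ.symm ⟨i, hi⟩ ∈ cover P Q σ s := by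
          have := h.le (σ.symm ⟨i, hi⟩)
          rw [mem_cover]
          simp only [Equiv.apply_symm_apply] at this ⊢
          omega
        have := Finset.one_lt_card.2 ⟨_, hk1, _, hk2, fun h3 => hk (by rw [h3]; simp)⟩
        omega
    · have hk1 : (⟨i - 1, by omega⟩ : Fin l) ∈ cover P Q σ (s + 1) := by
        have := h.le ⟨i - 1, by omega⟩
        rw [mem_cover]
        simp only [Nat.sub_add_cancel (show 1 ≤ i by omega)] at this ⊢
        omega
      have hk2 : k ∈ cover P Q σ (s + 1) := by
        rw [mem_cover]
        refine ⟨by omega, ?_⟩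
        by_contra! h3
        have h4 : Q (σ k) = s := by omega
        have h5 : i < σ k := by
          by_contra! h5
          rcases h5.eq_or_lt with h5 | h5
          · rw [h5] at h4; omega
          · have := hQ _ _ h5 hi; omega
        have : Q (σ k) ≤ Q (i + 1) := by
          rcases (Nat.succ_le_of_lt h5).eq_or_lt with h6 | h6
          · rw [← h6]
          · exact (hQ _ _ h6 (σ k).2).le
        have := M2 (by have := (σ k).2; omega)
        omega
      have := h.odd_of_cover hk1 hk2 (fun h3 => by
        rw [← h3] at k1
        simp only [Nat.sub_add_cancel (show 1 ≤ i by omega)] at k1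
        omega)
      simp only [Nat.sub_add_cancel (show 1 ≤ i by omega)] at this
      rw [Int.odd_iff] at this
      rw [Int.even_iff]
      omega
  have bot : Even (P (k + 1) - M) := by
    rcases M3 with e | ⟨h0, e, h1⟩
    · by_cases hk : k = ⟨i, hi⟩
      · simp [hk, e]
      · exfalso
        obtain ⟨m, m', hm, hm', h1, h2, hc⟩ := h.exists_card_cover hP hQ (M + 1)
        have e1 : m ≤ i + 1 := by
          by_contra! h3
          have := (h1 (i + 1) (by omega)).2 h3
          have := M2 (by omega)
          omega
        have e2 : i ≤ m' := by
          rcases Nat.eq_zero_or_pos i with h3 | h3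
          · omega
          · have := (h2 (i - 1) (by omega)).1 (by
              rw [Nat.sub_add_cancel h3]; have := o3 (by omega); omega)
            omega
        have hk1 : k ∈ cover P Q σ (M + 1) := mem_cover.2 ⟨k2, k4⟩
        have hk2 : (⟨i, hi⟩ : Fin l) ∈ cover P Q σ (M + 1) := by
          have := h.le ⟨i, hi⟩
          rw [mem_cover]
          simp only at this ⊢
          omega
        have := Finset.one_lt_card.2 ⟨_, hk1, _, hk2, hk⟩
        omega
    · have hk1 : σ.symm ⟨i + 1, h0⟩ ∈ cover P Q σ M := by
        have := h.le (σ.symm ⟨i + 1, h0⟩)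
        rw [mem_cover]
        simp only [Equiv.apply_symm_apply] at this ⊢
        omega
      have hk2 : k ∈ cover P Q σ M := by
        rw [mem_cover]
        refine ⟨?_, by omega⟩
        by_contra! h3
        have := pPle k k.2 (pPlow k k.2 k1)
        omega
      have h2 := h.odd_of_cover hk1 hk2 (fun h3 => by
        rw [← h3] at k4
        simp only [Equiv.apply_symm_apply] at k4
        omega)
      have h3 := h.even (σ.symm ⟨i + 1, h0⟩)
      simp only [Equiv.apply_symm_apply] at h3
      rw [Int.odd_iff] at h2
      rw [Int.even_iff] at h3 ⊢
      omega
  rw [← hs, ← hM]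
  rw [Int.even_iff] at top bot
  rw [Int.odd_iff]
  omega

end Matched

/-! ## Permutations that hop along runs -/

/-- `m` is the beginning of the run of `E` that ends before `k`. -/
structure IsRunStart (E : ℕ → Prop) (m k : ℕ) : Prop where
  le : m ≤ k
  run : ∀ i, m ≤ i → i < k → E i
  start : m = 0 ∨ ¬ E (m - 1)

open Classical in
/-- The product of the transpositions `(i, i+1)` for `i < j` with `E i`. -/
noncomputable def hopPerm (l : ℕ) (E : ℕ → Prop) : ℕ → Equiv.Perm (Fin l)
  | 0 => 1
  | j + 1 => hopPerm l E j *
      (if h : j + 1 < l ∧ E j then Equiv.swap ⟨j, by omega⟩ ⟨j + 1, h.1⟩ else (1 : Equiv.Perm (Fin l)))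

theorem hopPerm_spec {l : ℕ} {E : ℕ → Prop} (j : ℕ) (hj : j < l) :
    (∀ k : Fin l, j < k → hopPerm l E j k = k) ∧
    (∀ k : Fin l, (k : ℕ) < j → (E k → (hopPerm l E j k : ℕ) = k + 1) ∧
      (¬ E k → IsRunStart E (hopPerm l E j k) k)) ∧
    IsRunStart E (hopPerm l E j ⟨j, hj⟩) j := by
  induction j with
  | zero =>
    refine ⟨fun k _ => rfl, fun k hk => absurd hk (by omega), ⟨le_rfl, ?_, Or.inl rfl⟩⟩
    intro i _ hi
    omega
  | succ j ih =>
    obtain ⟨h1, h2, h3⟩ := ih (by omega)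
    by_cases hE : E j
    · have e : hopPerm l E (j + 1) =
          hopPerm l E j * Equiv.swap ⟨j, by omega⟩ ⟨j + 1, hj⟩ := by
        simp [hopPerm, hj, hE]
      rw [e]
      refine ⟨fun k hk => ?_, fun k hk => ?_, ?_⟩
      · rw [Equiv.Perm.mul_apply, Equiv.swap_apply_of_ne_of_ne, h1 k (by omega)]
        · exact fun h => by simp [h] at hk
        · exact fun h => by simp [h] at hk
      · rcases Nat.lt_succ_iff_lt_or_eq.1 hk with hk' | hk'
        · rw [Equiv.Perm.mul_apply, Equiv.swap_apply_of_ne_of_ne]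
          · exact h2 k hk'
          · exact fun h => by simp [h] at hk'
          · exact fun h => by simp [h] at hk'
        · obtain ⟨k, hk0⟩ := k
          obtain rfl : k = j := hk'
          rw [Equiv.Perm.mul_apply, Equiv.swap_apply_left, h1 _ (by simp)]
          exact ⟨fun _ => rfl, fun h => absurd hE h⟩
      · rw [Equiv.Perm.mul_apply, Equiv.swap_apply_right]
        refine ⟨h3.le.trans (by omega), fun i hi hij => ?_, h3.start⟩
        rcases Nat.lt_succ_iff_lt_or_eq.1 hij with h4 | rfl
        · exact h3.run i hi h4
        · exact hE
    · have e : hopPerm l E (j + 1) = hopPerm l E j := by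
        simp [hopPerm, hE]
      rw [e]
      refine ⟨fun k hk => h1 k (by omega), fun k hk => ?_, ?_⟩
      · rcases Nat.lt_succ_iff_lt_or_eq.1 hk with hk' | hk'
        · exact h2 k hk'
        · obtain ⟨k, hk0⟩ := k
          obtain rfl : k = j := hk'
          exact ⟨fun h => absurd h hE, fun _ => h3⟩
      · rw [h1 _ (by simp)]
        exact ⟨le_rfl, fun i hi hij => by simp at hi; omega, Or.inr (by simpa using hE)⟩

open Classical in
theorem sign_hopPerm {l : ℕ} {E : ℕ → Prop} (j : ℕ) :
    Equiv.Perm.sign (hopPerm l E j) =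
      (-1) ^ ((Finset.range j).filter fun i => i + 1 < l ∧ E i).card := by
  induction j with
  | zero => simp [hopPerm]
  | succ j ih =>
    rw [hopPerm, Equiv.Perm.sign_mul, ih, Finset.range_add_one, Finset.filter_insert]
    by_cases h : j + 1 < l ∧ E j
    · rw [dif_pos h, if_pos h, Finset.card_insert_of_notMem (by simp), pow_succ,
        Equiv.Perm.sign_swap]
      simp
    · rw [dif_neg h, if_neg h]
      simp

/-- The pair `(P i, Q i)` is an even overlap. -/
def OverlapAt (l : ℕ) (P Q : ℕ → ℤ) (i : ℕ) : Prop :=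
  i < l ∧ P i < Q i ∧ Odd (P i - Q i)

theorem OddSeparated.matched_hopPerm {l : ℕ} {P Q : ℕ → ℤ}
    (h : OddSeparated l P Q) :
    Matched P Q (hopPerm l (fun k => OverlapAt l P Q (k + 1)) (l - 1)) := by
  set E : ℕ → Prop := fun k => OverlapAt l P Q (k + 1) with hE
  rcases Nat.eq_zero_or_pos l with rfl | hl
  · exact ⟨fun k => k.elim0, fun k => k.elim0, fun k => k.elim0⟩
  have spec : ∀ k : Fin l, (E k → (hopPerm l E (l - 1) k : ℕ) = k + 1) ∧
      (¬ E k → IsRunStart E (hopPerm l E (l - 1) k) k) := by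
    obtain ⟨-, h2, h3⟩ := hopPerm_spec (E := E) (l - 1) (by omega : l - 1 < l)
    intro k
    by_cases hk : (k : ℕ) < l - 1
    · exact h2 k hk
    · obtain ⟨k, hk0⟩ := k
      obtain rfl : k = l - 1 := by simp only at hk; omega
      refine ⟨fun h4 => ?_, fun _ => h3⟩
      have := h4.1
      simp only at this
      omega
  set σ := hopPerm l E (l - 1)
  have m0 : pairMin P Q 0 = Q 0 := by simp [pairMin]
  have mP : ∀ i, i ≠ 0 → pairMin P Q i ≤ P i := fun i hi => by simp [pairMin, hi]
  have mQ : ∀ i, pairMin P Q i ≤ Q i := fun i => by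
    by_cases h0 : i = 0 <;> simp [pairMin, h0]
  have MP : ∀ i, P i ≤ pairMax l P Q i := fun i => by
    by_cases h0 : i = l <;> simp [pairMax, h0]
  have MQ : ∀ i, i ≠ l → Q i ≤ pairMax l P Q i := fun i hi => by simp [pairMax, hi]
  have mE : ∀ i, E i → pairMin P Q (i + 1) = P (i + 1) ∧ pairMax l P Q (i + 1) = Q (i + 1) :=
    fun i hi => by
      have := hi.1
      simp only [pairMin, pairMax, Nat.add_one_ne_zero, if_false, this.ne]
      exact ⟨min_eq_left hi.2.1.le, max_eq_right hi.2.1.le⟩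
  have mN : ∀ i, ¬ E i → i + 1 < l → Even (pairMin P Q (i + 1) - Q (i + 1)) := fun i hi hl => by
    simp only [pairMin, Nat.add_one_ne_zero, if_false]
    rcases le_or_gt (Q (i + 1)) (P (i + 1)) with h1 | h1
    · simp [min_eq_right h1]
    · rw [min_eq_left h1.le]
      by_contra h2
      exact hi ⟨hl, h1, Int.not_even_iff_odd.1 h2⟩
  have MN : ∀ i, ¬ E i → i < l → Even (pairMax l P Q (i + 1) - P (i + 1)) := fun i hi hl => by
    by_cases h0 : i + 1 = l
    · simp [pairMax, h0]
    · simp only [pairMax, h0, if_false]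
      rcases le_or_gt (Q (i + 1)) (P (i + 1)) with h1 | h1
      · simp [max_eq_left h1]
      · rw [max_eq_right h1.le]
        by_contra h2
        refine hi ⟨by omega, h1, ?_⟩
        rw [Int.not_even_iff_odd] at h2
        rw [← neg_sub]
        exact h2.neg
  -- along a run
  have run : ∀ m k, k < l → m ≤ k → (∀ i, m ≤ i → i < k → E i) →
      pairMin P Q k ≤ pairMin P Q m ∧ Even (pairMin P Q k - pairMin P Q m) := by
    intro m k hk hmk hr
    induction k, hmk using Nat.le_induction with
    | base => simp
    | succ k hmk ih =>
      obtain ⟨i1, i2⟩ := ih (by omega) fun i h1 h2 => hr i h1 (by omega)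
      obtain ⟨h1, h2⟩ := h k (by omega)
      have h3 := hr k hmk (by omega)
      obtain ⟨e1, e2⟩ := mE k h3
      obtain ⟨-, h4, h5⟩ := h3
      rw [e2] at h1 h2
      rw [e1]
      rw [Int.odd_iff] at h2 h5
      rw [Int.even_iff] at i2 ⊢
      omega
  have anti : ∀ i j, i < j → j < l → pairMax l P Q j < pairMin P Q i := by
    intro i j hij
    induction j, Nat.succ_le_of_lt hij using Nat.le_induction with
    | base => exact fun hj => (h i (by omega)).1
    | succ j hj ih =>
      intro hjl
      have h1 := ih (by omega) (by omega)
      have h2 := (h j (by omega)).1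
      have h3 := mQ j
      have h4 := MQ j (by omega)
      omega
  have startParity : ∀ k : Fin l, ¬ E k → Even (pairMin P Q (σ k) - Q (σ k)) := fun k hk => by
    rcases ((spec k).2 hk).start with h0 | h0
    · rw [h0, m0]; simp
    · by_cases h1 : (σ k : ℕ) = 0
      · rw [h1, m0]; simp
      · have := mN _ h0 (by have := (σ k).2; omega)
        rwa [Nat.sub_add_cancel (by omega)] at this
  have key : ∀ k : Fin l, ¬ E k → P (k + 1) < Q (σ k) ∧ Odd (Q (σ k) - P (k + 1)) := fun k hk => by
    have s := (spec k).2 hk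
    obtain ⟨r1, r2⟩ := run (σ k) k k.2 s.le s.run
    obtain ⟨h1, h2⟩ := h k k.2
    have h3 := startParity k hk
    have h4 := MN k hk k.2
    have h5 := MP (k + 1)
    have h6 := mQ (σ k)
    rw [Int.even_iff] at r2 h3 h4
    rw [Int.odd_iff] at h2 ⊢
    omega
  refine ⟨fun k => ?_, fun k => ?_, fun k k' hne he hle => ?_⟩
  · by_cases hk : E k
    · rw [(spec k).1 hk]
      exact hk.2.1
    · exact (key k hk).1
  · by_cases hk : E k
    · rw [(spec k).1 hk]
      have := hk.2.2
      rw [Int.odd_iff] at this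
      rw [Int.even_iff]
      omega
    · have := (key k hk).2
      rw [Int.odd_iff] at this
      rw [Int.even_iff]
      omega
  · have hlt : (k' : ℕ) < k := by
      by_contra! h1
      have h1 : (k : ℕ) < k' := lt_of_le_of_ne h1 fun h => hne (Fin.ext h)
      have h2 : P (k' + 1) < P (k + 1) := by
        have h5 := mP (k + 1) (by omega)
        have h6 := MP (k' + 1)
        rcases Nat.lt_or_ge (k' + 1) l with h7 | h7
        · have := anti (k + 1) (k' + 1) (by omega) h7
          omega
        · have h8 := (h k' k'.2).1
          rcases Nat.lt_or_ge (k + 1) k' with h9 | h9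
          · have := anti (k + 1) k' h9 k'.2
            have := mQ k'
            have := MQ k' (by have := k'.2; omega)
            omega
          · have : (k : ℕ) + 1 = k' := by omega
            rw [this] at h5 ⊢
            omega
      omega
    have far : (k' : ℕ) + 2 ≤ σ k → Q (σ k) < P (k' + 1) + 1 := fun h1 => by
      have h2 := anti (k' + 1) (σ k) (by omega) (σ k).2
      have h3 := mP (k' + 1) (by omega)
      have h4 := MQ (σ k) (by have := (σ k).2; omega)
      omega
    by_cases hk : E k
    · exact far (by rw [(spec k).1 hk]; omega)
    · have s := (spec k).2 hk
      rcases Nat.lt_or_ge (σ k) (k' + 2) with h1 | h1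
      swap
      · exact far h1
      have h2 := (key k hk).2
      rw [Int.odd_iff] at h2
      rw [Int.even_iff] at he
      rcases Nat.lt_or_ge k' (σ k) with h3 | h3
      · obtain h4 : (σ k : ℕ) = k' + 1 := by omega
        rcases s.start with h5 | h5
        · omega
        · rw [h4, Nat.add_sub_cancel] at h5
          rw [h4] at h2 ⊢
          by_contra! h6
          refine h5 ⟨by omega, by omega, ?_⟩
          rw [Int.odd_iff]
          omega
      · exfalso
        have h4 := (run (σ k) (k' + 1) (by omega) (by omega) fun i hi hi' =>
          s.run i hi (by omega)).2
        have h5 := startParity k hk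
        have h6 := (mE k' (s.run k' h3 hlt)).1
        rw [Int.even_iff] at h4 h5
        omega

theorem Matched.unique {l : ℕ} {P Q : ℕ → ℤ} {σ τ : Equiv.Perm (Fin l)} (h : Matched P Q σ)
    (h' : Matched P Q τ) : σ = τ := by
  have key : ∀ {σ τ : Equiv.Perm (Fin l)}, Matched P Q σ → Matched P Q τ → ∀ k,
      Q (τ k) ≤ Q (σ k) → τ k = σ k := by
    intro σ τ h h' k hle
    by_contra hne
    have h1 := h.le (σ.symm (τ k))
    have h2 := h.even (σ.symm (τ k))
    have h3 := h.le k
    have h4 := h.even k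
    have h5 := h'.le k
    have h6 := h'.even k
    have hk : σ.symm (τ k) ≠ k := fun h7 => hne (by rw [← σ.apply_symm_apply (τ k), h7])
    rw [Equiv.apply_symm_apply] at h1 h2
    rw [Int.even_iff] at h2 h4 h6
    rcases le_total (P (k + 1)) (P (σ.symm (τ k) + 1)) with h7 | h7
    · have := h.disj _ _ hk.symm (by rw [Int.even_iff]; omega) h7
      omega
    · have := h.disj _ _ hk (by rw [Int.even_iff]; omega) h7
      rw [Equiv.apply_symm_apply] at this
      omega
  ext k
  rcases le_total (Q (τ k)) (Q (σ k)) with h1 | h1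
  · rw [key h h' k h1]
  · rw [key h' h k h1]

open Classical in
theorem Matched.sign_eq {l : ℕ} {P Q : ℕ → ℤ} {σ : Equiv.Perm (Fin l)} (h : Matched P Q σ)
    (hP : ∀ i j, 1 ≤ i → i < j → j ≤ l → P j < P i) (hQ : ∀ i j, i < j → j < l → Q j < Q i) :
    Equiv.Perm.sign σ =
      (-1) ^ ((Finset.range (l - 1)).filter fun i => OverlapAt l P Q (i + 1)).card := by
  rw [h.unique (h.oddSeparated hP hQ).matched_hopPerm, sign_hopPerm]
  congr 2
  ext i
  simp only [Finset.mem_filter, Finset.mem_range]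
  exact and_congr_right fun _ => ⟨fun h => h.2, fun h => ⟨h.1, h⟩⟩

theorem OddSeparated.of_swap {l : ℕ} {P Q P' Q' : ℕ → ℤ} (h : OddSeparated l P Q)
    (h0 : Q' 0 = Q 0) (hl : P' l = P l)
    (hs : ∀ i, 1 ≤ i → i < l → (P' i = P i ∧ Q' i = Q i) ∨ (P' i = Q i ∧ Q' i = P i)) :
    OddSeparated l P' Q' := by
  have e1 : ∀ i < l, pairMin P' Q' i = pairMin P Q i := fun i hi => by
    by_cases hi0 : i = 0
    · simp [pairMin, hi0, h0]
    · rcases hs i (by omega) hi with ⟨a, b⟩ | ⟨a, b⟩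
      · simp [pairMin, a, b, hi0]
      · simp [pairMin, a, b, hi0, min_comm]
  have e2 : ∀ i, 1 ≤ i → i ≤ l → pairMax l P' Q' i = pairMax l P Q i := fun i h1 hi => by
    by_cases hi0 : i = l
    · simp [pairMax, hi0, hl]
    · rcases hs i h1 (by omega) with ⟨a, b⟩ | ⟨a, b⟩
      · simp [pairMax, a, b, hi0]
      · simp [pairMax, a, b, hi0, max_comm]
  intro i hi
  rw [e1 i hi, e2 (i + 1) (by omega) (by omega)]
  exact h i hi

/-! ## Units in dual coordinates -/

namespace Kind

/-- The other kind. -/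
def swap : Kind → Kind
  | .I => .II
  | .II => .I

@[simp] theorem swap_swap (k : Kind) : k.swap.swap = k := by cases k <;> rfl

theorem eq_or_eq_swap (k k' : Kind) : k' = k ∨ k' = k.swap := by cases k <;> cases k' <;> simp [swap]

end Kind

namespace LowerUpper

variable {l : ℕ}

/-- The finite values `α_i^*(r)`, for `r < i ≤ l + r`. -/
def A (D : LowerUpper l) (r i : ℕ) : ℤ :=
  if h : r < i ∧ i ≤ l + r then D.alpha ⟨i - r - 1, by omega⟩ r - 1 - r else 0

/-- The finite values `β_{i+1}(r)`, for `i < l`. -/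
def B (D : LowerUpper l) (r i : ℕ) : ℤ := if h : i < l then D.beta ⟨i, h⟩ r else 0

theorem A_alpha (D : LowerUpper l) (j : Fin l) (r : ℕ) : D.A r (j + 1 + r) = D.alpha j r - 1 - r := by
  have : r < j + 1 + r ∧ j + 1 + r ≤ l + r := by omega
  simp only [A, this, and_self, dif_pos]
  congr 3
  ext
  simp only
  omega

theorem B_beta (D : LowerUpper l) (j : Fin l) (r : ℕ) : D.B r j = D.beta j r := by
  simp [B]

/-- The position `x` at rank `r` lies in the row at `i` (of upper type). -/
def Occ (D : LowerUpper l) (k : Kind) (r i : ℕ) (x : ℤ) : Prop :=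
  match k with
  | .I => r < i ∧ i < l ∧ D.A r i ≤ x ∧ x < D.B r i
  | .II => (i < l → D.B r i ≤ x) ∧ (r < i → x < D.A r i)

end LowerUpper

namespace ExtInt

theorem ofInt_le_ofInt {x y : ℤ} : ofInt x ≤ ofInt y ↔ x ≤ y := by simp [ofInt]
theorem not_top_le (x : ℤ) : ¬ ((⊤ : ExtInt) ≤ ofInt x) := by
  rw [top_le_iff, ofInt]
  intro h
  have : ((x : WithTop ℤ) : WithBot (WithTop ℤ)) = ((⊤ : WithTop ℤ) : WithBot (WithTop ℤ)) := h
  rw [WithBot.coe_inj] at this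
  exact WithTop.coe_ne_top this
theorem not_le_bot (x : ℤ) : ¬ (ofInt x ≤ (⊥ : ExtInt)) := by simp [ofInt]

end ExtInt

namespace Square

/-- The index shift between a square and the upper square of the same dual position. -/
def shift (U : Square) : ℕ := if 0 ≤ U.y then 0 else U.rank

/-- The horizontal position of the upper square which equals `U` or is dual to it. -/
def pos (U : Square) : ℤ := if 0 ≤ U.y then U.x else U.x + U.y

/-- The dual square. -/
def dual (U : Square) : Square :=
  ⟨if 0 ≤ U.y then U.x + U.y + 1 else U.x + U.y, -1 - U.y⟩

theorem rank_of_nonneg {U : Square} (h : 0 ≤ U.y) : (U.rank : ℤ) = U.y := by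
  simp [rank, h]

theorem rank_of_neg {U : Square} (h : ¬ 0 ≤ U.y) : (U.rank : ℤ) = -U.y - 1 := by
  simp only [rank, h, if_false]
  omega

theorem rank_dual (U : Square) : U.dual.rank = U.rank := by
  by_cases h : 0 ≤ U.y
  · have h' : ¬ 0 ≤ -1 - U.y := by omega
    simp only [rank, dual, h, h', if_true, if_false]
    omega
  · have h' : 0 ≤ -1 - U.y := by omega
    simp only [rank, dual, h, h', if_true, if_false]
    omega

theorem pos_dual (U : Square) : U.dual.pos = U.pos := by
  simp only [pos, dual]
  split_ifs <;> omega

theorem dual_dual (U : Square) : U.dual.dual = U := by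
  ext
  · simp only [dual]
    split_ifs <;> omega
  · simp only [dual]
    omega

theorem adjacent_iff {U U' : Square} : U.Adjacent U' ↔
    (U'.y = U.y ∧ (U'.x = U.x - 1 ∨ U'.x = U.x ∨ U'.x = U.x + 1) ∧ U'.x ≠ U.x) ∨
    (U'.y = U.y + 1 ∧ (U'.x = U.x - 1 ∨ U'.x = U.x)) ∨
    (U'.y = U.y - 1 ∧ (U'.x = U.x + 1 ∨ U'.x = U.x)) ∨ U' = U := by
  simp only [Adjacent, vertices, Set.mem_insert_iff, Set.mem_singleton_iff, Prod.mk.injEq,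
    Square.ext_iff]
  omega

theorem Adjacent.symm {U U' : Square} (h : U.Adjacent U') : U'.Adjacent U := by
  rw [adjacent_iff, Square.ext_iff] at *
  omega

theorem Adjacent.dual {U U' : Square} (h : U.Adjacent U') (h0 : U'.rank ≠ 0) :
    U.dual.Adjacent U'.dual := by
  rw [adjacent_iff, Square.ext_iff] at h ⊢
  by_cases hy : 0 ≤ U.y <;> by_cases hy' : 0 ≤ U'.y
  · simp only [Square.dual, hy, hy', if_true]
    omega
  · have := rank_of_neg hy'
    omega
  · have := rank_of_nonneg hy'
    omega
  · simp only [Square.dual, hy, hy', if_false]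
    omega

theorem adjacent_dual {U : Square} (h : U.rank = 0) : U.Adjacent U.dual := by
  rw [adjacent_iff, Square.ext_iff]
  by_cases hy : 0 ≤ U.y
  · have := rank_of_nonneg hy
    simp only [Square.dual, hy, if_true]
    omega
  · have := rank_of_neg hy
    simp only [Square.dual, hy, if_false]
    omega

/-- Adjacency in dual coordinates. -/
theorem Adjacent.near {U U' : Square} (h : U.Adjacent U') :
    (U'.rank = U.rank ∧ (U'.pos = U.pos - 1 ∨ U'.pos = U.pos ∨ U'.pos = U.pos + 1)) ∨
    (U'.rank = U.rank + 1 ∧ (U'.pos = U.pos - 1 ∨ U'.pos = U.pos)) ∨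
    (U.rank = U'.rank + 1 ∧ (U'.pos = U.pos + 1 ∨ U'.pos = U.pos)) := by
  rw [adjacent_iff, Square.ext_iff] at h
  simp only [pos]
  by_cases hy : 0 ≤ U.y <;> by_cases hy' : 0 ≤ U'.y
  · have h1 := rank_of_nonneg hy
    have h2 := rank_of_nonneg hy'
    simp only [hy, hy', if_true]
    omega
  · have h1 := rank_of_nonneg hy
    have h2 := rank_of_neg hy'
    simp only [hy, hy', if_true, if_false]
    omega
  · have h1 := rank_of_neg hy
    have h2 := rank_of_nonneg hy'
    simp only [hy, hy', if_true, if_false]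
    omega
  · have h1 := rank_of_neg hy
    have h2 := rank_of_neg hy'
    simp only [hy, hy', if_false]
    omega

theorem eq_or_eq_dual {U U' : Square} (hr : U'.rank = U.rank) (hp : U'.pos = U.pos) :
    U' = U ∨ U' = U.dual := by
  simp only [Square.ext_iff, Square.dual]
  simp only [rank, pos] at hr hp
  split_ifs at hr hp ⊢ <;> omega

end Square

theorem unitAt_iff {n l : ℕ} {D : LowerUpper l} {k : Kind} {i : ℕ} {U : Square} :
    UnitAt n D k i U ↔ i ≤ l ∧ U.rank ≤ n ∧ D.Occ k U.rank (i + U.shift) U.pos := by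
  have hplus : ∀ h : 0 ≤ U.y, (U.InPlus n ↔ U.rank ≤ n) := fun h => by
    have := Square.rank_of_nonneg h
    unfold Square.InPlus
    omega
  have hminus : ∀ h : ¬ 0 ≤ U.y, (U.InMinus n ↔ U.rank ≤ n) := fun h => by
    have := Square.rank_of_neg h
    unfold Square.InMinus
    omega
  by_cases hy : 0 ≤ U.y
  · have hm : ¬ U.InMinus n := fun h => by have := h.2; omega
    have hs : U.shift = 0 := by simp [Square.shift, hy]
    have hp : U.pos = U.x := by simp [Square.pos, hy]
    cases k
    · simp only [UnitAt, hm, false_and, or_false, hplus hy, hs, hp, LowerUpper.Occ, add_zero]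
      refine and_congr_right fun hi => and_congr_right fun hr => ?_
      unfold LowerUpper.lowerDual LowerUpper.upper LowerUpper.A LowerUpper.B
      by_cases h1 : U.rank < i
      · have h1' : U.rank + 1 ≤ i ∧ i ≤ l := ⟨h1, hi⟩
        have h1'' : U.rank < i ∧ i ≤ l + U.rank := by omega
        rw [dif_pos h1', dif_pos h1'', ExtInt.ofInt_le_ofInt]
        by_cases h2 : i < l
        · rw [dif_pos (by omega), dif_pos h2, ExtInt.ofInt_le_ofInt]
          simp [h1, h2]
        · rw [dif_neg (by omega)]
          simp only [h2, ExtInt.not_le_bot, and_false, false_and]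
      · rw [dif_neg (by omega)]
        simp [h1, ExtInt.not_top_le, -top_le_iff]
    · simp only [UnitAt, hm, false_and, or_false, hplus hy, hs, hp, LowerUpper.Occ, add_zero]
      refine and_congr_right fun hi => and_congr_right fun hr => and_congr ?_ ?_
      · unfold LowerUpper.upper LowerUpper.B
        by_cases h2 : i < l
        · rw [dif_pos (by omega), dif_pos h2, ExtInt.ofInt_le_ofInt]
          simp [h2]
        · rw [dif_neg (by omega)]
          simp [h2]
      · unfold LowerUpper.lowerDual LowerUpper.A
        by_cases h1 : U.rank < i
        · have h1' : U.rank + 1 ≤ i ∧ i ≤ l := ⟨h1, hi⟩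
          have h1'' : U.rank < i ∧ i ≤ l + U.rank := by omega
          rw [dif_pos h1', dif_pos h1'', ExtInt.ofInt_le_ofInt]
          simp [h1]
        · rw [dif_neg (by omega)]
          simp [h1]
  · have hm : ¬ U.InPlus n := fun h => hy h.1
    have hs : U.shift = U.rank := by simp [Square.shift, hy]
    have hp : U.pos = U.x - 1 - U.rank := by
      have := Square.rank_of_neg hy
      simp only [Square.pos, hy, if_false]
      omega
    have hA : ∀ h : 1 ≤ i ∧ i ≤ l, D.A U.rank (i + U.rank) =
        D.alpha ⟨i - 1, by omega⟩ U.rank - 1 - U.rank := fun h => by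
      rw [← LowerUpper.A_alpha]
      congr 1
      simp only
      omega
    have hB : ∀ h : 1 ≤ i + 1 ∧ i + 1 + U.rank ≤ l, D.B U.rank (i + U.rank) =
        D.beta ⟨i + 1 + U.rank - 1, by omega⟩ U.rank := fun h => by
      rw [← LowerUpper.B_beta]
      congr 1
      simp only
      omega
    cases k
    · simp only [UnitAt, hm, false_and, false_or, hminus hy, hs, hp, LowerUpper.Occ]
      refine and_congr_right fun hi => and_congr_right fun hr => ?_
      unfold LowerUpper.lower LowerUpper.upperDual
      by_cases h1 : 1 ≤ i
      · rw [dif_pos ⟨h1, hi⟩, ExtInt.ofInt_le_ofInt, hA ⟨h1, hi⟩]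
        by_cases h2 : i + U.rank < l
        · have h2' : 1 ≤ i + 1 ∧ i + 1 + U.rank ≤ l := by omega
          rw [dif_pos h2', ExtInt.ofInt_le_ofInt, hB h2']
          omega
        · rw [dif_neg (by omega)]
          simp only [h2, ExtInt.not_le_bot, and_false, false_and]
      · rw [dif_neg (by omega)]
        have : ¬ (U.rank < i + U.rank) := by omega
        simp [this, ExtInt.not_top_le, -top_le_iff]
    · simp only [UnitAt, hm, false_and, false_or, hminus hy, hs, hp, LowerUpper.Occ]
      refine and_congr_right fun hi => and_congr_right fun hr => and_congr ?_ ?_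
      · unfold LowerUpper.upperDual
        by_cases h2 : i + U.rank < l
        · have h2' : 1 ≤ i + 1 ∧ i + 1 + U.rank ≤ l := by omega
          rw [dif_pos h2', ExtInt.ofInt_le_ofInt, hB h2']
          omega
        · rw [dif_neg (by omega)]
          simp [h2]
      · unfold LowerUpper.lower
        by_cases h1 : 1 ≤ i
        · rw [dif_pos ⟨h1, hi⟩, ExtInt.ofInt_le_ofInt, hA ⟨h1, hi⟩]
          omega
        · rw [dif_neg (by omega)]
          have : ¬ (U.rank < i + U.rank) := by omega
          simp only [this, le_top, false_implies]

theorem isBoundary_iff {n l : ℕ} {D : LowerUpper l} {U : Square} :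
    IsBoundary n D U ↔ ∃ i, UnitAt n D .II i U ∧
      (i + U.shift ≤ U.rank ∨ l ≤ i + U.shift ∨ U.rank = n) := by
  unfold IsBoundary
  refine exists_congr fun i => and_congr_right fun h => ?_
  have h' := unitAt_iff.1 h
  by_cases hy : 0 ≤ U.y
  · have hm : ¬ U.InMinus n := fun h => by have := h.2; omega
    have hs : U.shift = 0 := by simp [Square.shift, hy]
    have hp : U.InPlus n := by
      have := Square.rank_of_nonneg hy
      unfold Square.InPlus
      omega
    simp only [hm, hp, hs, true_and, false_and, or_false]
    omega
  · have hm : ¬ U.InPlus n := fun h => hy h.1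
    have hs : U.shift = U.rank := by simp [Square.shift, hy]
    have hp : U.InMinus n := by
      have := Square.rank_of_neg hy
      unfold Square.InMinus
      omega
    simp only [hm, hp, hs, true_and, false_and, false_or]
    omega

/-! ## Connected components of sets of squares -/

/-- The class of `U` for the equivalence relation generated by adjacency in `u`. -/
def classIn (u : Set Square) (U : Square) : Set Square :=
  {U' | Relation.EqvGen (fun A B => A ∈ u ∧ B ∈ u ∧ A.Adjacent B) U U'}

theorem component_eq_classIn (n : ℕ) {l : ℕ} (D : LowerUpper l) (k : Kind) (U : Square) :
    component n D k U = classIn (units n D k) U := rfl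

/-- A set closed under a relation in both directions contains whole classes. -/
theorem mem_of_eqvGen {α : Type*} {R : α → α → Prop} {V : Set α}
    (hV : ∀ a b, R a b → (a ∈ V ↔ b ∈ V)) {a b : α} (h : Relation.EqvGen R a b) :
    a ∈ V ↔ b ∈ V := by
  induction h with
  | rel a b h => exact hV a b h
  | refl a => exact Iff.rfl
  | symm a b _ ih => exact ih.symm
  | trans a b c _ _ ih1 ih2 => exact ih1.trans ih2

theorem classIn_subset {u : Set Square} {U : Square} (hU : U ∈ u) : classIn u U ⊆ u := fun _ h =>
  (mem_of_eqvGen (V := u) (fun _ _ h => ⟨fun _ => h.2.1, fun _ => h.1⟩) h).1 hU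

theorem classIn_closed {u : Set Square} {U A B : Square} (hU : U ∈ u) (hA : A ∈ classIn u U)
    (hB : B ∈ u) (h : A.Adjacent B) : B ∈ classIn u U :=
  hA.trans _ _ _ (.rel _ _ ⟨classIn_subset hU hA, hB, h⟩)

theorem classIn_eq {u : Set Square} {U A : Square} (hA : A ∈ classIn u U) :
    classIn u A = classIn u U := by
  ext B
  exact ⟨fun h => hA.trans _ _ _ h, fun h => (hA.symm).trans _ _ _ h⟩

theorem classIn_transfer {u u' : Set Square} {U : Square} (hU : U ∈ u) (h1 : classIn u U ⊆ u')
    (h2 : ∀ A ∈ classIn u U, ∀ B ∈ u', A.Adjacent B → B ∈ classIn u U) :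
    classIn u' U = classIn u U := by
  ext B
  constructor
  · intro hB
    refine (mem_of_eqvGen (V := classIn u U) (fun A B h => ⟨fun hA => h2 A hA B h.2.1 h.2.2,
      fun hB => h2 B hB A h.1 h.2.2.symm⟩) hB).1 (.refl _)
  · intro hB
    have key : ∀ {a b : Square}, Relation.EqvGen (fun A B => A ∈ u ∧ B ∈ u ∧ A.Adjacent B) a b →
        a ∈ classIn u U → Relation.EqvGen (fun A B => A ∈ u' ∧ B ∈ u' ∧ A.Adjacent B) a b := by
      intro a b h
      induction h with
      | rel a b h =>
        exact fun ha => .rel _ _ ⟨h1 ha, h1 (classIn_closed hU ha h.2.1 h.2.2), h.2.2⟩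
      | refl a => exact fun _ => .refl _
      | symm a b hab ih => exact fun hb => (ih (hb.trans _ _ _ hab.symm)).symm
      | trans a b c hab _ ih1 ih2 =>
        exact fun ha => (ih1 ha).trans _ _ _ (ih2 (ha.trans _ _ _ hab))
    exact key hB (.refl _)

/-! ## Interlacing arrays -/

/-- The lower paths do not meet each other, and neither do the upper paths. -/
structure Interlaced (n : ℕ) {l : ℕ} (D : LowerUpper l) : Prop where
  A_le : ∀ r i, r < n → r + 1 < i → i ≤ l + r → D.A r i ≤ D.A (r + 1) i
  A_lt : ∀ r i, r < n → r < i → i ≤ l + r → D.A (r + 1) (i + 1) < D.A r i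
  B_le : ∀ r i, r < n → i < l → D.B r i ≤ D.B (r + 1) i
  B_lt : ∀ r i, r < n → i + 1 < l → D.B (r + 1) (i + 1) < D.B r i

namespace Interlaced

variable {n l : ℕ} {D : LowerUpper l}

theorem A_succ (h : Interlaced n D) (hn : 1 ≤ n) {r i : ℕ} (hr : r ≤ n) (hi : r < i)
    (hil : i + 1 ≤ l + r) : D.A r (i + 1) < D.A r i := by
  rcases Nat.lt_or_ge r n with h1 | h1
  · exact (h.A_le r (i + 1) h1 (by omega) hil).trans_lt (h.A_lt r i h1 hi (by omega))
  · obtain ⟨r, rfl⟩ : ∃ s, r = s + 1 := ⟨r - 1, by omega⟩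
    exact (h.A_lt r i (by omega) (by omega) (by omega)).trans_le
      (h.A_le r i (by omega) hi (by omega))

theorem B_succ (h : Interlaced n D) (hn : 1 ≤ n) {r i : ℕ} (hr : r ≤ n) (hil : i + 1 < l) :
    D.B r (i + 1) < D.B r i := by
  rcases Nat.lt_or_ge r n with h1 | h1
  · exact (h.B_le r (i + 1) h1 (by omega)).trans_lt (h.B_lt r i h1 hil)
  · obtain ⟨r, rfl⟩ : ∃ s, r = s + 1 := ⟨r - 1, by omega⟩
    exact (h.B_lt r i (by omega) hil).trans_le (h.B_le r i (by omega) (by omega))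

theorem A_anti (h : Interlaced n D) (hn : 1 ≤ n) {r i j : ℕ} (hr : r ≤ n) (hi : r < i)
    (hij : i < j) (hj : j ≤ l + r) : D.A r j < D.A r i := by
  induction j, Nat.succ_le_of_lt hij using Nat.le_induction with
  | base => exact h.A_succ hn hr hi hj
  | succ j hij' ih =>
    exact (h.A_succ hn hr (by omega) hj).trans (ih (by omega) (by omega))

theorem B_anti (h : Interlaced n D) (hn : 1 ≤ n) {r i j : ℕ} (hr : r ≤ n)
    (hij : i < j) (hj : j < l) : D.B r j < D.B r i := by
  induction j, Nat.succ_le_of_lt hij using Nat.le_induction with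
  | base => exact h.B_succ hn hr hj
  | succ j hij' ih =>
    exact (h.B_succ hn hr hj).trans (ih (by omega) (by omega))

/-- Positions of different kinds are not adjacent. -/
theorem not_near (h : Interlaced n D) (hn : 1 ≤ n) {r i r' i' : ℕ} {x x' : ℤ} (hr : r ≤ n)
    (hr' : r' ≤ n) (hi' : i' ≤ l + r') (h1 : D.Occ .I r i x) (h2 : D.Occ .II r' i' x')
    (near : (r' = r ∧ (x' = x - 1 ∨ x' = x ∨ x' = x + 1)) ∨
      (r' = r + 1 ∧ (x' = x - 1 ∨ x' = x)) ∨ (r = r' + 1 ∧ (x' = x + 1 ∨ x' = x))) : False := by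
  obtain ⟨a1, a2, a3, a4⟩ := h1
  obtain ⟨b1, b2⟩ := h2
  rcases near with ⟨rfl, hx⟩ | ⟨rfl, hx⟩ | ⟨rfl, hx⟩
  · rcases lt_trichotomy i i' with c | rfl | c
    · have := h.A_anti hn hr a1 c hi'
      have := b2 (by omega)
      omega
    · have := b1 a2
      have := b2 a1
      omega
    · have := h.B_anti hn hr c a2
      have := b1 (by omega)
      omega
  · rcases Nat.lt_or_ge i i' with c | c
    · have e1 := h.A_lt r i (by omega) a1 (by omega)
      have e2 : D.A (r + 1) i' ≤ D.A (r + 1) (i + 1) := by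
        rcases (Nat.succ_le_of_lt c).eq_or_lt with e | e
        · rw [← e]
        · exact (h.A_anti hn hr' (by omega) e hi').le
      have := b2 (by omega)
      omega
    · have e1 := h.B_le r i (by omega) a2
      have e2 : D.B (r + 1) i ≤ D.B (r + 1) i' := by
        rcases c.eq_or_lt with e | e
        · rw [e]
        · exact (h.B_anti hn hr' e a2).le
      have := b1 (by omega)
      omega
  · rcases Nat.lt_or_ge i' i with c | c
    · obtain ⟨i, rfl⟩ : ∃ s, i = s + 1 := ⟨i - 1, by omega⟩
      have e1 := h.B_lt r' i (by omega) a2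
      have e2 : D.B r' i ≤ D.B r' i' := by
        rcases (Nat.lt_succ_iff.1 c).eq_or_lt with e | e
        · rw [e]
        · exact (h.B_anti hn hr' e (by omega)).le
      have := b1 (by omega)
      omega
    · have e1 := h.A_le r' i (by omega) a1 (by omega)
      have e2 : D.A r' i' ≤ D.A r' i := by
        rcases c.eq_or_lt with e | e
        · rw [e]
        · exact (h.A_anti hn hr' (by omega) e hi').le
      have := b2 (by omega)
      omega

end Interlaced

theorem Square.shift_le (U : Square) : U.shift ≤ U.rank := by
  unfold Square.shift
  split_ifs <;> omega

theorem Interlaced.not_adjacent {n l : ℕ} {D : LowerUpper l} (h : Interlaced n D) (hn : 1 ≤ n)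
    {k : Kind} {U U' : Square} (hU : U ∈ units n D k) (hU' : U' ∈ units n D k.swap) :
    ¬ U.Adjacent U' := by
  have key : ∀ {U U' : Square}, U ∈ units n D .I → U' ∈ units n D .II → ¬ U.Adjacent U' := by
    rintro U U' ⟨i, hi⟩ ⟨i', hi'⟩ ha
    rw [unitAt_iff] at hi hi'
    have := U'.shift_le
    exact h.not_near hn hi.2.1 hi'.2.1 (by omega) hi.2.2 hi'.2.2 ha.near
  cases k
  · exact key hU hU'
  · exact fun ha => key hU' hU ha.symm

theorem Square.adjacent_self (U : Square) : U.Adjacent U := by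
  rw [Square.adjacent_iff]
  simp

theorem Interlaced.disjoint_units {n l : ℕ} {D : LowerUpper l} (h : Interlaced n D) (hn : 1 ≤ n)
    {k : Kind} {U : Square} (hU : U ∈ units n D k) : U ∉ units n D k.swap := fun hU' =>
  h.not_adjacent hn hU hU' U.adjacent_self

/-! ## Regions -/

/-- The upper square of rank `r` at position `x`. -/
def upSquare (r : ℕ) (x : ℤ) : Square := ⟨x, r⟩

@[simp] theorem rank_upSquare (r : ℕ) (x : ℤ) : (upSquare r x).rank = r := by
  simp [upSquare, Square.rank]
@[simp] theorem pos_upSquare (r : ℕ) (x : ℤ) : (upSquare r x).pos = x := by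
  simp [upSquare, Square.pos]
@[simp] theorem shift_upSquare (r : ℕ) (x : ℤ) : (upSquare r x).shift = 0 := by
  simp [upSquare, Square.shift]

theorem unitAt_upSquare {n l : ℕ} {D : LowerUpper l} {k : Kind} {i r : ℕ} {x : ℤ} :
    UnitAt n D k i (upSquare r x) ↔ i ≤ l ∧ r ≤ n ∧ D.Occ k r i x := by
  simp [unitAt_iff]

theorem exists_unitAt {n l : ℕ} {D : LowerUpper l} {k : Kind} {i : ℕ} {U : Square}
    (hr : U.rank ≤ n) (h1 : U.rank < i) (h2 : i < l) (h : D.Occ k U.rank i U.pos) :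
    ∃ j, j + U.shift = i ∧ UnitAt n D k j U := by
  have := U.shift_le
  refine ⟨i - U.shift, by omega, ?_⟩
  rw [unitAt_iff, Nat.sub_add_cancel (by omega)]
  exact ⟨by omega, hr, h⟩

/-- There is no I-unit of rank `n`. -/
def NoTopOverlap (n : ℕ) {l : ℕ} (D : LowerUpper l) : Prop :=
  ∀ i, n < i → i < l → D.B n i ≤ D.A n i

namespace IsRegion

variable {n l : ℕ} {D : LowerUpper l} {k : Kind} {V : Set Square}

theorem subset_units (hV : IsRegion n D k V) : V ⊆ units n D k := by
  obtain ⟨⟨U, hU, rfl⟩, -, -⟩ := hV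
  exact classIn_subset hU

theorem closed (hV : IsRegion n D k V) {A B : Square} (hA : A ∈ V) (hB : B ∈ units n D k)
    (h : A.Adjacent B) : B ∈ V := by
  obtain ⟨⟨U, hU, rfl⟩, -, -⟩ := hV
  exact classIn_closed hU hA hB h

theorem interior (hV : IsRegion n D k V) (ht : NoTopOverlap n D) {U : Square} {i : ℕ}
    (hU : U ∈ V) (hi : UnitAt n D k i U) :
    U.rank < i + U.shift ∧ i + U.shift < l ∧ U.rank < n := by
  have h := unitAt_iff.1 hi
  cases k
  · obtain ⟨h1, h2, h3, h4, h5, h6⟩ := h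
    refine ⟨h3, h4, lt_of_le_of_ne h2 fun e => ?_⟩
    rw [e] at h5 h6 h3
    have := ht _ h3 h4
    omega
  · by_contra hc
    refine hV.2.2 rfl U hU (isBoundary_iff.2 ⟨i, hi, ?_⟩)
    omega

theorem dual_mem (hV : IsRegion n D k V) (ht : NoTopOverlap n D) {U : Square} (hU : U ∈ V) :
    U.dual ∈ V := by
  have unit : ∀ U ∈ V, U.dual ∈ units n D k := by
    intro U hU
    obtain ⟨i, hi⟩ := hV.subset_units hU
    obtain ⟨h1, h2, h3⟩ := hV.interior ht hU hi
    have h4 := (unitAt_iff.1 hi).2.2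
    rw [← U.rank_dual, ← U.pos_dual] at h4
    obtain ⟨j, -, hj⟩ := exists_unitAt (n := n) (by rw [U.rank_dual]; omega)
      (by rw [U.rank_dual]; exact h1) h2 h4
    exact ⟨j, hj⟩
  have zero : ∀ U ∈ V, U.rank = 0 → U.dual ∈ V := fun U hU h =>
    hV.closed hU (unit U hU) (Square.adjacent_dual h)
  obtain ⟨U₀, hU₀, h₀⟩ := hV.2.1
  have hVc := hV
  obtain ⟨⟨U₁, hU₁, hV₁⟩, -, -⟩ := hVc
  rw [component_eq_classIn] at hV₁
  have hV₀ : V = classIn (units n D k) U₀ := by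
    rw [hV₁] at hU₀ ⊢
    exact (classIn_eq hU₀).symm
  have step : ∀ A B, A ∈ units n D k ∧ B ∈ units n D k ∧ A.Adjacent B →
      A ∈ V → A.dual ∈ V → B.dual ∈ V := by
    rintro A B ⟨-, hB, hAB⟩ hA hA'
    have hBV := hV.closed hA hB hAB
    by_cases h : B.rank = 0
    · exact zero B hBV h
    · exact hV.closed hA' (unit B hBV) (hAB.dual h)
  have := (mem_of_eqvGen (V := {U | U ∈ V ∧ U.dual ∈ V}) (fun A B h =>
    ⟨fun hA => ⟨hV.closed hA.1 h.2.1 h.2.2, step A B h hA.1 hA.2⟩,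
      fun hB => ⟨hV.closed hB.1 h.1 h.2.2.symm,
        step B A ⟨h.2.1, h.1, h.2.2.symm⟩ hB.1 hB.2⟩⟩) (hV₀ ▸ hU)).1
      ⟨hU₀, zero U₀ hU₀ h₀⟩
  exact this.2

theorem mem_iff_upSquare (hV : IsRegion n D k V) (ht : NoTopOverlap n D) {U : Square} :
    U ∈ V ↔ upSquare U.rank U.pos ∈ V := by
  rcases Square.eq_or_eq_dual (U := U) (U' := upSquare U.rank U.pos) (by simp) (by simp) with h | h
  · rw [h]
  · rw [h]
    refine ⟨hV.dual_mem ht, fun h => ?_⟩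
    have := hV.dual_mem ht h
    rwa [Square.dual_dual] at this

end IsRegion

/-- The row at `i` of rank `r` lies inside the bands and meets `V`. -/
def RowIn {l : ℕ} (D : LowerUpper l) (k : Kind) (V : Set Square) (r i : ℕ) : Prop :=
  r < i ∧ i < l ∧ ∃ x, D.Occ k r i x ∧ upSquare r x ∈ V

theorem occ_interior {l : ℕ} {D : LowerUpper l} {k : Kind} {r i : ℕ} {x : ℤ} (h1 : r < i)
    (h2 : i < l) : D.Occ k r i x ↔
      match k with
      | .I => D.A r i ≤ x ∧ x < D.B r i
      | .II => D.B r i ≤ x ∧ x < D.A r i := by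
  cases k <;> simp [LowerUpper.Occ, h1, h2]

theorem occ_convex {l : ℕ} {D : LowerUpper l} {k : Kind} {r i : ℕ} {x y w : ℤ}
    (hx : D.Occ k r i x) (hy : D.Occ k r i y) (h1 : x ≤ w) (h2 : w ≤ y) : D.Occ k r i w := by
  cases k
  · exact ⟨hx.1, hx.2.1, hx.2.2.1.trans h1, h2.trans_lt hy.2.2.2⟩
  · exact ⟨fun h => (hx.1 h).trans h1, fun h => h2.trans_lt (hy.2 h)⟩

theorem adjacent_upSquare {r r' : ℕ} {x x' : ℤ}
    (near : (r' = r ∧ (x' = x - 1 ∨ x' = x ∨ x' = x + 1)) ∨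
      (r' = r + 1 ∧ (x' = x - 1 ∨ x' = x)) ∨ (r = r' + 1 ∧ (x' = x + 1 ∨ x' = x))) :
    (upSquare r x).Adjacent (upSquare r' x') := by
  rw [Square.adjacent_iff, Square.ext_iff]
  simp only [upSquare]
  omega

namespace IsRegion

variable {n l : ℕ} {D : LowerUpper l} {k : Kind} {V : Set Square}

theorem step (hV : IsRegion n D k V) (ht : NoTopOverlap n D) {r r' i' : ℕ} {x x' : ℤ}
    (hx : upSquare r x ∈ V) (hr' : r' ≤ n) (hi' : i' ≤ l) (h : D.Occ k r' i' x')
    (near : (r' = r ∧ (x' = x - 1 ∨ x' = x ∨ x' = x + 1)) ∨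
      (r' = r + 1 ∧ (x' = x - 1 ∨ x' = x)) ∨ (r = r' + 1 ∧ (x' = x + 1 ∨ x' = x))) :
    upSquare r' x' ∈ V ∧ RowIn D k V r' i' := by
  have h1 : UnitAt n D k i' (upSquare r' x') := unitAt_upSquare.2 ⟨hi', hr', h⟩
  have h2 := hV.closed hx ⟨i', h1⟩ (adjacent_upSquare near)
  have h3 := hV.interior ht h2 h1
  simp only [rank_upSquare, shift_upSquare, add_zero] at h3
  exact ⟨h2, h3.1, h3.2.1, x', h, h2⟩

theorem row_lt (hV : IsRegion n D k V) (ht : NoTopOverlap n D) {r i : ℕ} (h : RowIn D k V r i) :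
    r < n := by
  obtain ⟨h1, h2, x, h3, h4⟩ := h
  have hr : r ≤ n := by
    obtain ⟨j, hj⟩ := hV.subset_units h4
    exact (unitAt_upSquare.1 hj).2.1
  have := hV.interior ht h4 (unitAt_upSquare.2 ⟨h2.le, hr, h3⟩)
  simpa using this.2.2

theorem row_subset (hV : IsRegion n D k V) (ht : NoTopOverlap n D) {r i : ℕ} {y : ℤ}
    (h : RowIn D k V r i) (hy : D.Occ k r i y) : upSquare r y ∈ V := by
  have hr := hV.row_lt ht h
  obtain ⟨h1, h2, x, h3, h4⟩ := h
  have right : ∀ m : ℕ, x + m ≤ y → upSquare r (x + m) ∈ V := by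
    intro m
    induction m with
    | zero => intro _; simpa using h4
    | succ m ih =>
      intro hm
      push_cast at hm ⊢
      exact (hV.step ht (ih (by omega)) hr.le h2.le (occ_convex h3 hy (by omega) (by omega))
        (Or.inl ⟨rfl, by omega⟩)).1
  have left : ∀ m : ℕ, y ≤ x - m → upSquare r (x - m) ∈ V := by
    intro m
    induction m with
    | zero => intro _; simpa using h4
    | succ m ih =>
      intro hm
      push_cast at hm ⊢
      exact (hV.step ht (ih (by omega)) hr.le h2.le (occ_convex hy h3 (by omega) (by omega))
        (Or.inl ⟨rfl, by omega⟩)).1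
  rcases le_total x y with h5 | h5
  · have := right (y - x).toNat (by omega)
    rwa [Int.toNat_of_nonneg (by omega), add_sub_cancel] at this
  · have := left (x - y).toNat (by omega)
    rwa [Int.toNat_of_nonneg (by omega), sub_sub_cancel] at this

/-- A unit of `V` at `i` lies in a row of `V`, and conversely. -/
theorem rowIn_of_mem (hV : IsRegion n D k V) (ht : NoTopOverlap n D) {U : Square} {i : ℕ}
    (hU : U ∈ V) (hi : UnitAt n D k i U) : RowIn D k V U.rank (i + U.shift) := by
  have h := hV.interior ht hU hi
  exact ⟨h.1, h.2.1, U.pos, (unitAt_iff.1 hi).2.2, (hV.mem_iff_upSquare ht).1 hU⟩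

theorem mem_of_rowIn (hV : IsRegion n D k V) (ht : NoTopOverlap n D) {U : Square} {i : ℕ}
    (hi : UnitAt n D k i U) (h : RowIn D k V U.rank (i + U.shift)) : U ∈ V :=
  (hV.mem_iff_upSquare ht).2 (hV.row_subset ht h (unitAt_iff.1 hi).2.2)

end IsRegion

/-! ## Exchanging the lower and upper paths along a region -/

namespace LowerUpper

variable {l : ℕ}

open Classical in
/-- Exchange of `α_i^*(r)` and `β_{i+1}(r)` for all `(r, i)` in `S`. -/
noncomputable def flip (D : LowerUpper l) (S : ℕ → ℕ → Prop) : LowerUpper l where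
  alpha j r := if S r (j + 1 + r) then D.B r (j + 1 + r) + 1 + r else D.alpha j r
  beta j r := if S r j then D.A r j else D.beta j r

variable {D : LowerUpper l} {S : ℕ → ℕ → Prop} (hS : ∀ r i, S r i → r < i ∧ i < l)

include hS

open Classical in
theorem A_flip (r i : ℕ) : (D.flip S).A r i = if S r i then D.B r i else D.A r i := by
  by_cases h : r < i ∧ i ≤ l + r
  · have e : i - r - 1 + 1 + r = i := by omega
    simp only [A, h, and_self, dif_pos, flip, e]
    split_ifs <;> ring
  · have : ¬ S r i := fun hs => h (by have := hS r i hs; omega)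
    simp only [A, h, this, if_false, dif_neg, not_false_iff]

open Classical in
theorem B_flip (r i : ℕ) : (D.flip S).B r i = if S r i then D.A r i else D.B r i := by
  by_cases h : i < l
  · simp only [B, h, dif_pos, flip]
  · have : ¬ S r i := fun hs => h (by have := hS r i hs; omega)
    simp only [B, h, this, if_false, dif_neg, not_false_iff]

theorem occ_flip {k : Kind} {r i : ℕ} {x : ℤ} :
    (S r i → ((D.flip S).Occ k r i x ↔ D.Occ k.swap r i x)) ∧
    (¬ S r i → ((D.flip S).Occ k r i x ↔ D.Occ k r i x)) := by
  constructor
  · intro h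
    have h1 := (hS r i h).1
    have h2 := (hS r i h).2
    cases k <;> simp [Occ, A_flip hS, B_flip hS, h, h1, h2, Kind.swap]
  · intro h
    cases k <;> simp [Occ, A_flip hS, B_flip hS, h]

omit hS in
theorem ext_AB {D D' : LowerUpper l} (hA : ∀ r i, D.A r i = D'.A r i)
    (hB : ∀ r i, D.B r i = D'.B r i) : D = D' := by
  cases D with | mk a b => cases D' with | mk a' b' =>
  congr 1
  · funext j r
    have := hA r (j + 1 + r)
    rw [A_alpha, A_alpha] at this
    simpa using this
  · funext j r
    have := hB r j
    rwa [B_beta, B_beta] at this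

theorem flip_flip : (D.flip S).flip S = D := by
  refine ext_AB (fun r i => ?_) (fun r i => ?_)
  · rw [A_flip hS, A_flip hS, B_flip hS]
    split_ifs <;> rfl
  · rw [B_flip hS, A_flip hS, B_flip hS]
    split_ifs <;> rfl

end LowerUpper

namespace IsRegion

variable {n l : ℕ} {D : LowerUpper l} {k : Kind} {V : Set Square}

theorem row_nonempty {r i : ℕ} (h : RowIn D k V r i) :
    (k = .I ∧ D.A r i < D.B r i) ∨ (k = .II ∧ D.B r i < D.A r i) := by
  obtain ⟨h1, h2, x, h3, -⟩ := h
  rw [occ_interior h1 h2] at h3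
  cases k
  · exact Or.inl ⟨rfl, by simp only at h3; omega⟩
  · exact Or.inr ⟨rfl, by simp only at h3; omega⟩

/-- If exactly one of two neighbouring rows meets `V`, the two rows are ordered as intervals. -/
theorem compat_up (hV : IsRegion n D k V) (ht : NoTopOverlap n D) (hD : Interlaced n D) {r i : ℕ}
    (hr : r < n) (hl : i < l) (hi : r < i)
    (h : ¬ (RowIn D k V r i ↔ RowIn D k V (r + 1) i)) :
    D.A r i ≤ D.B (r + 1) i ∧ (r + 1 < i → D.B r i ≤ D.A (r + 1) i) := by
  have e1 := hD.B_le r i hr hl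
  have e2 := hD.A_le r i hr
  by_cases h1 : RowIn D k V r i
  · have h2 : ¬ RowIn D k V (r + 1) i := fun h2 => h ⟨fun _ => h2, fun _ => h1⟩
    rcases row_nonempty h1 with ⟨rfl, h3⟩ | ⟨rfl, h3⟩
    · refine ⟨by omega, fun hi' => ?_⟩
      by_contra! hc
      have h4 := e2 hi' (by omega)
      exact h2 (hV.step ht (r' := r + 1) (hV.row_subset ht h1 (y := D.A (r + 1) i) ⟨hi, hl, h4, hc⟩)
        hr hl.le (x' := D.A (r + 1) i) ⟨hi', hl, le_rfl, by omega⟩ (by omega)).2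
    · refine ⟨?_, fun hi' => ?_⟩
      · by_contra! hc
        refine h2 (hV.step ht (r' := r + 1) (hV.row_subset ht h1 (y := D.B (r + 1) i) ⟨fun _ => e1, fun _ => hc⟩)
          hr hl.le (x' := D.B (r + 1) i) ⟨fun _ => le_rfl, fun h5 => ?_⟩ (by omega)).2
        have := e2 h5 (by omega)
        omega
      · have := e2 hi' (by omega)
        omega
  · have h2 : RowIn D k V (r + 1) i := by
      by_contra h2
      exact h ⟨fun h => absurd h h1, fun h => absurd h h2⟩
    have hi' := h2.1
    have e2 := e2 hi' (by omega)
    rcases row_nonempty h2 with ⟨rfl, h3⟩ | ⟨rfl, h3⟩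
    · refine ⟨by omega, fun _ => ?_⟩
      by_contra! hc
      exact h1 (hV.step ht (hV.row_subset ht h2 (y := D.A (r + 1) i) ⟨hi', hl, le_rfl, h3⟩)
        hr.le hl.le (x' := D.A (r + 1) i) ⟨hi, hl, e2, hc⟩ (by omega)).2
    · refine ⟨?_, fun hi' => by omega⟩
      by_contra! hc
      exact h1 (hV.step ht (hV.row_subset ht h2 (y := D.B (r + 1) i)
        ⟨fun _ => le_rfl, fun _ => h3⟩)
        hr.le hl.le (x' := D.B (r + 1) i) ⟨fun _ => e1, fun _ => hc⟩ (by omega)).2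

theorem compat_diag (hV : IsRegion n D k V) (ht : NoTopOverlap n D) (hD : Interlaced n D) {r i : ℕ}
    (hr : r < n) (hl : i < l) (hi : r < i)
    (h : ¬ (RowIn D k V r i ↔ RowIn D k V (r + 1) (i + 1))) :
    D.A (r + 1) (i + 1) < D.B r i ∧ (i + 1 < l → D.B (r + 1) (i + 1) < D.A r i) := by
  have e1 := hD.A_lt r i hr hi (by omega)
  have e2 := hD.B_lt r i hr
  by_cases h1 : RowIn D k V r i
  · have h2 : ¬ RowIn D k V (r + 1) (i + 1) := fun h2 => h ⟨fun _ => h2, fun _ => h1⟩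
    rcases row_nonempty h1 with ⟨rfl, h3⟩ | ⟨rfl, h3⟩
    · refine ⟨by omega, fun hl' => ?_⟩
      by_contra! hc
      have h4 := e2 hl'
      exact h2 (hV.step ht (r' := r + 1) (i' := i + 1) (hV.row_subset ht h1 (y := D.A r i) ⟨hi, hl, le_rfl, h3⟩)
        hr hl (x' := D.A r i - 1) ⟨by omega, hl', by omega, by omega⟩ (by omega)).2
    · refine ⟨?_, fun hl' => ?_⟩
      · by_contra! hc
        refine h2 (hV.step ht (r' := r + 1) (i' := i + 1) (hV.row_subset ht h1 (y := D.B r i) ⟨fun _ => le_rfl, fun _ => h3⟩)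
          hr hl (x' := D.B r i - 1) ⟨fun h5 => ?_, fun h5 => by omega⟩ (by omega)).2
        have := e2 h5
        omega
      · have := e2 hl'
        omega
  · have h2 : RowIn D k V (r + 1) (i + 1) := by
      by_contra h2
      exact h ⟨fun h => absurd h h1, fun h => absurd h h2⟩
    have hl' := h2.2.1
    have e2 := e2 hl'
    rcases row_nonempty h2 with ⟨rfl, h3⟩ | ⟨rfl, h3⟩
    · refine ⟨by omega, fun _ => ?_⟩
      by_contra! hc
      exact h1 (hV.step ht (hV.row_subset ht h2 (y := D.A r i - 1)
        ⟨by omega, hl', by omega, by omega⟩)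
        hr.le hl.le (x' := D.A r i) ⟨hi, hl, le_rfl, by omega⟩ (by omega)).2
    · refine ⟨?_, fun hi' => by omega⟩
      by_contra! hc
      exact h1 (hV.step ht (hV.row_subset ht h2 (y := D.B r i - 1)
        ⟨fun _ => by omega, fun _ => by omega⟩)
        hr.le hl.le (x' := D.B r i) ⟨fun _ => le_rfl, fun _ => by omega⟩ (by omega)).2

theorem rowIn_interior {r i : ℕ} (h : RowIn D k V r i) : r < i ∧ i < l := ⟨h.1, h.2.1⟩

theorem interlaced_flip (hV : IsRegion n D k V) (ht : NoTopOverlap n D) (hD : Interlaced n D) :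
    Interlaced n (D.flip (RowIn D k V)) := by
  have hS : ∀ r i, RowIn D k V r i → r < i ∧ i < l := fun r i h => rowIn_interior h
  refine ⟨fun r i hr h1 h2 => ?_, fun r i hr h1 h2 => ?_, fun r i hr h1 => ?_,
    fun r i hr h1 => ?_⟩
  · have e := hD.A_le r i hr h1 h2
    rw [LowerUpper.A_flip hS, LowerUpper.A_flip hS]
    by_cases a : RowIn D k V r i <;> by_cases b : RowIn D k V (r + 1) i
    · simpa [a, b] using hD.B_le r i hr (hS _ _ a).2
    · simpa [a, b] using
        (hV.compat_up ht hD hr (hS _ _ a).2 (by omega) (by tauto)).2 h1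
    · simpa [a, b] using (hV.compat_up ht hD hr (hS _ _ b).2 (by omega) (by tauto)).1
    · simpa [a, b] using e
  · have e := hD.A_lt r i hr h1 h2
    rw [LowerUpper.A_flip hS, LowerUpper.A_flip hS]
    by_cases a : RowIn D k V r i <;> by_cases b : RowIn D k V (r + 1) (i + 1)
    · simpa [a, b] using hD.B_lt r i hr (hS _ _ b).2
    · simpa [a, b] using (hV.compat_diag ht hD hr (hS _ _ a).2 h1 (by tauto)).1
    · simpa [a, b] using (hV.compat_diag ht hD hr (by have := (hS _ _ b).2; omega) h1 (by tauto)).2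
        (hS _ _ b).2
    · simpa [a, b] using e
  · have e := hD.B_le r i hr h1
    rw [LowerUpper.B_flip hS, LowerUpper.B_flip hS]
    by_cases a : RowIn D k V r i <;> by_cases b : RowIn D k V (r + 1) i
    · simpa [a, b] using hD.A_le r i hr (hS _ _ b).1 (by omega)
    · simpa [a, b] using (hV.compat_up ht hD hr h1 (hS _ _ a).1 (by tauto)).1
    · simpa [a, b] using
        (hV.compat_up ht hD hr h1 (by have := (hS _ _ b).1; omega) (by tauto)).2 (hS _ _ b).1
    · simpa [a, b] using e
  · have e := hD.B_lt r i hr h1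
    rw [LowerUpper.B_flip hS, LowerUpper.B_flip hS]
    by_cases a : RowIn D k V r i <;> by_cases b : RowIn D k V (r + 1) (i + 1)
    · simpa [a, b] using hD.A_lt r i hr (hS _ _ a).1 (by omega)
    · simpa [a, b] using (hV.compat_diag ht hD hr (by omega) (hS _ _ a).1 (by tauto)).2 h1
    · simpa [a, b] using
        (hV.compat_diag ht hD hr (by omega) (by have := (hS _ _ b).1; omega) (by tauto)).1
    · simpa [a, b] using e

theorem noTopOverlap_flip (hV : IsRegion n D k V) (ht : NoTopOverlap n D) :
    NoTopOverlap n (D.flip (RowIn D k V)) := by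
  have hS : ∀ r i, RowIn D k V r i → r < i ∧ i < l := fun r i h => rowIn_interior h
  intro i h1 h2
  have : ¬ RowIn D k V n i := fun h => absurd (hV.row_lt ht h) (lt_irrefl n)
  rw [LowerUpper.A_flip hS, LowerUpper.B_flip hS, if_neg this, if_neg this]
  exact ht i h1 h2

theorem not_occ_swap {r i : ℕ} {x : ℤ} (h : RowIn D k V r i) : ¬ D.Occ k.swap r i x := by
  have h1 := row_nonempty h
  rw [occ_interior h.1 h.2.1]
  rcases h1 with ⟨rfl, h1⟩ | ⟨rfl, h1⟩ <;> simp only [Kind.swap] <;> omega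

theorem unitAt_flip {k' : Kind} {i : ℕ} {U : Square} :
    (RowIn D k V U.rank (i + U.shift) →
      (UnitAt n (D.flip (RowIn D k V)) k' i U ↔ UnitAt n D k'.swap i U)) ∧
    (¬ RowIn D k V U.rank (i + U.shift) →
      (UnitAt n (D.flip (RowIn D k V)) k' i U ↔ UnitAt n D k' i U)) := by
  have hS : ∀ r i, RowIn D k V r i → r < i ∧ i < l := fun r i h => rowIn_interior h
  simp only [unitAt_iff]
  exact ⟨fun h => by rw [(LowerUpper.occ_flip hS).1 h],
    fun h => by rw [(LowerUpper.occ_flip hS).2 h]⟩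

theorem unitAt_flip_of_mem (hV : IsRegion n D k V) (ht : NoTopOverlap n D) (hD : Interlaced n D)
    (hn : 1 ≤ n) {k' : Kind} {i : ℕ} {U : Square} (hU : U ∈ V) :
    UnitAt n (D.flip (RowIn D k V)) k' i U ↔ UnitAt n D k'.swap i U := by
  by_cases h : RowIn D k V U.rank (i + U.shift)
  · exact unitAt_flip.1 h
  · rw [unitAt_flip.2 h]
    have h1 : ¬ UnitAt n D k i U := fun h1 => h (hV.rowIn_of_mem ht hU h1)
    have h2 : ¬ UnitAt n D k.swap i U := fun h2 =>
      hD.disjoint_units hn (hV.subset_units hU) ⟨i, h2⟩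
    rcases k.eq_or_eq_swap k' with rfl | rfl
    · simp [h1, h2]
    · simp [h1, h2]

theorem unitAt_flip_of_notMem (hV : IsRegion n D k V) (ht : NoTopOverlap n D)
    {k' : Kind} {i : ℕ} {U : Square} (hU : U ∉ V) :
    UnitAt n (D.flip (RowIn D k V)) k' i U ↔ UnitAt n D k' i U := by
  by_cases h : RowIn D k V U.rank (i + U.shift)
  · rw [unitAt_flip.1 h]
    have h1 : ¬ UnitAt n D k i U := fun h1 => hU (hV.mem_of_rowIn ht h1 h)
    have h2 : ¬ UnitAt n D k.swap i U := fun h2 => not_occ_swap h (unitAt_iff.1 h2).2.2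
    rcases k.eq_or_eq_swap k' with rfl | rfl
    · simp [h1, h2]
    · simp [h1, h2]
  · exact unitAt_flip.2 h

theorem mem_units_flip (hV : IsRegion n D k V) (ht : NoTopOverlap n D) (hD : Interlaced n D)
    (hn : 1 ≤ n) {k' : Kind} {U : Square} :
    (U ∈ V → (U ∈ units n (D.flip (RowIn D k V)) k' ↔ U ∈ units n D k'.swap)) ∧
    (U ∉ V → (U ∈ units n (D.flip (RowIn D k V)) k' ↔ U ∈ units n D k')) :=
  ⟨fun h => exists_congr fun _ => hV.unitAt_flip_of_mem ht hD hn h,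
    fun h => exists_congr fun _ => hV.unitAt_flip_of_notMem ht h⟩

/-- The region itself changes its kind. -/
theorem isRegion_flip (hV : IsRegion n D k V) (ht : NoTopOverlap n D) (hD : Interlaced n D)
    (hn : 1 ≤ n) : IsRegion n (D.flip (RowIn D k V)) k.swap V := by
  have hsub : V ⊆ units n (D.flip (RowIn D k V)) k.swap := fun U hU => by
    rw [(hV.mem_units_flip ht hD hn).1 hU, Kind.swap_swap]
    exact hV.subset_units hU
  refine ⟨?_, hV.2.1, ?_⟩
  · obtain ⟨U, hU, hVU⟩ := hV.1
    have hmem : U ∈ V := by rw [hVU]; exact .refl U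
    refine ⟨U, hsub hmem, ?_⟩
    rw [component_eq_classIn] at hVU ⊢
    rw [classIn_transfer hU (hVU ▸ hsub)]
    · exact hVU
    · rw [← hVU]
      intro A hA B hB hAB
      by_contra hBV
      rw [(hV.mem_units_flip ht hD hn).2 hBV] at hB
      exact hD.not_adjacent hn (hV.subset_units hA) hB hAB
  · intro hk U hU hb
    obtain ⟨i, h1, h2⟩ := isBoundary_iff.1 hb
    rw [hV.unitAt_flip_of_mem ht hD hn hU, ← hk, Kind.swap_swap] at h1
    have := hV.interior ht hU h1
    omega

/-- The other regions are not affected. -/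
theorem isRegion_flip_of_ne (hV : IsRegion n D k V) (ht : NoTopOverlap n D) (hD : Interlaced n D)
    (hn : 1 ≤ n) {k' : Kind} {W : Set Square} (hW : IsRegion n D k' W) (hne : W ≠ V) :
    IsRegion n (D.flip (RowIn D k V)) k' W ∧ ∀ U ∈ W, U ∉ V := by
  have hdisj : ∀ U ∈ W, U ∉ V := by
    intro U hUW hUV
    rcases k.eq_or_eq_swap k' with rfl | rfl
    · obtain ⟨⟨A, hA, hWA⟩, -, -⟩ := hW
      obtain ⟨⟨B, hB, hVB⟩, -, -⟩ := hV
      rw [component_eq_classIn] at hWA hVB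
      rw [hWA] at hUW
      rw [hVB] at hUV
      exact hne (by rw [hWA, hVB, ← classIn_eq hUW, classIn_eq hUV])
    · exact hD.disjoint_units hn (hV.subset_units hUV) (hW.subset_units hUW)
  refine ⟨⟨?_, hW.2.1, ?_⟩, hdisj⟩
  · obtain ⟨U, hU, hWU⟩ := hW.1
    have hmem : U ∈ W := by rw [hWU]; exact .refl U
    have hsub : W ⊆ units n (D.flip (RowIn D k V)) k' := fun U hU => by
      rw [(hV.mem_units_flip ht hD hn).2 (hdisj U hU)]
      exact hW.subset_units hU
    refine ⟨U, hsub hmem, ?_⟩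
    rw [component_eq_classIn] at hWU ⊢
    rw [classIn_transfer hU (hWU ▸ hsub)]
    · exact hWU
    · rw [← hWU]
      intro A hA B hB hAB
      by_cases hBV : B ∈ V
      · rw [(hV.mem_units_flip ht hD hn).1 hBV] at hB
        exact absurd hAB (hD.not_adjacent hn (hW.subset_units hA) hB)
      · rw [(hV.mem_units_flip ht hD hn).2 hBV] at hB
        exact hW.closed hA hB hAB
  · intro hk U hU hb
    obtain ⟨i, h1, h2⟩ := isBoundary_iff.1 hb
    rw [hV.unitAt_flip_of_notMem ht (hdisj U hU)] at h1
    exact hW.2.2 hk U hU (isBoundary_iff.2 ⟨i, h1, h2⟩)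

theorem rowIn_flip (hV : IsRegion n D k V) (ht : NoTopOverlap n D) (hD : Interlaced n D)
    (hn : 1 ≤ n) (r i : ℕ) : RowIn (D.flip (RowIn D k V)) k.swap V r i ↔ RowIn D k V r i := by
  refine and_congr_right fun h1 => and_congr_right fun h2 => exists_congr fun x =>
    and_congr_left fun hx => ?_
  have hr : r ≤ n := by
    obtain ⟨j, hj⟩ := hV.subset_units hx
    exact (unitAt_upSquare.1 hj).2.1
  have := hV.unitAt_flip_of_mem ht hD hn (k' := k.swap) (i := i) hx
  rw [unitAt_upSquare, unitAt_upSquare, Kind.swap_swap] at this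
  simpa [h2.le, hr] using this

theorem rowIn_flip_of_disjoint (hV : IsRegion n D k V) (ht : NoTopOverlap n D)
    {k' : Kind} {W : Set Square} (hW : IsRegion n D k' W) (hdisj : ∀ U ∈ W, U ∉ V) (r i : ℕ) :
    (RowIn (D.flip (RowIn D k V)) k' W r i ↔ RowIn D k' W r i) ∧
      (RowIn D k' W r i → ¬ RowIn D k V r i) := by
  constructor
  · refine and_congr_right fun h1 => and_congr_right fun h2 => exists_congr fun x =>
      and_congr_left fun hx => ?_
    have hr : r ≤ n := by
      obtain ⟨j, hj⟩ := hW.subset_units hx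
      exact (unitAt_upSquare.1 hj).2.1
    have := hV.unitAt_flip_of_notMem ht (k' := k') (i := i) (hdisj _ hx)
    rw [unitAt_upSquare, unitAt_upSquare] at this
    simpa [h2.le, hr] using this
  · rintro ⟨h1, h2, x, h3, h4⟩ h
    rcases k.eq_or_eq_swap k' with rfl | rfl
    · exact hdisj _ h4 (hV.row_subset ht h h3)
    · exact not_occ_swap h h3

/-- The even overlaps or holes counted by `evenCount`. -/
theorem evenCount_eq (hV : IsRegion n D k V) (ht : NoTopOverlap n D) :
    evenCount n D k V = Set.ncard {i | RowIn D k V 0 i ∧ Odd (D.A 0 i - D.B 0 i)} := by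
  unfold evenCount
  congr 1
  ext i
  simp only [Set.mem_ofPred_eq]
  have hgap : ∀ hi : 1 ≤ i ∧ i < l,
      D.alpha ⟨i - 1, by omega⟩ 0 - D.beta ⟨i, hi.2⟩ 0 = D.A 0 i - D.B 0 i + 1 := fun hi => by
    have e1 := D.A_alpha ⟨i - 1, by omega⟩ 0
    have e2 := D.B_beta ⟨i, hi.2⟩ 0
    have e3 : i - 1 + 1 = i := by omega
    simp only [e3, add_zero] at e1 e2
    rw [e1, e2]
    push_cast
    ring
  constructor
  · rintro ⟨hi, h1, U, hU, h2, h3⟩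
    rw [hgap hi] at h1
    have h4 := hV.rowIn_of_mem ht hU h3
    have h5 := U.shift_le
    rw [show i + U.shift = i by omega, h2] at h4
    refine ⟨h4, ?_⟩
    rw [Int.odd_iff]
    cases k <;> obtain ⟨h1, -⟩ := h1 <;> rw [Int.even_iff] at h1 <;> omega
  · rintro ⟨h1, h2⟩
    have h3 := row_nonempty h1
    have hi := rowIn_interior h1
    refine ⟨by omega, ?_, ?_⟩
    · rw [hgap (by omega)]
      rw [Int.odd_iff] at h2
      rcases h3 with ⟨rfl, h3⟩ | ⟨rfl, h3⟩
      · exact ⟨by rw [Int.even_iff]; omega, by omega⟩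
      · exact ⟨by rw [Int.even_iff]; omega, by omega⟩
    · have hr := hV.row_lt ht h1
      obtain ⟨-, -, x, h4, h5⟩ := h1
      exact ⟨_, h5, by simp, unitAt_upSquare.2 ⟨hi.2.le, hr.le, h4⟩⟩

theorem evenCount_flip (hV : IsRegion n D k V) (ht : NoTopOverlap n D) (hD : Interlaced n D)
    (hn : 1 ≤ n) : evenCount n (D.flip (RowIn D k V)) k.swap V = evenCount n D k V := by
  have hS : ∀ r i, RowIn D k V r i → r < i ∧ i < l := fun r i h => rowIn_interior h
  rw [(hV.isRegion_flip ht hD hn).evenCount_eq (hV.noTopOverlap_flip ht), hV.evenCount_eq ht]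
  congr 1
  ext i
  simp only [Set.mem_ofPred_eq]
  rw [hV.rowIn_flip ht hD hn]
  refine and_congr_right fun h => ?_
  rw [LowerUpper.A_flip hS, LowerUpper.B_flip hS, if_pos h, if_pos h, Int.odd_iff, Int.odd_iff]
  omega

theorem evenCount_flip_of_ne (hV : IsRegion n D k V) (ht : NoTopOverlap n D)
    (hD : Interlaced n D) (hn : 1 ≤ n) {k' : Kind} {W : Set Square} (hW : IsRegion n D k' W)
    (hne : W ≠ V) : evenCount n (D.flip (RowIn D k V)) k' W = evenCount n D k' W := by
  have hS : ∀ r i, RowIn D k V r i → r < i ∧ i < l := fun r i h => rowIn_interior h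
  obtain ⟨h1, h2⟩ := hV.isRegion_flip_of_ne ht hD hn hW hne
  rw [h1.evenCount_eq (hV.noTopOverlap_flip ht), hW.evenCount_eq ht]
  congr 1
  ext i
  simp only [Set.mem_ofPred_eq]
  obtain ⟨h3, h4⟩ := hV.rowIn_flip_of_disjoint ht hW h2 0 i
  rw [h3]
  refine and_congr_right fun h => ?_
  rw [LowerUpper.A_flip hS, LowerUpper.B_flip hS, if_neg (h4 h), if_neg (h4 h)]

theorem flip_flip_rowIn (hV : IsRegion n D k V) (ht : NoTopOverlap n D) (hD : Interlaced n D)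
    (hn : 1 ≤ n) : (D.flip (RowIn D k V)).flip (RowIn (D.flip (RowIn D k V)) k.swap V) = D := by
  have : RowIn (D.flip (RowIn D k V)) k.swap V = RowIn D k V := by
    funext r i
    exact propext (hV.rowIn_flip ht hD hn r i)
  rw [this, LowerUpper.flip_flip fun r i h => rowIn_interior h]

theorem kind_unique (hV : IsRegion n D k V) (hD : Interlaced n D) (hn : 1 ≤ n) {k' : Kind}
    (hV' : IsRegion n D k' V) : k' = k := by
  rcases k.eq_or_eq_swap k' with h | rfl
  · exact h
  · obtain ⟨U, hU, -⟩ := hV.2.1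
    exact absurd (hV'.subset_units hU) (hD.disjoint_units hn (hV.subset_units hU))

end IsRegion

/-- The odd regions, as sets of squares. -/
def oddRegions (n : ℕ) {l : ℕ} (D : LowerUpper l) : Set (Set Square) :=
  {V | ∃ k, IsOddRegion n D k V}

namespace IsRegion

variable {n l : ℕ} {D : LowerUpper l} {k : Kind} {V : Set Square}

theorem oddRegions_subset_flip (hV : IsRegion n D k V) (ht : NoTopOverlap n D)
    (hD : Interlaced n D) (hn : 1 ≤ n) :
    oddRegions n D ⊆ oddRegions n (D.flip (RowIn D k V)) := by
  rintro W ⟨k', hW, hodd⟩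
  by_cases hne : W = V
  · subst hne
    obtain rfl := hV.kind_unique hD hn hW
    exact ⟨k'.swap, hV.isRegion_flip ht hD hn, by rwa [hV.evenCount_flip ht hD hn]⟩
  · exact ⟨k', (hV.isRegion_flip_of_ne ht hD hn hW hne).1, by
      rwa [hV.evenCount_flip_of_ne ht hD hn hW hne]⟩

theorem oddRegions_flip (hV : IsRegion n D k V) (ht : NoTopOverlap n D)
    (hD : Interlaced n D) (hn : 1 ≤ n) :
    oddRegions n (D.flip (RowIn D k V)) = oddRegions n D := by
  refine Set.Subset.antisymm ?_ (hV.oddRegions_subset_flip ht hD hn)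
  have := (hV.isRegion_flip ht hD hn).oddRegions_subset_flip (hV.noTopOverlap_flip ht)
    (hV.interlaced_flip ht hD) hn
  rwa [hV.flip_flip_rowIn ht hD hn] at this

open Classical in
/-- The number of even overlaps. -/
noncomputable def _root_.TypeC.overlapCount {l : ℕ} (D : LowerUpper l) : ℕ :=
  ((Finset.range (l - 1)).filter fun i => OverlapAt l (D.A 0) (D.B 0) (i + 1)).card

open Classical in
/-- The number of even overlaps changes by the number of those in the region. -/
theorem overlapCount_flip (hV : IsRegion n D k V) (ht : NoTopOverlap n D) :
    overlapCount (D.flip (RowIn D k V)) + overlapCount D + evenCount n D k V =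
      2 * (((Finset.range (l - 1)).filter fun i => RowIn D k V 0 (i + 1) ∧
        Odd (D.A 0 (i + 1) - D.B 0 (i + 1))).card + ((Finset.range (l - 1)).filter fun i =>
        ¬ RowIn D k V 0 (i + 1) ∧ OverlapAt l (D.A 0) (D.B 0) (i + 1)).card) := by
  have hS : ∀ r i, RowIn D k V r i → r < i ∧ i < l := fun r i h => rowIn_interior h
  have e1 : evenCount n D k V = ((Finset.range (l - 1)).filter fun i => RowIn D k V 0 (i + 1) ∧
      Odd (D.A 0 (i + 1) - D.B 0 (i + 1))).card := by
    rw [hV.evenCount_eq ht, ← Set.ncard_coe_finset]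
    refine (Set.ncard_congr (fun i _ => i + 1) ?_ (fun _ _ _ _ h => by simpa using h) ?_).symm
    · intro i hi
      simpa using (Finset.mem_filter.1 hi).2
    · rintro i hi
      have h1 := hS _ _ hi.1
      obtain ⟨i, rfl⟩ : ∃ j, i = j + 1 := ⟨i - 1, by omega⟩
      refine ⟨i, ?_, rfl⟩
      simp only [Finset.coe_filter, Finset.mem_range, Set.mem_ofPred_eq]
      exact ⟨by omega, hi⟩
  have e2 : ∀ D' : LowerUpper l, overlapCount D' =
      ((Finset.range (l - 1)).filter fun i => RowIn D k V 0 (i + 1) ∧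
        OverlapAt l (D'.A 0) (D'.B 0) (i + 1)).card +
      ((Finset.range (l - 1)).filter fun i => ¬ RowIn D k V 0 (i + 1) ∧
        OverlapAt l (D'.A 0) (D'.B 0) (i + 1)).card := fun D' => by
    unfold overlapCount
    rw [← Finset.card_filter_add_card_filter_not (fun i => RowIn D k V 0 (i + 1)),
      Finset.filter_filter, Finset.filter_filter]
    congr 2 <;> ext i <;> simp only [Finset.mem_filter] <;> tauto
  have e3 : ((Finset.range (l - 1)).filter fun i => ¬ RowIn D k V 0 (i + 1) ∧
      OverlapAt l ((D.flip (RowIn D k V)).A 0) ((D.flip (RowIn D k V)).B 0) (i + 1)) =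
      ((Finset.range (l - 1)).filter fun i => ¬ RowIn D k V 0 (i + 1) ∧
        OverlapAt l (D.A 0) (D.B 0) (i + 1)) := by
    refine Finset.filter_congr fun i _ => and_congr_right fun h => ?_
    simp only [OverlapAt, LowerUpper.A_flip hS, LowerUpper.B_flip hS, if_neg h]
  have e4 : ((Finset.range (l - 1)).filter fun i => RowIn D k V 0 (i + 1) ∧
      OverlapAt l ((D.flip (RowIn D k V)).A 0) ((D.flip (RowIn D k V)).B 0) (i + 1)).card +
      ((Finset.range (l - 1)).filter fun i => RowIn D k V 0 (i + 1) ∧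
        OverlapAt l (D.A 0) (D.B 0) (i + 1)).card =
      ((Finset.range (l - 1)).filter fun i => RowIn D k V 0 (i + 1) ∧
      Odd (D.A 0 (i + 1) - D.B 0 (i + 1))).card := by
    rw [← Finset.card_union_of_disjoint]
    · congr 1
      ext i
      simp only [Finset.mem_union, Finset.mem_filter, ← and_or_left]
      refine and_congr_right fun _ => and_congr_right fun h => ?_
      have h1 := row_nonempty h
      have h2 := (hS _ _ h).2
      simp only [OverlapAt, LowerUpper.A_flip hS, LowerUpper.B_flip hS, if_pos h, h2, true_and]
      rw [Int.odd_iff, Int.odd_iff]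
      omega
    · rw [Finset.disjoint_filter]
      rintro i - ⟨h, h1⟩ ⟨-, h2⟩
      simp only [OverlapAt, LowerUpper.A_flip hS, LowerUpper.B_flip hS, if_pos h] at h1 h2
      omega
  rw [e2 (D.flip (RowIn D k V)), e2 D, e3, e1, ← e4]
  ring

end IsRegion

end TypeC

namespace SkewSeries

variable {R : Type*} [CommRing R] {τ : R →+* R}

theorem coeff_C_mul_X_mul (c : R) (f : SkewSeries τ) (k : ℕ) :
    (C c * X * f).coeff k = if k = 0 then 0 else c * τ (f.coeff (k - 1)) := by
  have hCX : ∀ j, (C c * X : SkewSeries τ).coeff j = if j = 1 then c else 0 := by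
    intro j
    rw [coeff_mul, Finset.sum_eq_single (0, j)]
    · simp [C, X]
    · rintro ⟨p, q⟩ h1 h2
      have : p ≠ 0 := by
        rintro rfl
        exact h2 (by simpa using h1)
      simp [C, this]
    · simp
  rw [coeff_mul]
  split_ifs with h
  · subst h
    simp [hCX]
  · rw [Finset.sum_eq_single (1, k - 1)]
    · simp [hCX]
    · rintro ⟨p, q⟩ h1 h2
      have : p ≠ 1 := by
        rintro rfl
        rw [Finset.HasAntidiagonal.mem_antidiagonal] at h1
        exact h2 (by simp only [Prod.mk.injEq, true_and]; omega)
      simp [hCX, this]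
    · intro h1
      exact absurd (by rw [Finset.HasAntidiagonal.mem_antidiagonal]; omega) h1

theorem inverse_eq_one_add {u : SkewSeries τ} (hu : u.coeff 0 = 0) :
    Ring.inverse (1 - u) = 1 + u * Ring.inverse (1 - u) := by
  have h := Ring.mul_inverse_cancel (1 - u) (isUnit_of_coeff_zero _ (by
    rw [coeff_sub, hu, coeff_one]; simp))
  rw [sub_mul, one_mul, sub_eq_iff_eq_add] at h
  exact h

theorem coeff_inverse_linear (c : R) (k : ℕ) :
    (Ring.inverse (1 - C c * X) : SkewSeries τ).coeff k =
      if k = 0 then 1 else c * τ ((Ring.inverse (1 - C c * X) : SkewSeries τ).coeff (k - 1)) := by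
  have h0 : (C c * X : SkewSeries τ).coeff 0 = 0 := by
    have := coeff_C_mul_X_mul (τ := τ) c 1 0
    rwa [mul_one, if_pos rfl] at this
  conv_lhs => rw [inverse_eq_one_add h0]
  rw [coeff_add, coeff_C_mul_X_mul, coeff_one]
  split_ifs <;> simp

theorem coeff_inverse_quadratic (c d : R) (k : ℕ) :
    (Ring.inverse (1 - C c * X * C d * X) : SkewSeries τ).coeff k =
      if k = 0 then 1 else if k = 1 then 0 else
        c * τ (d * τ ((Ring.inverse (1 - C c * X * C d * X) : SkewSeries τ).coeff (k - 2))) := by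
  have e : (C c * X * C d * X : SkewSeries τ) = C c * X * (C d * X) := by rw [mul_assoc (C c * X)]
  have h0 : (C c * X * C d * X : SkewSeries τ).coeff 0 = 0 := by
    rw [e, coeff_C_mul_X_mul, if_pos rfl]
  conv_lhs => rw [inverse_eq_one_add h0]
  rw [coeff_add, e, mul_assoc (C c * X), coeff_C_mul_X_mul, coeff_C_mul_X_mul, coeff_one]
  by_cases h1 : k = 0
  · simp [h1]
  · by_cases h2 : k = 1
    · simp [h2]
    · have h3 : k - 1 ≠ 0 := by omega
      have h4 : k - 1 - 1 = k - 2 := by omega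
      simp [h1, h2, h3, h4]

end SkewSeries

namespace TypeC

/-! ## Transfer matrices -/

section Transfer

variable {n : ℕ}

/-- A family of series compatible with the shift. -/
def Equivariant (f : ℂ → SkewSeries (shift n)) : Prop :=
  ∀ a k, shift n ((f a).coeff k) = (f (a - 2)).coeff k

/-- The entry in row `x` and column `x'` of the transfer matrix of a family of series. -/
noncomputable def entry (f : ℂ → SkewSeries (shift n)) (a : ℂ) (x x' : ℤ) : ZRing n :=
  if x ≤ x' then (f (a + 2 * ((x' : ℂ) - 1))).coeff (x' - x).toNat else 0

theorem Equivariant.iterate {f : ℂ → SkewSeries (shift n)} (hf : Equivariant f) (a : ℂ) (k p : ℕ) :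
    (shift n)^[p] ((f a).coeff k) = (f (a - 2 * p)).coeff k := by
  induction p with
  | zero => simp
  | succ p ih =>
    rw [Function.iterate_succ_apply', ih, hf]
    congr 2
    push_cast
    ring

theorem entry_mul {f g : ℂ → SkewSeries (shift n)} (hg : Equivariant g) (a : ℂ) (x x'' : ℤ) :
    entry (fun a => f a * g a) a x x'' =
      ∑ x' ∈ Finset.Icc x x'', entry g a x x' * entry f a x' x'' := by
  unfold entry
  split_ifs with h
  · rw [SkewSeries.coeff_mul]
    refine Finset.sum_nbij' (fun q => x + q.2) (fun x' => ((x'' - x').toNat, (x' - x).toNat))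
      ?_ ?_ ?_ ?_ ?_
    · rintro ⟨p, q⟩ hq
      rw [Finset.HasAntidiagonal.mem_antidiagonal] at hq
      simp only [Finset.mem_Icc] at hq ⊢
      omega
    · intro x' hx
      rw [Finset.mem_Icc] at hx
      rw [Finset.HasAntidiagonal.mem_antidiagonal]
      omega
    · rintro ⟨p, q⟩ hq
      rw [Finset.HasAntidiagonal.mem_antidiagonal] at hq
      simp only [Prod.mk.injEq] at hq ⊢
      omega
    · intro x' hx
      rw [Finset.mem_Icc] at hx
      simp only
      omega
    · rintro ⟨p, q⟩ hq
      rw [Finset.HasAntidiagonal.mem_antidiagonal] at hq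
      simp only at hq ⊢
      rw [if_pos (by omega), if_pos (by omega), hg.iterate, mul_comm]
      congr 2
      · congr 1
        have : (p : ℂ) = x'' - x - q := by
          have : (p : ℤ) = x'' - x - q := by omega
          exact_mod_cast congrArg (Int.cast (R := ℂ)) this
        rw [this]
        push_cast
        ring
      · omega
      · omega
  · rw [Finset.Icc_eq_empty h, Finset.sum_empty]

theorem Equivariant.mul {f g : ℂ → SkewSeries (shift n)} (hf : Equivariant f)
    (hg : Equivariant g) : Equivariant (fun a => f a * g a) := by
  intro a k
  simp only [SkewSeries.coeff_mul, map_sum, map_mul]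
  refine Finset.sum_congr rfl fun q _ => ?_
  rw [hf, hg.iterate, hg, hg.iterate]
  congr 3
  ring

/-- The weight of a stretch at height `y` from `x` to `x'`. -/
noncomputable def stretch (n : ℕ) (a : ℂ) (y x x' : ℤ) : ZRing n :=
  if y < 0 then ∏ s ∈ Finset.Ico x x', z n (n + 1 + y).toNat (a + 2 * s)
  else if 0 < y then ∏ s ∈ Finset.Ico x x', zbar n (n + 1 - y).toNat (a + 2 * s)
  else if Even (x' - x) then ∏ s ∈ Finset.Ico x x',
    if Even (s - x) then zbar n n (a + 2 * s) else z n n (a + 2 * s)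
  else 0

open SkewSeries in
/-- The factor of `H` belonging to the height `y`. -/
noncomputable def factor (n : ℕ) (y : ℤ) (a : ℂ) : SkewSeries (shift n) :=
  if y < 0 then Ring.inverse (1 - C (z n (n + 1 + y).toNat a) * X)
  else if 0 < y then Ring.inverse (1 - C (zbar n (n + 1 - y).toNat a) * X)
  else Ring.inverse (1 - C (z n n a) * X * C (zbar n n a) * X)

theorem prod_Ico_int_succ {M : Type*} [CommMonoid M] (f : ℤ → M) (x : ℤ) (m : ℕ) :
    ∏ s ∈ Finset.Ico x (x + ((m + 1 : ℕ) : ℤ)), f s = (∏ s ∈ Finset.Ico x (x + m), f s) * f (x + m) := by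
  have : Finset.Ico x (x + ((m + 1 : ℕ) : ℤ)) = insert (x + (m : ℤ)) (Finset.Ico x (x + m)) := by
    ext s
    simp only [Finset.mem_insert, Finset.mem_Ico]
    omega
  rw [this, Finset.prod_insert (by simp), mul_comm]

theorem prod_Ico_int_eq_range {M : Type*} [CommMonoid M] (f : ℤ → M) (x : ℤ) (m : ℕ) :
    ∏ s ∈ Finset.Ico x (x + m), f s = ∏ j ∈ Finset.range m, f (x + m - 1 - j) := by
  induction m with
  | zero => simp
  | succ m ih =>
    rw [prod_Ico_int_succ, ih, Finset.prod_range_succ']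
    congr 1
    · refine Finset.prod_congr rfl fun j _ => congrArg f ?_
      push_cast
      ring
    · congr 1
      push_cast
      ring

section Linear

variable {c : ℂ → ZRing n} (hc : ∀ a, shift n (c a) = c (a - 2))

include hc

open SkewSeries in
theorem coeff_inverse_linear_eq_prod (a : ℂ) (k : ℕ) :
    (Ring.inverse (1 - C (c a) * X) : SkewSeries (shift n)).coeff k =
      ∏ j ∈ Finset.range k, c (a - 2 * j) := by
  induction k generalizing a with
  | zero => rw [coeff_inverse_linear]; simp
  | succ k ih =>
    rw [coeff_inverse_linear, if_neg (Nat.succ_ne_zero k), Nat.add_sub_cancel, ih, map_prod,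
      Finset.prod_range_succ', mul_comm]
    congr 1
    · refine Finset.prod_congr rfl fun j _ => ?_
      rw [hc]
      congr 1
      push_cast
      ring
    · simp

open SkewSeries in
theorem equivariant_inverse_linear :
    Equivariant (fun a => (Ring.inverse (1 - C (c a) * X) : SkewSeries (shift n))) := by
  intro a k
  rw [coeff_inverse_linear_eq_prod hc, coeff_inverse_linear_eq_prod hc, map_prod]
  refine Finset.prod_congr rfl fun j _ => ?_
  rw [hc]
  congr 1
  ring

open SkewSeries in
theorem entry_inverse_linear (a : ℂ) (x : ℤ) (m : ℕ) :
    entry (fun a => (Ring.inverse (1 - C (c a) * X) : SkewSeries (shift n))) a x (x + m) =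
      ∏ s ∈ Finset.Ico x (x + m), c (a + 2 * s) := by
  rw [entry, if_pos (by omega), coeff_inverse_linear_eq_prod hc,
    prod_Ico_int_eq_range (fun s => c (a + 2 * (s : ℂ))), show (x + (m : ℤ) - x).toNat = m by omega]
  refine Finset.prod_congr rfl fun j _ => congrArg c ?_
  push_cast
  ring

end Linear

theorem even_add_two_iff {k : ℕ} : Even (k + 2) ↔ Even k := by
  simp [Nat.even_add]

open SkewSeries in
theorem coeff_factor_zero (a : ℂ) (k : ℕ) :
    (Ring.inverse (1 - C (z n n a) * X * C (zbar n n a) * X) : SkewSeries (shift n)).coeff k =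
      if Even k then ∏ j ∈ Finset.range k,
        if Even j then z n n (a - 2 * j) else zbar n n (a - 2 * j) else 0 := by
  induction k using Nat.strong_induction_on generalizing a with
  | _ k ih =>
    rw [coeff_inverse_quadratic]
    match k, ih with
    | 0, _ => simp
    | 1, _ => simp
    | k + 2, ih =>
      rw [if_neg (by omega), if_neg (by omega), Nat.add_sub_cancel, ih k (by omega)]
      by_cases hk : Even k
      · have hk2 : Even (k + 2) := by rwa [even_add_two_iff]
        rw [if_pos hk, if_pos hk2, Finset.prod_range_succ', Finset.prod_range_succ']
        simp only [map_mul, map_prod, shift_zbar]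
        rw [mul_comm (zbar n n (a - 2)), ← mul_assoc, mul_comm (z n n a), mul_assoc, mul_assoc]
        congr 1
        · refine Finset.prod_congr rfl fun j _ => ?_
          have : Even (j + 1 + 1) ↔ Even j := even_add_two_iff
          simp only [this]
          split_ifs
          · rw [shift_z, shift_z]; congr 1; push_cast; ring
          · rw [shift_zbar, shift_zbar]; congr 1; push_cast; ring
        · rw [mul_comm]
          simp
      · have hk2 : ¬ Even (k + 2) := by rwa [even_add_two_iff]
        simp [hk, hk2]

theorem equivariant_factor (y : ℤ) : Equivariant (factor n y) := by
  unfold factor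
  split_ifs
  · exact equivariant_inverse_linear fun a => shift_z _ _ _
  · exact equivariant_inverse_linear fun a => shift_zbar _ _ _
  · intro a k
    rw [coeff_factor_zero, coeff_factor_zero]
    split_ifs
    · rw [map_prod]
      refine Finset.prod_congr rfl fun j _ => ?_
      split_ifs
      · rw [shift_z]; congr 1; ring
      · rw [shift_zbar]; congr 1; ring
    · simp

theorem entry_factor (a : ℂ) (y : ℤ) {x x' : ℤ} (h : x ≤ x') :
    entry (factor n y) a x x' = stretch n a y x x' := by
  obtain ⟨m, rfl⟩ : ∃ m : ℕ, x' = x + m := ⟨(x' - x).toNat, by omega⟩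
  unfold factor stretch
  split_ifs with h1 h2 h3
  · exact entry_inverse_linear (c := z n (n + 1 + y).toNat) (fun a => shift_z n _ a) a x m
  · exact entry_inverse_linear (c := zbar n (n + 1 - y).toNat) (fun a => shift_zbar n _ a) a x m
  · have hm : Even m := by
      rw [add_sub_cancel_left] at h3
      exact_mod_cast h3
    rw [entry, if_pos h, coeff_factor_zero, show (x + (m : ℤ) - x).toNat = m by omega, if_pos hm,
      prod_Ico_int_eq_range (fun s => if Even (s - x) then zbar n n (a + 2 * (s : ℂ)) else
        z n n (a + 2 * (s : ℂ)))]
    refine Finset.prod_congr rfl fun j hj => ?_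
    have e : Even (x + (m : ℤ) - 1 - j - x) ↔ ¬ Even j := by
      rw [Nat.even_iff] at hm
      rw [Nat.even_iff, Int.even_iff]
      omega
    simp only [e]
    by_cases hj : Even j
    · rw [if_pos hj, if_neg (by simpa using hj)]
      congr 1
      push_cast
      ring
    · rw [if_neg hj, if_pos hj]
      congr 1
      push_cast
      ring
  · have hm : ¬ Even m := by
      rw [add_sub_cancel_left] at h3
      exact_mod_cast h3
    rw [entry, if_pos h, coeff_factor_zero, show (x + (m : ℤ) - x).toNat = m by omega, if_neg hm]

/-- The product of the factors of the lowest `m` heights. -/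
noncomputable def partialProd (n : ℕ) : ℕ → ℂ → SkewSeries (shift n)
  | 0, _ => 1
  | m + 1, a => factor n ((m : ℤ) - n) a * partialProd n m a

theorem equivariant_partialProd (m : ℕ) : Equivariant (partialProd n m) := by
  induction m with
  | zero =>
    intro a k
    simp only [partialProd, SkewSeries.coeff_one]
    split_ifs <;> simp
  | succ m ih => exact (equivariant_factor _).mul ih

theorem partialProd_eq_prod (m : ℕ) (a : ℂ) : partialProd n m a =
    (List.ofFn fun i : Fin m => factor n ((i : ℤ) - n) a).reverse.prod := by
  induction m with
  | zero => simp [partialProd]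
  | succ m ih =>
    rw [List.ofFn_succ', List.concat_eq_append, List.reverse_append, List.prod_append]
    simp [partialProd, ih]

theorem H_eq_partialProd (a : ℂ) : H n a = partialProd n (n + 1 + n) a := by
  rw [partialProd_eq_prod, List.ofFn_add, List.reverse_append, List.prod_append, H]
  rw [List.ofFn_succ', List.concat_eq_append, List.reverse_append, List.prod_append, ← mul_assoc]
  congr 1
  · congr 1
    · congr 1
      apply List.ext_getElem
      · simp
      · intro i h1 h2
        simp only [List.length_ofFn] at h1
        rw [List.getElem_reverse]
        simp only [List.getElem_ofFn, List.length_ofFn, factor, Fin.val_natAdd]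
        rw [if_neg (by omega), if_pos (by omega)]
        have : ((n : ℤ) + 1 - (((n + 1 + (n - 1 - i) : ℕ) : ℤ) - n)).toNat = i + 1 := by omega
        rw [this]
    · simp [factor]
  · congr 2
    refine List.ofFn_inj.2 (funext fun i => ?_)
    change _ = factor n ((i : ℤ) - n) a
    rw [factor, if_pos (by omega)]
    have : ((n : ℤ) + 1 + ((i : ℤ) - n)).toNat = i + 1 := by omega
    rw [this]

theorem h_eq_entry (a : ℂ) (x x' : ℤ) : h n (x' - x) (a + 2 * ((x' : ℂ) - 1)) =
    entry (H n) a x x' := by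
  unfold h entry
  by_cases hx : x ≤ x'
  · rw [if_pos hx, if_pos (by omega)]
  · rw [if_neg hx, if_neg (by omega)]

/-! ## Chains -/

/-- Weakly increasing sequences from `u` to `v`, constant after `m` steps. -/
noncomputable def chains : ℕ → ℤ → ℤ → Finset (ℕ → ℤ)
  | 0, u, v => by classical exact if u = v then {fun _ => v} else ∅
  | m + 1, u, v => by
    classical exact (Finset.Icc u v).biUnion fun w =>
      (chains m u w).image fun c j => if j ≤ m then c j else v

theorem mem_chains {m : ℕ} {u v : ℤ} {c : ℕ → ℤ} :
    c ∈ chains m u v ↔ c 0 = u ∧ (∀ j, m ≤ j → c j = v) ∧ Monotone c := by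
  classical
  induction m generalizing v c with
  | zero =>
    rw [chains]
    constructor
    · split_ifs with h
      · intro hc
        rw [Finset.mem_singleton] at hc
        subst hc
        exact ⟨h.symm, fun _ _ => rfl, monotone_const⟩
      · intro hc
        simp at hc
    · rintro ⟨h1, h2, -⟩
      rw [if_pos (by rw [← h1, h2 0 le_rfl]), Finset.mem_singleton]
      funext j
      exact h2 j (Nat.zero_le j)
  | succ m ih =>
    rw [chains]
    simp only [Finset.mem_biUnion, Finset.mem_image, Finset.mem_Icc]
    constructor
    · rintro ⟨w, hw, c, hc, rfl⟩
      obtain ⟨h1, h2, h3⟩ := ih.1 hc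
      refine ⟨by simp [h1], fun j hj => if_neg (by omega), ?_⟩
      refine monotone_nat_of_le_succ fun j => ?_
      rcases lt_trichotomy j m with h | rfl | h
      · rw [if_pos h.le, if_pos (by omega)]
        exact h3 (Nat.le_succ j)
      · rw [if_pos le_rfl, if_neg (by omega), h2 j le_rfl]
        exact hw.2
      · rw [if_neg (by omega), if_neg (by omega)]
    · rintro ⟨h1, h2, h3⟩
      refine ⟨c m, ⟨h1 ▸ h3 (Nat.zero_le m), h2 (m + 1) le_rfl ▸ h3 (Nat.le_succ m)⟩,
        fun j => c (min j m), ih.2 ⟨by simpa using h1, fun j hj => by simp [hj],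
          fun i j hij => h3 (min_le_min_right m hij)⟩, ?_⟩
      funext j
      split_ifs with h
      · simp only [min_eq_left h]
      · rw [h2 j (by omega)]

theorem sum_chains_succ {M : Type*} [AddCommMonoid M] (m : ℕ) (u v : ℤ) (f : (ℕ → ℤ) → M) :
    ∑ c ∈ chains (m + 1) u v, f c =
      ∑ w ∈ Finset.Icc u v, ∑ c ∈ chains m u w, f fun j => if j ≤ m then c j else v := by
  classical
  rw [chains, Finset.sum_biUnion]
  · refine Finset.sum_congr rfl fun w _ => Finset.sum_image ?_
    intro c hc c' hc' h
    have h1 := (mem_chains.1 hc).2.1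
    have h2 := (mem_chains.1 hc').2.1
    funext j
    rcases le_total j m with hj | hj
    · simpa [hj] using congrFun h j
    · rw [h1 j hj, h2 j hj]
  · intro w _ w' _ hne
    rw [Function.onFun, Finset.disjoint_left]
    intro c hc hc'
    simp only [Finset.mem_image] at hc hc'
    obtain ⟨d, hd, rfl⟩ := hc
    obtain ⟨d', hd', h⟩ := hc'
    have := congrFun h m
    simp only [le_refl, if_true] at this
    rw [(mem_chains.1 hd).2.1 m le_rfl, (mem_chains.1 hd').2.1 m le_rfl] at this
    exact hne this.symm

theorem entry_partialProd (a : ℂ) (m : ℕ) (u v : ℤ) : entry (partialProd n m) a u v =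
    ∑ c ∈ chains m u v, ∏ j ∈ Finset.range m, stretch n a ((j : ℤ) - n) (c j) (c (j + 1)) := by
  classical
  induction m generalizing v with
  | zero =>
    rw [chains, entry]
    simp only [partialProd, SkewSeries.coeff_one, Finset.range_zero, Finset.prod_empty]
    rcases lt_trichotomy u v with h | rfl | h
    · rw [if_pos h.le, if_neg (by omega), if_neg h.ne, Finset.sum_empty]
    · simp
    · rw [if_neg (by omega), if_neg h.ne', Finset.sum_empty]
  | succ m ih =>
    have := entry_mul (f := factor n ((m : ℤ) - n)) (equivariant_partialProd (n := n) m) a u v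
    have e : partialProd n (m + 1) = fun a => factor n ((m : ℤ) - n) a * partialProd n m a := rfl
    rw [e, this, sum_chains_succ]
    refine Finset.sum_congr rfl fun w hw => ?_
    rw [Finset.mem_Icc] at hw
    rw [ih, Finset.sum_mul]
    refine Finset.sum_congr rfl fun c hc => ?_
    rw [Finset.prod_range_succ, entry_factor _ _ hw.2]
    congr 1
    · refine Finset.prod_congr rfl fun j hj => ?_
      rw [Finset.mem_range] at hj
      simp only [hj.le, if_true, Nat.succ_le_of_lt hj]
    · simp [(mem_chains.1 hc).2.1 m le_rfl]

end Transfer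

/-! ## The determinant as a signed sum over tuples of paths -/

namespace Path

variable {n : ℕ}

/-- The paths between two horizontal positions. -/
def between (n : ℕ) (u v : ℤ) : Set (Path n) := {p | p.left (-n) = u ∧ p.left (n + 1) = v}

/-- The sequence of leftmost positions from bottom to top. -/
def toChain (p : Path n) : ℕ → ℤ := fun j => p.left (j - n)

theorem toChain_injective : Function.Injective (toChain (n := n)) := by
  intro p q h
  have key : ∀ y : ℤ, -n ≤ y → p.left y = q.left y := fun y hy => by
    have := congrFun h (y + n).toNat
    unfold toChain at this
    rwa [Int.toNat_of_nonneg (by omega), add_sub_cancel_right] at this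
  ext y
  rcases le_total (-(n : ℤ)) y with hy | hy
  · exact key y hy
  · rw [p.left_of_le y hy, q.left_of_le y hy, key _ le_rfl]

theorem toChain_mem {u v : ℤ} {p : Path n} (hp : p ∈ between n u v) :
    p.toChain ∈ chains (n + 1 + n) u v := by
  rw [mem_chains]
  refine ⟨by simpa [toChain] using hp.1, fun j hj => ?_, fun i j hij => p.mono (by omega)⟩
  rw [toChain, p.left_of_ge _ (by omega)]
  exact hp.2

theorem finite_between (u v : ℤ) : (between n u v).Finite :=
  Set.Finite.of_injOn (f := toChain) (fun _ hp => toChain_mem hp) toChain_injective.injOn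
    (Finset.finite_toSet _)

/-- The path with a given sequence of leftmost positions. -/
def ofChain {u v : ℤ} {c : ℕ → ℤ} (hc : c ∈ chains (n + 1 + n) u v)
    (he : Even (c (n + 1) - c n)) : Path n where
  left y := c (y + n).toNat
  mono y y' h := (mem_chains.1 hc).2.2 (by omega)
  left_of_le y hy := by congr 1; omega
  left_of_ge y hy := by
    rw [(mem_chains.1 hc).2.1 _ (by omega), (mem_chains.1 hc).2.1 _ (by omega)]
  even_zero := by
    have e1 : ((1 : ℤ) + n).toNat = n + 1 := by omega
    have e2 : ((0 : ℤ) + n).toNat = n := by omega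
    rwa [e1, e2]

theorem ofChain_mem {u v : ℤ} {c : ℕ → ℤ} (hc : c ∈ chains (n + 1 + n) u v)
    (he : Even (c (n + 1) - c n)) : ofChain hc he ∈ between n u v := by
  have h := mem_chains.1 hc
  constructor
  · have : (-(n : ℤ) + n).toNat = 0 := by omega
    simp only [ofChain, this, h.1]
  · exact h.2.1 _ (by omega)

theorem toChain_ofChain {u v : ℤ} {c : ℕ → ℤ} (hc : c ∈ chains (n + 1 + n) u v)
    (he : Even (c (n + 1) - c n)) : (ofChain hc he).toChain = c := by
  funext j
  simp [toChain, ofChain]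

theorem weight_eq_prod_stretch (p : Path n) (a : ℂ) :
    p.weight a = ∏ y ∈ Finset.Icc (-(n : ℤ)) n, stretch n a y (p.left y) (p.right y) := by
  refine Finset.prod_congr rfl fun y _ => ?_
  unfold stretch stepWeight
  split_ifs with h1 h2 h3
  · rfl
  · rfl
  · obtain rfl : y = 0 := by omega
    rfl
  · obtain rfl : y = 0 := by omega
    exact absurd p.even_zero h3

theorem prod_heights {M : Type*} [CommMonoid M] (f : ℤ → M) :
    ∏ y ∈ Finset.Icc (-(n : ℤ)) n, f y = ∏ j ∈ Finset.range (n + 1 + n), f ((j : ℤ) - n) := by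
  refine Finset.prod_nbij' (fun y => (y + n).toNat) (fun j => (j : ℤ) - n) ?_ ?_ ?_ ?_ ?_
  · intro y hy
    rw [Finset.mem_Icc] at hy
    rw [Finset.mem_range]
    omega
  · intro j hj
    rw [Finset.mem_range] at hj
    rw [Finset.mem_Icc]
    omega
  · intro y hy
    rw [Finset.mem_Icc] at hy
    omega
  · intro j hj
    omega
  · intro y hy
    rw [Finset.mem_Icc] at hy
    congr 1
    omega

theorem weight_eq_chain (p : Path n) (a : ℂ) : p.weight a =
    ∏ j ∈ Finset.range (n + 1 + n),
      stretch n a ((j : ℤ) - n) (p.toChain j) (p.toChain (j + 1)) := by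
  rw [weight_eq_prod_stretch, prod_heights]
  refine Finset.prod_congr rfl fun j _ => ?_
  unfold toChain right
  congr 2
  push_cast
  ring

theorem entry_H (a : ℂ) (u v : ℤ) :
    entry (H n) a u v = ∑ p ∈ (finite_between (n := n) u v).toFinset, p.weight a := by
  have : H n = partialProd n (n + 1 + n) := funext H_eq_partialProd
  rw [this, entry_partialProd]
  symm
  refine Finset.sum_of_injOn toChain toChain_injective.injOn ?_ ?_ ?_
  · intro p hp
    rw [Set.Finite.coe_toFinset] at hp
    exact toChain_mem hp
  · intro c hc hc'
    refine Finset.prod_eq_zero (i := n) (by rw [Finset.mem_range]; omega) ?_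
    rw [sub_self, stretch, if_neg (lt_irrefl 0), if_neg (lt_irrefl 0), if_neg]
    intro he
    refine hc' ⟨ofChain hc he, ?_, toChain_ofChain hc he⟩
    rw [Set.Finite.coe_toFinset]
    exact ofChain_mem hc he
  · intro p _
    exact p.weight_eq_chain a

theorem source_eq_iff {p : Path n} {u : ℤ} : p.source = (u, -(n : ℤ) - 1) ↔ p.left (-n) = u := by
  rw [source, p.left_of_le (-n - 1) (by omega)]
  simp

theorem target_eq_iff {p : Path n} {v : ℤ} : p.target = (v, (n : ℤ) + 1) ↔ p.left (n + 1) = v := by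
  rw [target, right, p.left_of_ge (n + 1 + 1) (by omega)]
  simp

end Path

section Determinant

variable (n : ℕ) (lam mu : YoungDiagram)

theorem mem_pathTuples {n : ℕ} {lam mu : YoungDiagram}
    {t : Equiv.Perm (Fin (len lam)) × (Fin (len lam) → Path n)} :
    t ∈ pathTuples n lam mu ↔ ∀ i, (t.2 i).left (-n) = (mu.rowLen i : ℤ) - i ∧
      (t.2 i).left (n + 1) = (lam.rowLen (t.1 i) : ℤ) - (t.1 i : ℕ) :=
  forall_congr' fun _ => and_congr Path.source_eq_iff Path.target_eq_iff

theorem finite_pathTuples : (pathTuples n lam mu).Finite := by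
  have : pathTuples n lam mu ⊆ ⋃ σ : Equiv.Perm (Fin (len lam)), Prod.mk σ '' (Set.pi Set.univ
      fun i => Path.between n ((mu.rowLen i : ℤ) - i) ((lam.rowLen (σ i) : ℤ) - (σ i : ℕ))) := by
    rintro ⟨σ, p⟩ ht
    exact Set.mem_iUnion.2 ⟨σ, p, fun i _ => mem_pathTuples.1 ht i, rfl⟩
  refine Set.Finite.subset (Set.finite_iUnion fun σ => ?_) this
  exact (Set.Finite.pi fun i => Path.finite_between _ _).image _

theorem chi_eq_sum (a : ℂ) : chi n lam mu a = ∑ t ∈ (finite_pathTuples n lam mu).toFinset,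
    (Equiv.Perm.sign t.1 : ℤ) * tupleWeight t a := by
  classical
  rw [chi, Matrix.det_apply']
  have e : ∀ σ : Equiv.Perm (Fin (len lam)), ∏ i, (Matrix.of fun i j : Fin (len lam) =>
      h n ((lam.rowLen i : ℤ) - mu.rowLen j - i + j) (a + 2 * ((lam.rowLen i : ℂ) - (i + 1)))) (σ i) i =
      ∑ p ∈ Fintype.piFinset fun i : Fin (len lam) => (Path.finite_between (n := n) ((mu.rowLen i : ℤ) - i)
        ((lam.rowLen (σ i) : ℤ) - (σ i : ℕ))).toFinset, ∏ i, (p i).weight a := fun σ => by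
    refine Eq.trans ?_ (Finset.prod_univ_sum _ fun _ p => Path.weight p a)
    refine Finset.prod_congr rfl fun i _ => ?_
    rw [← Path.entry_H, ← h_eq_entry, Matrix.of_apply]
    congr 1
    · ring
    · push_cast
      ring
  simp only [e, Finset.mul_sum]
  rw [Finset.sum_sigma']
  refine Finset.sum_nbij' (fun t => (t.1, t.2)) (fun t => ⟨t.1, t.2⟩) ?_ ?_ ?_ ?_ ?_
  · rintro ⟨σ, p⟩ ht
    rw [Set.Finite.mem_toFinset, mem_pathTuples]
    simp only [Finset.mem_sigma, Finset.mem_univ, true_and, Fintype.mem_piFinset,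
      Set.Finite.mem_toFinset] at ht
    exact ht
  · rintro ⟨σ, p⟩ ht
    rw [Set.Finite.mem_toFinset, mem_pathTuples] at ht
    simp only [Finset.mem_sigma, Finset.mem_univ, true_and, Fintype.mem_piFinset,
      Set.Finite.mem_toFinset]
    exact ht
  · rintro ⟨σ, p⟩ _
    rfl
  · rintro ⟨σ, p⟩ _
    rfl
  · rintro ⟨σ, p⟩ _
    rfl

end Determinant

/-! ## Weights as differences of potentials -/

section Units

variable {n : ℕ}

theorem z_zero (a : ℂ) : z n 0 a = 1 := by simp [z, zPoly]
theorem zbar_zero (a : ℂ) : zbar n 0 a = 1 := by simp [zbar, zbarPoly]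

theorem z_mul_zbar {i : ℕ} (hi : 1 ≤ i) (hin : i ≤ n) (a : ℂ) :
    z n i a * zbar n i (a - 2 * n + 2 * i - 4) =
      z n (i - 1) a * zbar n (i - 1) (a - 2 * n + 2 * i - 4) := by
  unfold z zbar
  rw [← map_mul, ← map_mul, Ideal.Quotient.mk_eq_mk_iff_sub_mem]
  exact Ideal.subset_span ⟨i, a, hi, hin, rfl⟩

theorem isUnit_z_zbar {i : ℕ} (hi : i ≤ n) : ∀ a, IsUnit (z n i a) ∧ IsUnit (zbar n i a) := by
  induction i with
  | zero => exact fun a => by simp [z_zero, zbar_zero]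
  | succ i ih =>
    have key : ∀ a, IsUnit (z n (i + 1) a) ∧
        IsUnit (zbar n (i + 1) (a - 2 * n + 2 * (i + 1 : ℕ) - 4)) := fun a => by
      rw [← IsUnit.mul_iff, z_mul_zbar (by omega) hi]
      exact ((ih (by omega) _).1).mul ((ih (by omega) _).2)
    refine fun a => ⟨(key a).1, ?_⟩
    have := (key (a + 2 * n - 2 * (i + 1 : ℕ) + 4)).2
    convert this using 2
    ring

open Classical in
/-- `z_{i,a}` as a unit. -/
noncomputable def zUnit (n i : ℕ) (a : ℂ) : (ZRing n)ˣ :=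
  if h : i ≤ n then (isUnit_z_zbar h a).1.unit else 1

open Classical in
/-- `z_{ī,a}` as a unit. -/
noncomputable def zbarUnit (n i : ℕ) (a : ℂ) : (ZRing n)ˣ :=
  if h : i ≤ n then (isUnit_z_zbar h a).2.unit else 1

theorem coe_zUnit {i : ℕ} (hi : i ≤ n) (a : ℂ) : (zUnit n i a : ZRing n) = z n i a := by
  simp [zUnit, hi]

theorem coe_zbarUnit {i : ℕ} (hi : i ≤ n) (a : ℂ) : (zbarUnit n i a : ZRing n) = zbar n i a := by
  simp [zbarUnit, hi]

theorem zUnit_mul_zbarUnit {i : ℕ} (hi : 1 ≤ i) (hin : i ≤ n) (a : ℂ) :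
    zUnit n i a * zbarUnit n i (a - 2 * n + 2 * i - 4) =
      zUnit n (i - 1) a * zbarUnit n (i - 1) (a - 2 * n + 2 * i - 4) := by
  ext
  rw [Units.val_mul, Units.val_mul, coe_zUnit hin, coe_zbarUnit hin, coe_zUnit (by omega),
    coe_zbarUnit (by omega)]
  exact z_mul_zbar hi hin a

end Units

section Primitive

variable {G : Type*} [CommGroup G]

/-- A discrete antiderivative. -/
noncomputable def primitive (f : ℤ → G) (x : ℤ) : G :=
  (∏ s ∈ Finset.Ico 0 x, f s) * (∏ s ∈ Finset.Ico x 0, f s)⁻¹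

theorem primitive_succ (f : ℤ → G) (x : ℤ) : primitive f (x + 1) = primitive f x * f x := by
  unfold primitive
  rcases lt_or_ge x 0 with h | h
  · have e1 : Finset.Ico 0 (x + 1) = ∅ := Finset.Ico_eq_empty (by omega)
    have e2 : Finset.Ico 0 x = ∅ := Finset.Ico_eq_empty (by omega)
    have e3 : Finset.Ico x 0 = insert x (Finset.Ico (x + 1) 0) := by
      ext s
      simp only [Finset.mem_insert, Finset.mem_Ico]
      omega
    rw [e1, e2, e3, Finset.prod_insert (by simp)]
    simp
  · have e1 : Finset.Ico (x + 1) 0 = ∅ := Finset.Ico_eq_empty (by omega)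
    have e2 : Finset.Ico x 0 = ∅ := Finset.Ico_eq_empty (by omega)
    have e3 : Finset.Ico 0 (x + 1) = insert x (Finset.Ico 0 x) := by
      ext s
      simp only [Finset.mem_insert, Finset.mem_Ico]
      omega
    rw [e1, e2, e3, Finset.prod_insert (by simp)]
    simp [mul_comm]

theorem prod_Ico_eq_primitive {f F : ℤ → G} (hF : ∀ x, F (x + 1) = F x * f x) (x : ℤ) (m : ℕ) :
    ∏ s ∈ Finset.Ico x (x + m), f s = F (x + m) * (F x)⁻¹ := by
  induction m with
  | zero => simp
  | succ m ih =>
    rw [prod_Ico_int_succ, ih, Nat.cast_add, Nat.cast_one, ← add_assoc, hF, mul_right_comm]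

/-- A function whose products of consecutive values are prescribed. -/
noncomputable def halfPrimitive (c : ℤ → G) (x : ℤ) : G :=
  if Even x then primitive (fun s => if Even s then (c s)⁻¹ else c s) x
  else (primitive (fun s => if Even s then (c s)⁻¹ else c s) x)⁻¹

theorem halfPrimitive_mul (c : ℤ → G) (x : ℤ) :
    halfPrimitive c (x + 1) * halfPrimitive c x = c x := by
  unfold halfPrimitive
  by_cases h : Even x
  · have h' : ¬ Even (x + 1) := by simpa [Int.even_add_one] using h
    rw [if_neg h', if_pos h, primitive_succ, if_pos h]
    simp [mul_comm]
  · have h' : Even (x + 1) := by simpa [Int.even_add_one] using h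
    rw [if_pos h', if_neg h, primitive_succ, if_neg h]
    simp [mul_comm]

/-- Cancellation of quotients in a commutative group. -/
theorem quot_cancel {p q r s x x' y y' : G} (h : x * y = x' * y') :
    (p * x') * (q * x)⁻¹ * ((r * y) * (s * y')⁻¹)⁻¹ = p * q⁻¹ * (r * s⁻¹)⁻¹ := by
  have key : ∀ {A : Type _} [AddCommGroup A] {p q r s x x' y y' : A}, x + y = x' + y' →
      (p + x') + -(q + x) + -((r + y) + -(s + y')) = p + -q + -(r + -s) := by
    intro A _ p q r s x x' y y' h
    have : y' = x + y - x' := by rw [h]; abel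
    subst this
    abel
  exact key (A := Additive G) h

theorem mul_mul_swap (p q x y : G) : p * y * (q * x) = p * q * (x * y) := by
  rw [mul_mul_mul_comm, mul_comm y x]

theorem mul_inv_eq_of_mul_eq {p q x y : G} (h : x * y = p * q) : p * x⁻¹ = y * q⁻¹ := by
  rw [mul_inv_eq_iff_eq_mul, mul_right_comm, eq_mul_inv_iff_mul_eq, ← h, mul_comm]

theorem halfPrimitive_add_two {c : ℤ → G} {x : ℤ} {w : G} (h : c (x + 1) = c x * w) :
    halfPrimitive c (x + 2) = halfPrimitive c x * w := by
  have e1 := halfPrimitive_mul c (x + 1)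
  rw [h, ← halfPrimitive_mul c x, add_assoc, one_add_one_eq_two,
    mul_comm (halfPrimitive c (x + 1)), mul_right_comm] at e1
  exact mul_right_cancel e1

omit [CommGroup G] in
theorem eq_const_of_periodic {f : ℤ → G} (h : ∀ x, f (x + 1) = f x) (x : ℤ) : f x = f 0 := by
  induction x using Int.induction_on with
  | zero => rfl
  | succ i ih => rw [h, ih]
  | pred i ih => rw [← ih, ← h, sub_add_cancel]

end Primitive

section Potential

variable {n : ℕ}

/-- The potential of the steps at height `y`. -/
noncomputable def potential (n : ℕ) (a : ℂ) (y : ℤ) : ℤ → (ZRing n)ˣ :=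
  if y < 0 then primitive fun s => zUnit n (n + 1 + y).toNat (a + 2 * s)
  else if 0 < y then primitive fun s => zbarUnit n (n + 1 - y).toNat (a + 2 * s)
  else halfPrimitive fun x => primitive (fun s => zUnit n n (a + 2 * s)) (x + 1) *
    primitive (fun s => zbarUnit n n (a + 2 * s)) x

theorem potential_zero_add_two (a : ℂ) (x : ℤ) : potential n a 0 (x + 2) =
    potential n a 0 x * (zbarUnit n n (a + 2 * x) * zUnit n n (a + 2 * (x + 1 : ℤ))) := by
  simp only [potential, lt_irrefl, if_false]
  refine halfPrimitive_add_two ?_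
  rw [primitive_succ, primitive_succ (fun s : ℤ => zbarUnit n n (a + 2 * s))]
  exact mul_mul_swap _ _ _ _

theorem stretch_eq_potential (a : ℂ) {y u v : ℤ} (hy : -(n : ℤ) ≤ y) (hy' : y ≤ n) (h : u ≤ v)
    (he : y = 0 → Even (v - u)) :
    stretch n a y u v = (potential n a y v * (potential n a y u)⁻¹ : (ZRing n)ˣ) := by
  obtain ⟨m, rfl⟩ : ∃ m : ℕ, v = u + m := ⟨(v - u).toNat, by omega⟩
  unfold stretch
  split_ifs with h1 h2 h3
  · rw [potential, if_pos h1, ← prod_Ico_eq_primitive (primitive_succ _), Units.coe_prod]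
    exact Finset.prod_congr rfl fun s _ => (coe_zUnit (by omega) _).symm
  · rw [potential, if_neg h1, if_pos h2, ← prod_Ico_eq_primitive (primitive_succ _), Units.coe_prod]
    exact Finset.prod_congr rfl fun s _ => (coe_zbarUnit (by omega) _).symm
  · obtain rfl : y = 0 := by omega
    obtain ⟨k, rfl⟩ : ∃ k, m = 2 * k := by
      rw [add_sub_cancel_left] at h3
      exact (even_iff_exists_two_mul).1 (by exact_mod_cast h3)
    clear h h3 he
    induction k with
    | zero => simp
    | succ k ih =>
      have e1 : Even (u + ((2 * k : ℕ) : ℤ) - u) := by simp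
      have e2 : ¬ Even (u + ((2 * k + 1 : ℕ) : ℤ) - u) := by simp
      have e3 : u + ((2 * (k + 1) : ℕ) : ℤ) = u + ((2 * k : ℕ) : ℤ) + 2 := by push_cast; ring
      have e4 : u + ((2 * k + 1 : ℕ) : ℤ) = u + ((2 * k : ℕ) : ℤ) + 1 := by push_cast; ring
      rw [show 2 * (k + 1) = 2 * k + 1 + 1 by ring, prod_Ico_int_succ, prod_Ico_int_succ, ih,
        if_pos e1, if_neg e2, show 2 * k + 1 + 1 = 2 * (k + 1) by ring, e3,
        potential_zero_add_two, e4, ← coe_zUnit le_rfl, ← coe_zbarUnit le_rfl]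
      simp only [Units.val_mul]
      ring
  · exact absurd (he (by omega)) h3

/-- The potentials of the lower and the upper half are dual to each other. -/
theorem potential_dual (a : ℂ) {r : ℕ} (hr : r < n) : ∃ c : (ZRing n)ˣ, ∀ x : ℤ,
    potential n a (-(r : ℤ) - 1) x * (potential n a (-(r : ℤ)) x)⁻¹ =
      c * (potential n a r (x - 1 - r) * (potential n a (r + 1) (x - 1 - r))⁻¹) := by
  rcases Nat.eq_zero_or_pos r with rfl | h0
  · refine ⟨1, fun x => ?_⟩
    have e1 : ((n : ℤ) + 1 + (-((0 : ℕ) : ℤ) - 1)).toNat = n := by simp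
    have e2 : ((n : ℤ) + 1 - ((0 : ℕ) + 1)).toNat = n := by simp
    have e := halfPrimitive_mul (fun x => primitive (fun s : ℤ => zUnit n n (a + 2 * s)) (x + 1) *
      primitive (fun s : ℤ => zbarUnit n n (a + 2 * s)) x) (x - 1)
    simp only [sub_add_cancel] at e
    simp only [potential, e1, e2]
    simp only [Nat.cast_zero, neg_zero, zero_sub, lt_irrefl, if_false, sub_zero, zero_add,
      one_mul, show (-1 : ℤ) < 0 by omega, show ¬ (1 : ℤ) < 0 by omega, show (0 : ℤ) < 1 by omega,
      if_true]
    exact mul_inv_eq_of_mul_eq e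
  · set g : ℤ → (ZRing n)ˣ := fun x =>
      potential n a (-(r : ℤ) - 1) x * (potential n a (-(r : ℤ)) x)⁻¹ with hg
    set h : ℤ → (ZRing n)ˣ := fun x =>
      potential n a r (x - 1 - r) * (potential n a (r + 1) (x - 1 - r))⁻¹ with hh
    have step : ∀ x, g (x + 1) * (h (x + 1))⁻¹ = g x * (h x)⁻¹ := fun x => by
      have e1 : ((n : ℤ) + 1 + (-(r : ℤ) - 1)).toNat = n + 1 - r - 1 := by omega
      have e2 : ((n : ℤ) + 1 + (-(r : ℤ))).toNat = n + 1 - r := by omega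
      have e3 : ((n : ℤ) + 1 - r).toNat = n + 1 - r := by omega
      have e4 : ((n : ℤ) + 1 - (r + 1)).toNat = n + 1 - r - 1 := by omega
      have e5 : x + 1 - 1 - (r : ℤ) = x - 1 - r + 1 := by ring
      have rel := zUnit_mul_zbarUnit (n := n) (i := n + 1 - r) (by omega) (by omega) (a + 2 * x)
      have e6 : a + 2 * (x : ℂ) - 2 * n + 2 * ((n + 1 - r : ℕ) : ℂ) - 4 =
          a + 2 * ((x - 1 - r : ℤ) : ℂ) := by
        rw [Nat.cast_sub (by omega)]
        push_cast
        ring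
      rw [e6] at rel
      simp only [hg, hh, e5]
      simp only [potential, e1, e2, e3, e4, show -(r : ℤ) - 1 < 0 by omega,
        show -(r : ℤ) < 0 by omega, show ¬ (r : ℤ) < 0 by omega, show (0 : ℤ) < r by omega,
        show ¬ (r : ℤ) + 1 < 0 by omega, show (0 : ℤ) < r + 1 by omega, if_true, if_false,
        primitive_succ]
      exact quot_cancel rel
    refine ⟨g 0 * (h 0)⁻¹, fun x => ?_⟩
    have := eq_const_of_periodic (f := fun x => g x * (h x)⁻¹) step x
    change g x = g 0 * (h 0)⁻¹ * h x
    rw [← this, inv_mul_cancel_right]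

end Potential

/-! ## Weights of tuples -/

section TupleVal

variable {G : Type*} [CommGroup G] {l : ℕ}

/-- The product of the potential differences of `l` paths with leftmost positions `x y k`. -/
noncomputable def tupleVal (n : ℕ) (V : ℤ → ℤ → G) (x : ℤ → Fin l → ℤ) : G :=
  ∏ y ∈ Finset.Icc (-(n : ℤ)) n, ∏ k, (V y (x (y + 1) k) * (V y (x y k))⁻¹)

theorem tupleVal_congr {n : ℕ} (V : ℤ → ℤ → G) {x x' : ℤ → Fin l → ℤ}
    (h : ∀ y, ∃ π : Equiv.Perm (Fin l), ∀ k, x' y k = x y (π k)) :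
    tupleVal n V x' = tupleVal n V x := by
  refine Finset.prod_congr rfl fun y _ => ?_
  rw [Finset.prod_mul_distrib, Finset.prod_mul_distrib]
  obtain ⟨π, hπ⟩ := h y
  obtain ⟨ρ, hρ⟩ := h (y + 1)
  simp only [hπ, hρ]
  rw [Equiv.prod_comp ρ (fun k => V y (x (y + 1) k)),
    Equiv.prod_comp π (fun k => (V y (x y k))⁻¹)]

end TupleVal

theorem tupleWeight_eq_tupleVal {n l : ℕ} (t : Equiv.Perm (Fin l) × (Fin l → Path n)) (a : ℂ) :
    tupleWeight t a =
      (tupleVal n (potential n a) (fun y k => (t.2 k).left y) : (ZRing n)ˣ) := by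
  rw [tupleWeight, tupleVal, Units.coe_prod]
  simp only [Path.weight_eq_prod_stretch]
  rw [Finset.prod_comm]
  refine Finset.prod_congr rfl fun y hy => ?_
  rw [Units.coe_prod]
  refine Finset.prod_congr rfl fun k _ => ?_
  rw [Finset.mem_Icc] at hy
  refine stretch_eq_potential a hy.1 hy.2 ((t.2 k).mono (by omega)) fun h => ?_
  subst h
  exact (t.2 k).even_zero

/-! ## The first involution -/

namespace Path

variable {n : ℕ}

open Classical in
/-- The path which follows `p` up to height `y` and `q` above. -/
noncomputable def splice (p q : Path n) (y : ℤ) : Path n :=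
  if h : -(n : ℤ) ≤ y ∧ y ≤ n ∧ p.left y ≤ q.left (y + 1) ∧ (y = 0 → Even (q.left 1 - p.left 0))
  then
    { left := fun w => if w ≤ y then p.left w else q.left w
      mono := by
        intro w w' hw
        dsimp only
        split_ifs with h1 h2
        · exact p.mono hw
        · exact (p.mono h1).trans (h.2.2.1.trans (q.mono (by omega)))
        · omega
        · exact q.mono hw
      left_of_le := fun w hw => by
        rw [if_pos (by omega), if_pos (by omega), p.left_of_le w hw]
      left_of_ge := fun w hw => by
        rw [if_neg (by omega), if_neg (by omega), q.left_of_ge w hw]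
      even_zero := by
        rcases lt_trichotomy y 0 with h1 | h1 | h1
        · rw [if_neg (by omega), if_neg (by omega)]
          exact q.even_zero
        · rw [if_neg (by omega), if_pos (by omega)]
          exact h.2.2.2 h1
        · rw [if_pos (by omega), if_pos (by omega)]
          exact p.even_zero }
  else p

theorem splice_left {p q : Path n} {y : ℤ} (h : -(n : ℤ) ≤ y ∧ y ≤ n ∧
    p.left y ≤ q.left (y + 1) ∧ (y = 0 → Even (q.left 1 - p.left 0))) (w : ℤ) :
    (p.splice q y).left w = if w ≤ y then p.left w else q.left w := by
  rw [splice, dif_pos h]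

end Path

section FirstInvolution

variable {n l : ℕ}

/-- The path `k'` meets the path `k` at height `y`, from the right, and ordinarily. -/
def Collides (p : Fin l → Path n) (y : ℤ) (k k' : Fin l) : Prop :=
  -(n : ℤ) ≤ y ∧ y ≤ n ∧ (p k).left y ≤ (p k').left y ∧ (p k').left y ≤ (p k).left (y + 1) ∧
    (y = 0 → Even ((p k).left 0 - (p k').left 0))

theorem ordinarilyIntersecting_iff (hn : 1 ≤ n) (p : Fin l → Path n) (k k' : Fin l) :
    (p k).OrdinarilyIntersecting (p k') ↔ ∃ y, Collides p y k k' ∨ Collides p y k' k := by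
  constructor
  · rintro ⟨h1, h2⟩
    obtain ⟨⟨x, y⟩, hw, hodd⟩ : ∃ w ∈ (p k).points ∩ (p k').points,
        w.2 = 0 → Even ((p k).left 0 - (p k').left 0) := by
      by_contra! hc
      refine h2 ⟨h1, fun w hw => (hc w hw).1, ?_⟩
      obtain ⟨w, hw⟩ := h1
      exact Int.not_even_iff_odd.1 (hc w hw).2
    obtain ⟨⟨a1, a2, a3, a4⟩, -, -, b3, b4⟩ := hw
    simp only [Path.right] at a1 a2 a3 a4 b3 b4 hodd
    obtain ⟨w, hw1, hw2, hw0, c1, c2, c3, c4⟩ : ∃ w : ℤ, -(n : ℤ) ≤ w ∧ w ≤ n ∧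
        (w = 0 → y = 0) ∧ (p k).left w ≤ x ∧ x ≤ (p k).left (w + 1) ∧ (p k').left w ≤ x ∧
        x ≤ (p k').left (w + 1) := by
      rcases lt_or_ge y (-n) with h | h
      · refine ⟨-n, by omega, by omega, by omega, ?_, a4.trans ((p k).mono (by omega)), ?_,
          b4.trans ((p k').mono (by omega))⟩
        · rwa [← (p k).left_of_le y h.le]
        · rwa [← (p k').left_of_le y h.le]
      · rcases lt_or_ge (n : ℤ) y with h' | h'
        · refine ⟨n, by omega, by omega, by omega, ((p k).mono (by omega)).trans a3, ?_,
            ((p k').mono (by omega)).trans b3, ?_⟩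
          · rwa [← (p k).left_of_ge (y + 1) (by omega)]
          · rwa [← (p k').left_of_ge (y + 1) (by omega)]
        · exact ⟨y, h, h', id, a3, a4, b3, b4⟩
    refine ⟨w, ?_⟩
    rcases le_total ((p k).left w) ((p k').left w) with h | h
    · exact Or.inl ⟨hw1, hw2, h, c3.trans c2, fun h0 => hodd (hw0 h0)⟩
    · refine Or.inr ⟨hw1, hw2, h, c1.trans c4, fun h0 => ?_⟩
      rw [← neg_sub]
      exact (hodd (hw0 h0)).neg
  · have key : ∀ k k', (∃ y, Collides p y k k') → (p k).OrdinarilyIntersecting (p k') ∧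
        (p k').OrdinarilyIntersecting (p k) := by
      rintro k k' ⟨y, h1, h2, h3, h4, h5⟩
      have m1 : ((p k').left y, y) ∈ (p k).points := ⟨by simp only; omega, by simp only; omega,
        h3, h4⟩
      have m2 : ((p k').left y, y) ∈ (p k').points := ⟨by simp only; omega, by simp only; omega,
        le_rfl, (p k').mono (by simp)⟩
      refine ⟨⟨⟨_, m1, m2⟩, fun hs => ?_⟩, ⟨⟨_, m2, m1⟩, fun hs => ?_⟩⟩
      · have := h5 (hs.2.1 _ ⟨m1, m2⟩)
        exact Int.not_even_iff_odd.2 hs.2.2 this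
      · have := h5 (hs.2.1 _ ⟨m2, m1⟩)
        rw [← neg_sub] at this
        exact Int.not_even_iff_odd.2 hs.2.2 (by simpa using this.neg)
    rintro ⟨y, h | h⟩
    · exact (key k k' ⟨y, h⟩).1
    · exact (key k' k ⟨y, h⟩).2

/-- The tuple with the tails of the paths `k` and `k'` above the height `y` exchanged. -/
noncomputable def swapTails (t : Equiv.Perm (Fin l) × (Fin l → Path n)) (y : ℤ) (k k' : Fin l) :
    Equiv.Perm (Fin l) × (Fin l → Path n) :=
  (t.1 * Equiv.swap k k', fun m => (t.2 m).splice (t.2 (Equiv.swap k k' m)) y)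

variable {t : Equiv.Perm (Fin l) × (Fin l → Path n)} {y : ℤ} {k k' : Fin l}

theorem swapTails_left (h : Collides t.2 y k k') (m : Fin l) (w : ℤ) :
    ((swapTails t y k k').2 m).left w =
      if w ≤ y then (t.2 m).left w else (t.2 (Equiv.swap k k' m)).left w := by
  refine Path.splice_left ?_ w
  obtain ⟨h1, h2, h3, h4, h5⟩ := h
  refine ⟨h1, h2, ?_⟩
  by_cases hk : m = k
  · subst hk
    rw [Equiv.swap_apply_left]
    refine ⟨h3.trans ((t.2 k').mono (by omega)), fun h0 => ?_⟩
    have := (t.2 k').even_zero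
    have := h5 h0
    rw [Int.even_iff] at *
    omega
  · by_cases hk' : m = k'
    · subst hk'
      rw [Equiv.swap_apply_right]
      refine ⟨h4, fun h0 => ?_⟩
      have := (t.2 k).even_zero
      have := h5 h0
      rw [Int.even_iff] at *
      omega
    · rw [Equiv.swap_apply_of_ne_of_ne hk hk']
      exact ⟨(t.2 m).mono (by omega), fun _ => (t.2 m).even_zero⟩

/-- The lowest ordinary intersection: the leftmost path `k` involved, and the next one. -/
structure FirstCollision (p : Fin l → Path n) (y : ℤ) (k k' : Fin l) : Prop where
  ne : k ≠ k'
  coll : Collides p y k k'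
  first : ∀ w < y, ∀ m m', m ≠ m' → ¬ Collides p w m m'
  left_min : ∀ m m', m ≠ m' → Collides p y m m' → (p k).left y ≤ (p m).left y
  right_min : ∀ m, m ≠ k → (p k).left y ≤ (p m).left y →
    (y = 0 → Even ((p k).left 0 - (p m).left 0)) → (p k').left y ≤ (p m).left y

theorem exists_firstCollision {p : Fin l → Path n} (h : ∃ y k k', k ≠ k' ∧ Collides p y k k') :
    ∃ q : ℤ × Fin l × Fin l, FirstCollision p q.1 q.2.1 q.2.2 := by
  classical
  obtain ⟨⟨y, k, k'⟩, hy, hmin⟩ := Finset.exists_min_image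
    ((Finset.Icc (-(n : ℤ)) n ×ˢ (Finset.univ : Finset (Fin l × Fin l))).filter
      fun q => q.2.1 ≠ q.2.2 ∧ Collides p q.1 q.2.1 q.2.2) (fun q => q.1) (by
        obtain ⟨y, k, k', hne, hc⟩ := h
        refine ⟨(y, k, k'), ?_⟩
        simp only [Finset.mem_filter, Finset.mem_product, Finset.mem_Icc, Finset.mem_univ]
        exact ⟨⟨⟨hc.1, hc.2.1⟩, trivial⟩, hne, hc⟩)
  simp only [Finset.mem_filter, Finset.mem_product, Finset.mem_Icc, Finset.mem_univ] at hy hmin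
  obtain ⟨⟨m, m'⟩, hm, hmin'⟩ := Finset.exists_min_image
    ((Finset.univ : Finset (Fin l × Fin l)).filter fun q => q.1 ≠ q.2 ∧ Collides p y q.1 q.2)
    (fun q => (p q.1).left y) ⟨(k, k'), by simpa using hy.2⟩
  simp only [Finset.mem_filter, Finset.mem_univ, true_and] at hm hmin'
  obtain ⟨hmne, h1, h2, h3, h4, h5⟩ := hm
  obtain ⟨s, hs, hmin''⟩ := Finset.exists_min_image ((Finset.univ : Finset (Fin l)).filter fun s =>
    s ≠ m ∧ (p m).left y ≤ (p s).left y ∧ (y = 0 → Even ((p m).left 0 - (p s).left 0)))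
    (fun s => (p s).left y) ⟨m', by
      simp only [Finset.mem_filter, Finset.mem_univ, true_and]
      exact ⟨hmne.symm, h3, h5⟩⟩
  simp only [Finset.mem_filter, Finset.mem_univ, true_and] at hs hmin''
  refine ⟨(y, m, s), hs.1.symm, ⟨h1, h2, hs.2.1, (hmin'' m' ⟨hmne.symm, h3, h5⟩).trans h4, hs.2.2⟩,
    fun w hw a b hab hc => ?_, fun a b hab hc => hmin' (a, b) ⟨hab, hc⟩,
    fun a ha h6 h7 => hmin'' a ⟨ha, h6, h7⟩⟩
  have := hmin (w, a, b) ⟨⟨⟨hc.1, hc.2.1⟩, trivial⟩, hab, hc⟩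
  simp only at this hw
  omega

theorem left_injective {p : Fin l → Path n} (hs : Function.Injective fun k => (p k).left (-n))
    (hy : -(n : ℤ) ≤ y) (hy' : y ≤ n + 1) (h : ∀ w < y, ∀ m m', m ≠ m' → ¬ Collides p w m m') :
    Function.Injective fun k => (p k).left y := by
  rcases hy.eq_or_lt with rfl | hlt
  · exact hs
  · have key : ∀ k k', k ≠ k' → (p k).left y = (p k').left y →
        ¬ (p k).left (y - 1) ≤ (p k').left (y - 1) := by
      intro k k' hne he hle
      have h1 := (p k').mono (show y - 1 ≤ y by omega)
      refine h (y - 1) (by omega) k k' hne ⟨by omega, by omega, hle, ?_, fun h0 => ?_⟩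
      · rw [sub_add_cancel, he]
        exact h1
      · obtain rfl : y = 1 := by omega
        have e1 := (p k).even_zero
        have e2 := (p k').even_zero
        rw [Int.even_iff] at *
        omega
    intro k k' he
    by_contra hne
    rcases le_total ((p k).left (y - 1)) ((p k').left (y - 1)) with h1 | h1
    · exact key k k' hne he h1
    · exact key k' k (Ne.symm hne) he.symm h1

theorem FirstCollision.unique {p : Fin l → Path n}
    (hs : Function.Injective fun k => (p k).left (-n)) {q q' : ℤ × Fin l × Fin l}
    (h : FirstCollision p q.1 q.2.1 q.2.2) (h' : FirstCollision p q'.1 q'.2.1 q'.2.2) : q = q' := by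
  obtain ⟨y, k, k'⟩ := q
  obtain ⟨w, m, m'⟩ := q'
  simp only at h h'
  have e1 : y = w := by
    rcases lt_trichotomy y w with h1 | h1 | h1
    · exact absurd h.coll (h'.first y h1 k k' h.ne)
    · exact h1
    · exact absurd h'.coll (h.first w h1 m m' h'.ne)
  subst e1
  have inj := left_injective hs h.coll.1 (by have := h.coll.2.1; omega) h.first
  have e2 : k = m := inj (le_antisymm (h.left_min m m' h'.ne h'.coll)
    (h'.left_min k k' h.ne h.coll))
  subst e2
  have e3 : k' = m' := inj (le_antisymm
    (h.right_min m' h'.ne.symm h'.coll.2.2.1 h'.coll.2.2.2.2)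
    (h'.right_min k' h.ne.symm h.coll.2.2.1 h.coll.2.2.2.2))
  rw [e3]

theorem FirstCollision.swapTails (h : FirstCollision t.2 y k k') :
    FirstCollision (swapTails t y k k').2 y k k' := by
  have hl := swapTails_left h.coll
  have low : ∀ m w, w ≤ y → ((TypeC.swapTails t y k k').2 m).left w = (t.2 m).left w :=
    fun m w hw => by rw [hl, if_pos hw]
  have high : ∀ m, ((TypeC.swapTails t y k k').2 m).left (y + 1) =
      (t.2 (Equiv.swap k k' m)).left (y + 1) := fun m => by rw [hl, if_neg (by omega)]
  have low0 : y = 0 → ∀ m, ((TypeC.swapTails t y k k').2 m).left 0 = (t.2 m).left 0 :=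
    fun h0 m => low m 0 h0.ge
  obtain ⟨hne, ⟨h1, h2, h3, h4, h5⟩, h6, h7, h8⟩ := h
  refine ⟨hne, ⟨h1, h2, ?_, ?_, fun h0 => ?_⟩, fun w hw m m' hm hc => ?_, fun m m' hm hc => ?_,
    fun m hm ha hb => ?_⟩
  · rwa [low _ _ le_rfl, low _ _ le_rfl]
  · rw [low _ _ le_rfl, high, Equiv.swap_apply_left]
    exact (t.2 k').mono (by omega)
  · rw [low0 h0, low0 h0]
    exact h5 h0
  · refine h6 w hw m m' hm ?_
    obtain ⟨c1, c2, c3, c4, c5⟩ := hc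
    rw [low _ _ hw.le, low _ _ hw.le] at c3
    rw [low _ _ hw.le, low _ _ (by omega)] at c4
    refine ⟨c1, c2, c3, c4, fun h0 => ?_⟩
    have := c5 h0
    rwa [low _ _ (by omega), low _ _ (by omega)] at this
  · rw [low _ _ le_rfl, low _ _ le_rfl]
    by_contra! hlt
    refine absurd (h7 m m' hm ?_) (by omega)
    obtain ⟨c1, c2, c3, c4, c5⟩ := hc
    rw [low _ _ le_rfl, low _ _ le_rfl] at c3
    rw [low _ _ le_rfl, high, Equiv.swap_apply_of_ne_of_ne] at c4
    · refine ⟨c1, c2, c3, c4, fun h0 => ?_⟩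
      have := c5 h0
      rwa [low0 h0, low0 h0] at this
    · rintro rfl
      omega
    · rintro rfl
      omega
  · rw [low _ _ le_rfl, low _ _ le_rfl] at ha ⊢
    refine h8 m hm ha fun h0 => ?_
    have := hb h0
    rwa [low0 h0, low0 h0] at this

theorem swapTails_swapTails (h : Collides t.2 y k k')
    (h' : Collides (swapTails t y k k').2 y k k') : swapTails (swapTails t y k k') y k k' = t := by
  refine Prod.ext ?_ ?_
  · change t.1 * Equiv.swap k k' * Equiv.swap k k' = t.1
    rw [mul_assoc, Equiv.swap_mul_self, mul_one]
  · funext m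
    ext w
    rw [swapTails_left h']
    split_ifs with hw
    · rw [swapTails_left h, if_pos hw]
    · rw [swapTails_left h, if_neg hw, Equiv.swap_apply_self]

theorem tupleWeight_swapTails (h : Collides t.2 y k k') (a : ℂ) :
    tupleWeight (swapTails t y k k') a = tupleWeight t a := by
  rw [tupleWeight_eq_tupleVal, tupleWeight_eq_tupleVal]
  congr 1
  refine tupleVal_congr _ fun w => ?_
  by_cases hw : w ≤ y
  · exact ⟨1, fun m => by rw [swapTails_left h, if_pos hw]; rfl⟩
  · exact ⟨Equiv.swap k k', fun m => by rw [swapTails_left h, if_neg hw]⟩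

end FirstInvolution

section

variable {n : ℕ} {lam mu : YoungDiagram}

theorem swapTails_mem {t : Equiv.Perm (Fin (len lam)) × (Fin (len lam) → Path n)}
    (ht : t ∈ pathTuples n lam mu) {y : ℤ} {k k' : Fin (len lam)} (h : Collides t.2 y k k') :
    swapTails t y k k' ∈ pathTuples n lam mu := by
  rw [mem_pathTuples] at ht ⊢
  intro i
  have h1 := h.1
  have h2 := h.2.1
  rw [swapTails_left h, swapTails_left h, if_pos h1, if_neg (by omega)]
  exact ⟨(ht i).1, (ht _).2⟩

theorem rowLen_sub_strictAnti (mu : YoungDiagram) {i j : ℕ} (h : i < j) :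
    (mu.rowLen j : ℤ) - j < (mu.rowLen i : ℤ) - i := by
  have := mu.rowLen_anti i j h.le
  omega

theorem left_neg_injective {t : Equiv.Perm (Fin (len lam)) × (Fin (len lam) → Path n)}
    (ht : t ∈ pathTuples n lam mu) : Function.Injective fun k => (t.2 k).left (-n) := by
  rw [mem_pathTuples] at ht
  intro i j hij
  simp only [(ht _).1] at hij
  rcases lt_trichotomy (i : ℕ) j with h | h | h
  · have := rowLen_sub_strictAnti mu h
    omega
  · exact Fin.ext h
  · have := rowLen_sub_strictAnti mu h
    omega

theorem mem_P1_iff (hn : 1 ≤ n) {t : Equiv.Perm (Fin (len lam)) × (Fin (len lam) → Path n)} :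
    t ∈ P1 n lam mu ↔ t ∈ pathTuples n lam mu ∧
      ∀ y k k', k ≠ k' → ¬ Collides t.2 y k k' := by
  refine and_congr_right fun _ => ?_
  simp only [ordinarilyIntersecting_iff hn]
  constructor
  · intro h y k k' hne hc
    exact h k k' hne ⟨y, Or.inl hc⟩
  · rintro h k k' hne ⟨y, hc | hc⟩
    · exact h y k k' hne hc
    · exact h y k' k hne.symm hc

theorem finite_P1 (n : ℕ) (lam mu : YoungDiagram) : (P1 n lam mu).Finite :=
  (finite_pathTuples n lam mu).subset fun _ h => h.1

theorem chi_eq_sum_P1 (hn : 1 ≤ n) (a : ℂ) : chi n lam mu a =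
    ∑ t ∈ (finite_P1 n lam mu).toFinset, (Equiv.Perm.sign t.1 : ℤ) * tupleWeight t a := by
  classical
  rw [chi_eq_sum]
  have hsub : (finite_P1 n lam mu).toFinset ⊆ (finite_pathTuples n lam mu).toFinset := fun t ht => by
    rw [Set.Finite.mem_toFinset] at ht ⊢
    exact ht.1
  rw [← Finset.sum_sdiff hsub, add_eq_right]
  have mem : ∀ {t}, t ∈ (finite_pathTuples n lam mu).toFinset \ (finite_P1 n lam mu).toFinset ↔
      t ∈ pathTuples n lam mu ∧
        ∃ q : ℤ × Fin (len lam) × Fin (len lam), FirstCollision t.2 q.1 q.2.1 q.2.2 := fun {t} => by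
    rw [Finset.mem_sdiff, Set.Finite.mem_toFinset, Set.Finite.mem_toFinset, mem_P1_iff hn]
    refine and_congr_right fun ht => ?_
    constructor
    · intro h
      refine exists_firstCollision ?_
      by_contra! hc
      exact h ⟨ht, hc⟩
    · rintro ⟨q, hq⟩ h
      exact h.2 _ _ _ hq.ne hq.coll
  have spec := fun t ht => (mem (t := t).1 ht).2.choose_spec
  set c := fun t ht => (mem (t := t).1 ht).2.choose with hcdef
  have mem' : ∀ t ht, swapTails t (c t ht).1 (c t ht).2.1 (c t ht).2.2 ∈
      (finite_pathTuples n lam mu).toFinset \ (finite_P1 n lam mu).toFinset := fun t ht =>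
    mem.2 ⟨swapTails_mem (mem.1 ht).1 (spec t ht).coll, _, (spec t ht).swapTails⟩
  refine Finset.sum_involution
    (fun t ht => swapTails t (c t ht).1 (c t ht).2.1 (c t ht).2.2) ?_ ?_ mem' ?_
  · intro t ht
    rw [tupleWeight_swapTails (spec t ht).coll]
    have hs : Equiv.Perm.sign (swapTails t (c t ht).1 (c t ht).2.1 (c t ht).2.2).1 =
        -Equiv.Perm.sign t.1 := by
      change Equiv.Perm.sign (t.1 * Equiv.swap _ _) = _
      rw [Equiv.Perm.sign_mul, Equiv.Perm.sign_swap (spec t ht).ne]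
      simp
    have key : ∀ {R : Type} [CommRing R] (s w : R), s * w + -s * w = 0 := fun s w => by ring
    rw [hs, Units.val_neg, Int.cast_neg]
    exact key _ _
  · intro t ht _ h
    have := congrArg (fun s => Equiv.Perm.sign s.1) h
    change Equiv.Perm.sign (t.1 * Equiv.swap _ _) = Equiv.Perm.sign t.1 at this
    rw [Equiv.Perm.sign_mul, Equiv.Perm.sign_swap (spec t ht).ne] at this
    simp at this
  · intro t ht
    have h1 := (spec t ht).swapTails
    have h2 : c _ (mem' t ht) = c t ht :=
      FirstCollision.unique (left_neg_injective (mem.1 (mem' t ht)).1) (spec _ (mem' t ht)) h1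
    rw [h2]
    exact swapTails_swapTails (spec t ht).coll h1.coll

end

/-! ## Tuples of paths and their lower and upper halves -/

theorem LowerUpper.A_eq {l : ℕ} (D : LowerUpper l) {r i : ℕ} (j : Fin l) (h : i = j + 1 + r) :
    D.A r i = D.alpha j r - 1 - r := by
  rw [h, D.A_alpha]

theorem LowerUpper.B_eq {l : ℕ} (D : LowerUpper l) {r i : ℕ} (h : i < l) :
    D.B r i = D.beta ⟨i, h⟩ r :=
  D.B_beta ⟨i, h⟩ r

namespace Interlaced

variable {n l : ℕ} {D : LowerUpper l}

theorem of_alpha_beta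
    (h1 : ∀ r < n, ∀ j k : Fin l, j < k → D.alpha k r < D.alpha j (r + 1))
    (h2 : ∀ r < n, ∀ j : Fin l, D.alpha j (r + 1) ≤ D.alpha j r)
    (h3 : ∀ r < n, ∀ j : Fin l, D.beta j r ≤ D.beta j (r + 1))
    (h4 : ∀ r < n, ∀ j k : Fin l, j < k → D.beta k (r + 1) < D.beta j r) : Interlaced n D where
  A_le r i hr hi hil := by
    rw [D.A_eq ⟨i - r - 1, by omega⟩ (by simp only; omega),
      D.A_eq ⟨i - r - 2, by omega⟩ (by simp only; omega)]
    have := h1 r hr ⟨i - r - 2, by omega⟩ ⟨i - r - 1, by omega⟩ (Fin.mk_lt_mk.2 (by omega))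
    push_cast
    omega
  A_lt r i hr hi hil := by
    rw [D.A_eq ⟨i - r - 1, by omega⟩ (by simp only; omega),
      D.A_eq ⟨i - r - 1, by omega⟩ (by simp only; omega)]
    have := h2 r hr ⟨i - r - 1, by omega⟩
    push_cast
    omega
  B_le r i hr hi := by
    rw [D.B_eq hi, D.B_eq hi]
    exact h3 r hr _
  B_lt r i hr hi := by
    rw [D.B_eq hi, D.B_eq (by omega)]
    exact h4 r hr _ _ (Fin.mk_lt_mk.2 (by omega))

variable (h : Interlaced n D)

include h

theorem alpha_succ_le {r : ℕ} (hr : r < n) (j : Fin l) : D.alpha j (r + 1) ≤ D.alpha j r := by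
  have := h.A_lt r (j + 1 + r) hr (by omega) (by omega)
  rw [D.A_eq j rfl, D.A_eq j (by omega)] at this
  push_cast at this
  omega

theorem beta_le_succ {r : ℕ} (hr : r < n) (j : Fin l) : D.beta j r ≤ D.beta j (r + 1) := by
  have := h.B_le r j hr j.2
  rwa [D.B_beta, D.B_beta] at this

theorem alpha_lt (hn : 1 ≤ n) {r : ℕ} (hr : r < n) {j k : Fin l} (hjk : j < k) :
    D.alpha k r < D.alpha j (r + 1) := by
  have h1 := h.A_le r (j + 1 + (r + 1)) hr (by omega) (by omega)
  rw [D.A_eq j rfl] at h1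
  have h2 : D.A r (k + 1 + r) ≤ D.A r (j + 1 + (r + 1)) := by
    have : (j : ℕ) < k := hjk
    rcases Nat.eq_or_lt_of_le (show (j : ℕ) + 1 + (r + 1) ≤ k + 1 + r by omega) with e | e
    · rw [e]
    · exact (h.A_anti hn hr.le (by omega) e (by omega)).le
  rw [D.A_eq k rfl] at h2
  push_cast at h1
  omega

theorem beta_lt (hn : 1 ≤ n) {r : ℕ} (hr : r < n) {j k : Fin l} (hjk : j < k) :
    D.beta k (r + 1) < D.beta j r := by
  have hjk' : (j : ℕ) < k := hjk
  have h1 := h.B_lt r j hr (by omega)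
  rw [D.B_beta] at h1
  have h2 : D.B (r + 1) k ≤ D.B (r + 1) (j + 1) := by
    rcases Nat.eq_or_lt_of_le (show (j : ℕ) + 1 ≤ k by omega) with e | e
    · rw [e]
    · exact (h.B_anti hn hr e k.2).le
  rw [D.B_beta] at h2
  omega

end Interlaced

/-- The pairs `(α; β)` which come from tuples without ordinary intersections. -/
structure IsHalves (n : ℕ) (lam mu : YoungDiagram) (D : LowerUpper (len lam)) : Prop where
  interlaced : Interlaced n D
  separated : OddSeparated (len lam) (D.A 0) (D.B 0)
  alpha_top : ∀ j r, n ≤ r → D.alpha j r = (mu.rowLen j : ℤ) - j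
  beta_top : ∀ j r, n ≤ r → D.beta j r = (lam.rowLen j : ℤ) - j

section

variable {n : ℕ} {lam mu : YoungDiagram} {t : Equiv.Perm (Fin (len lam)) × (Fin (len lam) → Path n)}

theorem matched_lowerUpper (hn : 1 ≤ n) (ht : t ∈ P1 n lam mu) :
    Matched ((lowerUpper t).A 0) ((lowerUpper t).B 0) t.1 := by
  rw [mem_P1_iff hn] at ht
  have hA : ∀ k : Fin (len lam), (lowerUpper t).A 0 (k + 1) = (t.2 k).left 0 - 1 := fun k => by
    rw [LowerUpper.A_eq _ k rfl]
    simp [lowerUpper]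
  have hB : ∀ k : Fin (len lam), (lowerUpper t).B 0 (t.1 k) = (t.2 k).left 1 := fun k => by
    rw [LowerUpper.B_beta]
    simp [lowerUpper, Path.right]
  refine ⟨fun k => ?_, fun k => ?_, fun k k' hne he hle => ?_⟩
  · rw [hA, hB, sub_add_cancel]
    exact (t.2 k).mono (by omega)
  · rw [hA, hB, sub_add_cancel]
    exact (t.2 k).even_zero
  · rw [hA, hA] at he hle
    rw [hA, hB, sub_add_cancel]
    by_contra! hc
    exact ht.2 0 k k' hne ⟨by omega, by omega, by omega, by simpa using hc, fun _ => by
      rwa [sub_sub_sub_cancel_right] at he⟩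

theorem left_lt_left (hn : 1 ≤ n) (ht : t ∈ P1 n lam mu) {k k' : Fin (len lam)} (hk : k < k')
    {y : ℤ} (hy : -(n : ℤ) ≤ y) (hy' : y ≤ 0) : (t.2 k').left y < (t.2 k).left y := by
  rw [mem_P1_iff hn] at ht
  induction y, hy using Int.leInduction with
  | base =>
    have := mem_pathTuples.1 ht.1
    rw [(this k).1, (this k').1]
    exact rowLen_sub_strictAnti mu hk
  | succ y hy ih =>
    have h1 := ih (by omega)
    by_contra! hc
    have h2 := (t.2 k).mono (show y ≤ y + 1 by omega)
    exact ht.2 y k' k hk.ne' ⟨hy, by omega, h1.le, by omega, fun h0 => by omega⟩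

theorem left_succ_lt_left (hn : 1 ≤ n) (ht : t ∈ P1 n lam mu) {k k' : Fin (len lam)} (hk : k < k')
    {y : ℤ} (hy : -(n : ℤ) ≤ y) (hy' : y < 0) : (t.2 k').left (y + 1) < (t.2 k).left y := by
  have h1 := left_lt_left hn ht hk hy hy'.le
  rw [mem_P1_iff hn] at ht
  by_contra! hc
  exact ht.2 y k' k hk.ne' ⟨hy, by omega, h1.le, hc, fun h0 => by omega⟩

theorem left_succ_lt_left_of_lt (hn : 1 ≤ n) (ht : t ∈ P1 n lam mu) {j j' : Fin (len lam)}
    (hj : j < j') {y : ℤ} (hy : 1 ≤ y) (hy' : y ≤ n)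
    (h : (t.2 (t.1.symm j')).left (y + 1) < (t.2 (t.1.symm j)).left (y + 1)) :
    (t.2 (t.1.symm j')).left (y + 1) < (t.2 (t.1.symm j)).left y := by
  rw [mem_P1_iff hn] at ht
  have hne : t.1.symm j ≠ t.1.symm j' := fun e => hj.ne (t.1.symm.injective e)
  by_contra! hc
  rcases le_total ((t.2 (t.1.symm j')).left y) ((t.2 (t.1.symm j)).left y) with h1 | h1
  · exact ht.2 y _ _ hne.symm ⟨by omega, hy', h1, hc, fun h0 => by omega⟩
  · refine ht.2 y _ _ hne ⟨by omega, hy', h1, ?_, fun h0 => by omega⟩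
    have := (t.2 (t.1.symm j')).mono (show y ≤ y + 1 by omega)
    omega

theorem left_lt_left_target (hn : 1 ≤ n) (ht : t ∈ P1 n lam mu) {j j' : Fin (len lam)}
    (hj : j < j') {y : ℤ} (hy : 1 ≤ y) (hy' : y ≤ n + 1) :
    (t.2 (t.1.symm j')).left y < (t.2 (t.1.symm j)).left y := by
  induction y, hy' using Int.leInductionDown with
  | base =>
    have := mem_pathTuples.1 ht.1
    rw [(this _).2, (this _).2, Equiv.apply_symm_apply, Equiv.apply_symm_apply]
    exact rowLen_sub_strictAnti lam hj
  | pred y hy' ih =>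
    have h1 := left_succ_lt_left_of_lt hn ht hj hy (by omega)
      (by rw [sub_add_cancel]; exact ih (by omega))
    exact ((t.2 (t.1.symm j')).mono (by omega)).trans_lt h1

theorem isHalves_lowerUpper (hn : 1 ≤ n) (ht : t ∈ P1 n lam mu) :
    IsHalves n lam mu (lowerUpper t) := by
  have hi : Interlaced n (lowerUpper t) := by
    refine Interlaced.of_alpha_beta (fun r hr j k hjk => ?_) (fun r hr j => ?_)
      (fun r hr j => ?_) fun r hr j k hjk => ?_
    · have := left_succ_lt_left hn ht hjk (y := -((r + 1 : ℕ) : ℤ)) (by omega) (by omega)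
      simp only [lowerUpper]
      convert this using 2
      push_cast
      ring
    · exact (t.2 j).mono (by push_cast; omega)
    · exact (t.2 (t.1.symm j)).mono (by push_cast; omega)
    · have h1 := left_lt_left_target hn ht hjk (y := (r : ℤ) + 1 + 1) (by omega) (by omega)
      have := left_succ_lt_left_of_lt hn ht hjk (by omega) (by omega) h1
      simpa [lowerUpper, Path.right] using this
  refine ⟨hi, ?_, fun j r hr => ?_, fun j r hr => ?_⟩
  · exact (matched_lowerUpper hn ht).oddSeparated
      (fun i j h1 h2 h3 => hi.A_anti hn (by omega) (by omega) h2 (by omega))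
      (fun i j h1 h2 => hi.B_anti hn (by omega) h1 h2)
  · simp only [lowerUpper]
    rw [(t.2 j).left_of_le _ (by omega)]
    exact (mem_pathTuples.1 ht.1 j).1
  · simp only [lowerUpper, Path.right]
    rw [(t.2 _).left_of_ge _ (by omega), (mem_pathTuples.1 ht.1 _).2, Equiv.apply_symm_apply]

theorem lowerUpper_injOn (hn : 1 ≤ n) : Set.InjOn (lowerUpper (n := n)) (P1 n lam mu) := by
  intro t ht t' ht' h
  have h1 := matched_lowerUpper hn ht
  have h2 := matched_lowerUpper hn ht'
  rw [← h] at h2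
  have hs := h1.unique h2
  refine Prod.ext hs ?_
  funext k
  ext y
  rcases le_or_gt y 0 with hy | hy
  · have : (lowerUpper t).alpha k (-y).toNat = (lowerUpper t').alpha k (-y).toNat := by rw [h]
    simp only [lowerUpper] at this
    rwa [Int.toNat_of_nonneg (by omega), neg_neg] at this
  · have : (lowerUpper t).beta (t.1 k) (y - 1).toNat =
      (lowerUpper t').beta (t.1 k) (y - 1).toNat := by rw [h]
    simp only [lowerUpper, Path.right] at this
    rwa [Int.toNat_of_nonneg (by omega), sub_add_cancel, Equiv.symm_apply_apply, hs,
      Equiv.symm_apply_apply] at this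

end

namespace IsHalves

variable {n : ℕ} {lam mu : YoungDiagram} {D : LowerUpper (len lam)}

theorem alpha_antitone (h : IsHalves n lam mu D) (j : Fin (len lam)) : Antitone (D.alpha j) :=
  antitone_nat_of_succ_le fun r => by
    rcases lt_or_ge r n with hr | hr
    · exact h.interlaced.alpha_succ_le hr j
    · rw [h.alpha_top j r hr, h.alpha_top j (r + 1) (by omega)]

theorem beta_monotone (h : IsHalves n lam mu D) (j : Fin (len lam)) : Monotone (D.beta j) :=
  monotone_nat_of_le_succ fun r => by
    rcases lt_or_ge r n with hr | hr
    · exact h.interlaced.beta_le_succ hr j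
    · rw [h.beta_top j r hr, h.beta_top j (r + 1) (by omega)]

/-- The path with given lower and upper halves. -/
def path (h : IsHalves n lam mu D) (k j : Fin (len lam)) (hle : D.alpha k 0 ≤ D.beta j 0)
    (he : Even (D.beta j 0 - D.alpha k 0)) : Path n where
  left y := if y ≤ 0 then D.alpha k (-y).toNat else D.beta j (y - 1).toNat
  mono y y' hy := by
    dsimp only
    split_ifs with h1 h2
    · exact h.alpha_antitone k (by omega)
    · exact (h.alpha_antitone k (Nat.zero_le _)).trans (hle.trans (h.beta_monotone j (Nat.zero_le _)))
    · omega
    · exact h.beta_monotone j (by omega)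
  left_of_le y hy := by
    rw [if_pos (by omega), if_pos (by omega), h.alpha_top _ _ (by omega), h.alpha_top _ _ (by omega)]
  left_of_ge y hy := by
    rw [if_neg (by omega), if_neg (by omega), h.beta_top _ _ (by omega), h.beta_top _ _ (by omega)]
  even_zero := by simpa using he

theorem exists_mem_P1 (h : IsHalves n lam mu D) (hn : 1 ≤ n) :
    ∃ t ∈ P1 n lam mu, lowerUpper t = D := by
  have hm := h.separated.matched_hopPerm
  set σ := hopPerm (len lam) (fun k => OverlapAt (len lam) (D.A 0) (D.B 0) (k + 1)) (len lam - 1)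
  have hA : ∀ k : Fin (len lam), D.A 0 (k + 1) = D.alpha k 0 - 1 := fun k => by
    rw [LowerUpper.A_eq _ k rfl]
    simp
  have hle : ∀ k, D.alpha k 0 ≤ D.beta (σ k) 0 := fun k => by
    have := hm.le k
    rwa [hA, D.B_beta, sub_add_cancel] at this
  have he : ∀ k, Even (D.beta (σ k) 0 - D.alpha k 0) := fun k => by
    have := hm.even k
    rwa [hA, D.B_beta, sub_add_cancel] at this
  refine ⟨(σ, fun k => h.path k (σ k) (hle k) (he k)), ?_, ?_⟩
  · rw [mem_P1_iff hn, mem_pathTuples]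
    refine ⟨fun k => ⟨?_, ?_⟩, ?_⟩
    · simp only [path]
      rw [if_pos (by omega), h.alpha_top _ _ (by omega)]
    · simp only [path]
      rw [if_neg (by omega), h.beta_top _ _ (by omega)]
    · rintro y k k' hne ⟨h1, h2, h3, h4, h5⟩
      simp only [path] at h3 h4 h5
      rcases lt_trichotomy y 0 with hy | rfl | hy
      · obtain ⟨r, rfl⟩ : ∃ r : ℕ, y = -r - 1 := ⟨(-y - 1).toNat, by omega⟩
        rw [if_pos (by omega), if_pos (by omega)] at h3 h4
        have e1 : (-(-(r : ℤ) - 1)).toNat = r + 1 := by omega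
        have e2 : (-(-(r : ℤ) - 1 + 1)).toNat = r := by omega
        rw [e1] at h3 h4
        rw [e2] at h4
        rcases lt_or_gt_of_ne hne with hlt | hlt
        · have := h.interlaced.alpha_lt hn (show r < n by omega) hlt
          have := h.interlaced.alpha_succ_le (show r < n by omega) k'
          omega
        · have := h.interlaced.alpha_lt hn (show r < n by omega) hlt
          omega
      · have := hm.disj k k' hne
        rw [hA, hA, D.B_beta] at this
        simp only [le_refl, if_true, neg_zero, Int.toNat_zero, zero_add] at h3 h4 h5
        rw [if_neg (by omega)] at h4
        simp only [sub_self, Int.toNat_zero] at h4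
        have := this (by rw [sub_sub_sub_cancel_right]; exact h5 trivial) (by omega)
        omega
      · obtain ⟨r, rfl⟩ : ∃ r : ℕ, y = r + 1 := ⟨(y - 1).toNat, by omega⟩
        rw [if_neg (by omega), if_neg (by omega)] at h3 h4
        have e1 : ((r : ℤ) + 1 - 1).toNat = r := by omega
        have e2 : ((r : ℤ) + 1 + 1 - 1).toNat = r + 1 := by omega
        rw [e1] at h3 h4
        rw [e2] at h4
        have hne' : σ k ≠ σ k' := fun e => hne (σ.injective e)
        rcases lt_or_gt_of_ne hne' with hlt | hlt
        · have := h.interlaced.beta_lt hn (show r < n by omega) hlt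
          have := h.interlaced.beta_le_succ (show r < n by omega) (σ k')
          omega
        · have := h.interlaced.beta_lt hn (show r < n by omega) hlt
          omega
  · have e1 : ∀ k (r : ℕ), (if -(r : ℤ) ≤ 0 then D.alpha k (-(-(r : ℤ))).toNat else
        D.beta (σ k) (-(r : ℤ) - 1).toNat) = D.alpha k r := fun k r => by
      rw [if_pos (by omega)]
      simp
    have e2 : ∀ k (r : ℕ), (if (r : ℤ) + 1 ≤ 0 then D.alpha (σ.symm k) (-((r : ℤ) + 1)).toNat else
        D.beta (σ (σ.symm k)) ((r : ℤ) + 1 - 1).toNat) = D.beta k r := fun k r => by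
      rw [if_neg (by omega)]
      simp
    refine LowerUpper.ext_AB (fun r i => ?_) fun r i => ?_
    · simp only [LowerUpper.A, lowerUpper, path, e1]
    · simp only [LowerUpper.B, lowerUpper, path, Path.right, e2]

theorem noTopOverlap (h : IsHalves n lam mu D) (hpos : depth lam mu ≤ n + 1) :
    NoTopOverlap n D := by
  intro i hi hil
  rw [D.A_eq ⟨i - n - 1, by omega⟩ (by simp only; omega), D.B_eq hil, h.alpha_top _ _ le_rfl,
    h.beta_top _ _ le_rfl]
  simp only
  by_contra! hc
  have hlt : mu.rowLen (i - n - 1) < lam.rowLen i := by omega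
  have h1 : i < lam.colLen (mu.rowLen (i - n - 1)) := by
    rw [← YoungDiagram.mem_iff_lt_colLen, YoungDiagram.mem_iff_lt_rowLen]
    exact hlt
  have h2 : mu.colLen (mu.rowLen (i - n - 1)) ≤ i - n - 1 := by
    by_contra! hc'
    rw [← YoungDiagram.mem_iff_lt_colLen, YoungDiagram.mem_iff_lt_rowLen] at hc'
    omega
  have h3 : lam.colLen (mu.rowLen (i - n - 1)) - mu.colLen (mu.rowLen (i - n - 1)) ≤
      depth lam mu := by
    refine Finset.le_sup (f := fun j => lam.colLen j - mu.colLen j) (Finset.mem_range.2 ?_)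
    have := lam.rowLen_anti 0 i (Nat.zero_le _)
    omega
  omega

theorem flip (h : IsHalves n lam mu D) (ht : NoTopOverlap n D) {k : Kind} {V : Set Square}
    (hV : IsRegion n D k V) : IsHalves n lam mu (D.flip (RowIn D k V)) := by
  classical
  have hA := LowerUpper.A_flip (D := D) (S := RowIn D k V) (fun _ _ h => IsRegion.rowIn_interior h)
  have hB := LowerUpper.B_flip (D := D) (S := RowIn D k V) (fun _ _ h => IsRegion.rowIn_interior h)
  refine ⟨hV.interlaced_flip ht h.interlaced, h.separated.of_swap ?_ ?_ fun i h1 h2 => ?_,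
    fun j r hr => ?_, fun j r hr => ?_⟩
  · rw [hB, if_neg fun hc => absurd hc.1 (lt_irrefl 0)]
  · rw [hA, if_neg fun hc => absurd hc.2.1 (lt_irrefl _)]
  · rw [hA, hB]
    split_ifs <;> simp
  · rw [← h.alpha_top j r hr]
    have := hA r (j + 1 + r)
    rw [if_neg fun hc => absurd (hV.row_lt ht hc) (by omega), LowerUpper.A_eq _ j rfl,
      LowerUpper.A_eq _ j rfl] at this
    omega
  · rw [← h.beta_top j r hr]
    have := hB r j
    rwa [if_neg fun hc => absurd (hV.row_lt ht hc) (by omega), LowerUpper.B_beta,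
      LowerUpper.B_beta] at this

end IsHalves

/-! ## The weight in terms of the lower and upper halves -/

section HalvesVal

theorem add_exchange {A : Type*} [AddCommGroup A] (z b a b₁ b' a₁ a' : A) :
    b₁ + -b' + (a' + -a₁ + (b + -a + z)) = b₁ + -a₁ + (z + ((b + -b') + (a' + -a))) := by
  abel

theorem mul_exchange {G : Type*} [CommGroup G] (z b a b₁ b' a₁ a' : G) :
    b₁ * b'⁻¹ * (a' * a₁⁻¹ * (b * a⁻¹ * z)) = b₁ * a₁⁻¹ * (z * ((b * b'⁻¹) * (a' * a⁻¹))) :=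
  add_exchange (A := Additive G) z b a b₁ b' a₁ a'

variable {G : Type*} [CommGroup G] {l : ℕ}

/-- The contribution of the positions of rank `r`. -/
def rankVal (V : ℤ → ℤ → G) (D : LowerUpper l) (r : ℕ) : G :=
  (∏ j, (V r (D.beta j r) * (V (r + 1) (D.beta j r))⁻¹)) *
    ∏ j, (V (-r - 1) (D.alpha j r) * (V (-r) (D.alpha j r))⁻¹)

theorem tupleVal_eq_rankVal (V : ℤ → ℤ → G) {x : ℤ → Fin l → ℤ} {D : LowerUpper l}
    {σ : Equiv.Perm (Fin l)} (ha : ∀ (r : ℕ) k, x (-r) k = D.alpha k r)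
    (hb : ∀ (r : ℕ) k, x (r + 1) k = D.beta (σ k) r) (m : ℕ) :
    tupleVal m V x = (∏ j, V m (D.beta j m)) * (∏ j, V (-m) (D.alpha j m))⁻¹ *
      ∏ r ∈ Finset.range m, rankVal V D r := by
  have sb : ∀ (y : ℤ) (r : ℕ), ∏ k, V y (x (r + 1) k) = ∏ j, V y (D.beta j r) := fun y r => by
    simp only [hb]
    exact Equiv.prod_comp σ fun j => V y (D.beta j r)
  have sa : ∀ (y : ℤ) (r : ℕ), ∏ k, V y (x (-r) k) = ∏ j, V y (D.alpha j r) := fun y r => by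
    simp only [ha]
  induction m with
  | zero =>
    have h1 := sb 0 0
    have h2 := sa 0 0
    simp only [Nat.cast_zero, neg_zero, zero_add] at h1 h2
    simp [tupleVal, Finset.prod_mul_distrib, h1, h2]
  | succ m ih =>
    have hI : Finset.Icc (-((m + 1 : ℕ) : ℤ)) (m + 1 : ℕ) =
        insert ((m : ℤ) + 1) (insert (-(m : ℤ) - 1) (Finset.Icc (-(m : ℤ)) m)) := by
      ext y
      simp only [Finset.mem_Icc, Finset.mem_insert]
      push_cast
      omega
    have h1 := sb (m + 1) (m + 1)
    have h2 := sb (m + 1) m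
    have h3 := sa (-m - 1) m
    have h4 := sa (-m - 1) (m + 1)
    have e : (-((m + 1 : ℕ) : ℤ)) = -m - 1 := by push_cast; ring
    rw [e] at h4
    rw [Nat.cast_add_one] at h1
    rw [tupleVal, hI, Finset.prod_insert, Finset.prod_insert, ← tupleVal, ih,
      Finset.prod_range_succ, rankVal]
    · simp only [Finset.prod_mul_distrib, Finset.prod_inv_distrib]
      rw [e, Nat.cast_add_one, sub_add_cancel, h1, h2, h3, h4]
      exact mul_exchange _ _ _ _ _ _ _
    · simp only [Finset.mem_Icc]
      omega
    · simp only [Finset.mem_Icc, Finset.mem_insert]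
      omega

theorem rankVal_eq (V : ℤ → ℤ → G) (D : LowerUpper l) (r : ℕ) {c : G}
    (hc : ∀ x : ℤ, V (-r - 1) x * (V (-r) x)⁻¹ =
      c * (V r (x - 1 - r) * (V (r + 1) (x - 1 - r))⁻¹)) :
    rankVal V D r = c ^ l * ∏ i ∈ Finset.range (r + 1 + l),
      ((if i < l then V r (D.B r i) * (V (r + 1) (D.B r i))⁻¹ else 1) *
        if r < i then V r (D.A r i) * (V (r + 1) (D.A r i))⁻¹ else 1) := by
  have e1 : ∏ i ∈ Finset.range (r + 1 + l),
      (if i < l then V r (D.B r i) * (V (r + 1) (D.B r i))⁻¹ else 1) =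
      ∏ j, (V r (D.beta j r) * (V (r + 1) (D.beta j r))⁻¹) := by
    rw [add_comm, Finset.prod_range_add, Finset.prod_range, Finset.prod_eq_one (s := Finset.range _),
      mul_one]
    · refine Finset.prod_congr rfl fun j _ => ?_
      rw [if_pos j.2, D.B_beta]
    · intro i _
      rw [if_neg (by omega)]
  have e2 : ∏ i ∈ Finset.range (r + 1 + l),
      (if r < i then V r (D.A r i) * (V (r + 1) (D.A r i))⁻¹ else 1) =
      ∏ j, (V r (D.alpha j r - 1 - r) * (V (r + 1) (D.alpha j r - 1 - r))⁻¹) := by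
    rw [Finset.prod_range_add, Finset.prod_eq_one (s := Finset.range (r + 1)), one_mul,
      Finset.prod_range]
    · refine Finset.prod_congr rfl fun j _ => ?_
      rw [if_pos (by omega), D.A_eq j (by omega)]
    · intro i hi
      rw [if_neg (by have := Finset.mem_range.1 hi; omega)]
  rw [Finset.prod_mul_distrib, e1, e2, rankVal]
  simp only [hc]
  rw [Finset.prod_mul_distrib (f := fun _ => c), Finset.prod_const, Finset.card_univ,
    Fintype.card_fin, mul_left_comm]

theorem rankVal_flip (V : ℤ → ℤ → G) (D : LowerUpper l) (r : ℕ) {c : G}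
    (hc : ∀ x : ℤ, V (-r - 1) x * (V (-r) x)⁻¹ =
      c * (V r (x - 1 - r) * (V (r + 1) (x - 1 - r))⁻¹))
    {S : ℕ → ℕ → Prop} (hS : ∀ r i, S r i → r < i ∧ i < l) :
    rankVal V (D.flip S) r = rankVal V D r := by
  classical
  rw [rankVal_eq V _ r hc, rankVal_eq V _ r hc]
  congr 1
  refine Finset.prod_congr rfl fun i _ => ?_
  rw [LowerUpper.A_flip hS, LowerUpper.B_flip hS]
  by_cases h : S r i
  · have := hS r i h
    simp only [h, this, if_true]
    exact mul_comm _ _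
  · simp only [h, if_false]

end HalvesVal

section

variable {n : ℕ} {lam mu : YoungDiagram} {t t' : Equiv.Perm (Fin (len lam)) × (Fin (len lam) → Path n)}

theorem tupleVal_of_mem {G : Type*} [CommGroup G] (V : ℤ → ℤ → G) :
    tupleVal n V (fun y k => (t.2 k).left y) =
      (∏ j, V n ((lowerUpper t).beta j n)) * (∏ j, V (-n) ((lowerUpper t).alpha j n))⁻¹ *
      ∏ r ∈ Finset.range n, rankVal V (lowerUpper t) r :=
  tupleVal_eq_rankVal V (σ := t.1) (fun r k => rfl) (fun r k => by simp [lowerUpper, Path.right]) n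

theorem tupleWeight_flip (hn : 1 ≤ n) (ht : t ∈ P1 n lam mu) (ht' : t' ∈ P1 n lam mu)
    {S : ℕ → ℕ → Prop} (hS : ∀ r i, S r i → r < i ∧ i < len lam)
    (h : lowerUpper t' = (lowerUpper t).flip S) (a : ℂ) : tupleWeight t' a = tupleWeight t a := by
  have h1 := isHalves_lowerUpper hn ht
  have h2 := isHalves_lowerUpper hn ht'
  have key : tupleVal n (potential n a) (fun y k => (t'.2 k).left y) =
      tupleVal n (potential n a) (fun y k => (t.2 k).left y) := by
    rw [tupleVal_of_mem, tupleVal_of_mem]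
    simp only [h1.alpha_top _ _ le_rfl, h1.beta_top _ _ le_rfl, h2.alpha_top _ _ le_rfl,
      h2.beta_top _ _ le_rfl]
    congr 1
    refine Finset.prod_congr rfl fun r hr => ?_
    obtain ⟨c, hc⟩ := potential_dual a (Finset.mem_range.1 hr)
    rw [h]
    exact rankVal_flip _ _ r hc hS
  rw [tupleWeight_eq_tupleVal, tupleWeight_eq_tupleVal, key]

/-! ## The second involution -/

theorem sign_eq_overlapCount (hn : 1 ≤ n) (ht : t ∈ P1 n lam mu) :
    Equiv.Perm.sign t.1 = (-1) ^ overlapCount (lowerUpper t) := by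
  have hi := (isHalves_lowerUpper hn ht).interlaced
  exact (matched_lowerUpper hn ht).sign_eq
    (fun i j h1 h2 h3 => hi.A_anti hn (by omega) (by omega) h2 (by omega))
    (fun i j h1 h2 => hi.B_anti hn (by omega) h1 h2)

theorem even_overlapCount {l : ℕ} {D : LowerUpper l} (ht : NoTopOverlap n D)
    (hD : ∀ k V, ¬ IsOddRegion n D k V) : Even (overlapCount D) := by
  classical
  let V : ℕ → Set Square := fun i => component n D .I (upSquare 0 (D.A 0 (i + 1)))
  set E := (Finset.range (l - 1)).filter fun i => OverlapAt l (D.A 0) (D.B 0) (i + 1) with hE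
  have hocc : ∀ i ∈ E, i + 1 < l ∧ D.Occ .I 0 (i + 1) (D.A 0 (i + 1)) ∧
      Odd (D.A 0 (i + 1) - D.B 0 (i + 1)) := fun i hi => by
    obtain ⟨h1, h2, h3⟩ := (Finset.mem_filter.1 hi).2
    exact ⟨h1, ⟨by omega, h1, le_rfl, h2⟩, h3⟩
  have hreg : ∀ i ∈ E, IsRegion n D .I (V i) := fun i hi => by
    obtain ⟨h1, h2, h3⟩ := hocc i hi
    refine ⟨⟨_, ⟨i + 1, unitAt_upSquare.2 ⟨h1.le, by omega, h2⟩⟩, rfl⟩,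
      ⟨_, Relation.EqvGen.refl _, rank_upSquare _ _⟩, fun h => by cases h⟩
  have hcard : overlapCount D = E.card := by
    rw [overlapCount, hE]
  rw [hcard, Finset.card_eq_sum_card_image V E]
  refine Finset.even_sum _ fun W hW => ?_
  obtain ⟨i₀, hi₀, rfl⟩ := Finset.mem_image.1 hW
  have hr := hreg i₀ hi₀
  have heven : Even (evenCount n D .I (V i₀)) := by
    rw [← Nat.not_odd_iff_even]
    exact fun ho => hD .I _ ⟨hr, ho⟩
  rw [hr.evenCount_eq ht] at heven
  suffices hc : {i ∈ E | V i = V i₀}.card =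
      {i | RowIn D .I (V i₀) 0 i ∧ Odd (D.A 0 i - D.B 0 i)}.ncard by rwa [hc]
  rw [← Set.ncard_coe_finset]
  refine Set.ncard_congr (fun i _ => i + 1) ?_ (fun _ _ _ _ h => by omega) ?_
  · intro i hi
    simp only [Finset.coe_filter, Set.mem_ofPred_eq] at hi
    obtain ⟨h1, h2, h3⟩ := hocc i hi.1
    refine ⟨⟨by omega, h1, _, h2, ?_⟩, h3⟩
    rw [← hi.2]
    exact Relation.EqvGen.refl _
  · rintro b ⟨⟨h1, h2, x, h3, h4⟩, h5⟩
    obtain ⟨i, rfl⟩ : ∃ i, b = i + 1 := ⟨b - 1, by omega⟩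
    have h3' := h3
    obtain ⟨-, -, h6, h7⟩ := h3
    have hiE : i ∈ E := by
      rw [hE, Finset.mem_filter, Finset.mem_range]
      exact ⟨by omega, h2, by omega, h5⟩
    refine ⟨i, ?_, rfl⟩
    simp only [Finset.coe_filter, Set.mem_ofPred_eq]
    refine ⟨hiE, ?_⟩
    have := hr.row_subset ht ⟨h1, h2, x, h3', h4⟩ (hocc i hiE).2.1
    exact classIn_eq this

open Classical in
/-- A chosen element of a nonempty set of regions. -/
noncomputable def pick (R : Set (Set Square)) : Set Square := if h : R.Nonempty then h.some else ∅

theorem pick_mem {R : Set (Set Square)} (h : R.Nonempty) : pick R ∈ R := by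
  rw [pick, dif_pos h]
  exact h.some_mem

/-- `t'` arises from `t` by an exchange along the chosen odd region. -/
def IsPartner (t t' : Equiv.Perm (Fin (len lam)) × (Fin (len lam) → Path n)) : Prop :=
  ∃ k, IsOddRegion n (lowerUpper t) k (pick (oddRegions n (lowerUpper t))) ∧
    lowerUpper t' = (lowerUpper t).flip
      (RowIn (lowerUpper t) k (pick (oddRegions n (lowerUpper t))))

theorem exists_isPartner (hn : 1 ≤ n) (hpos : depth lam mu ≤ n + 1) (ht : t ∈ P1 n lam mu)
    (h : (oddRegions n (lowerUpper t)).Nonempty) : ∃ t' ∈ P1 n lam mu, IsPartner t t' := by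
  have hD := isHalves_lowerUpper hn ht
  obtain ⟨k, hk⟩ := pick_mem h
  obtain ⟨t', h1, h2⟩ := (hD.flip (hD.noTopOverlap hpos) hk.1).exists_mem_P1 hn
  exact ⟨t', h1, k, hk, h2⟩

namespace IsPartner

theorem tupleWeight_eq (h : IsPartner t t') (hn : 1 ≤ n) (ht : t ∈ P1 n lam mu)
    (ht' : t' ∈ P1 n lam mu) (a : ℂ) : tupleWeight t' a = tupleWeight t a := by
  obtain ⟨k, -, h⟩ := h
  exact tupleWeight_flip hn ht ht' (fun _ _ => IsRegion.rowIn_interior) h a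

theorem sign_eq (h : IsPartner t t') (hn : 1 ≤ n) (hpos : depth lam mu ≤ n + 1)
    (ht : t ∈ P1 n lam mu) (ht' : t' ∈ P1 n lam mu) :
    Equiv.Perm.sign t'.1 = -Equiv.Perm.sign t.1 := by
  obtain ⟨k, hk, h⟩ := h
  have hc := hk.1.overlapCount_flip ((isHalves_lowerUpper hn ht).noTopOverlap hpos)
  rw [← h] at hc
  rw [sign_eq_overlapCount hn ht, sign_eq_overlapCount hn ht']
  have ho := hk.2
  have : (-1 : ℤˣ) ^ overlapCount (lowerUpper t') =
      (-1) ^ (overlapCount (lowerUpper t) + 1) := by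
    rw [Nat.odd_iff] at ho
    rcases Nat.even_or_odd (overlapCount (lowerUpper t)) with e | e
    · rw [e.add_one.neg_one_pow, Odd.neg_one_pow]
      rw [Nat.even_iff] at e
      rw [Nat.odd_iff]
      omega
    · rw [e.add_one.neg_one_pow, Even.neg_one_pow]
      rw [Nat.odd_iff] at e
      rw [Nat.even_iff]
      omega
  rw [this, pow_succ, mul_neg_one]

theorem oddRegions_eq (h : IsPartner t t') (hn : 1 ≤ n) (hpos : depth lam mu ≤ n + 1)
    (ht : t ∈ P1 n lam mu) : oddRegions n (lowerUpper t') = oddRegions n (lowerUpper t) := by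
  have hD := isHalves_lowerUpper hn ht
  obtain ⟨k, hk, h⟩ := h
  rw [h]
  exact hk.1.oddRegions_flip (hD.noTopOverlap hpos) hD.interlaced hn

theorem eq_of_isPartner {t'' : Equiv.Perm (Fin (len lam)) × (Fin (len lam) → Path n)}
    (h : IsPartner t t') (h' : IsPartner t' t'') (hn : 1 ≤ n) (hpos : depth lam mu ≤ n + 1)
    (ht : t ∈ P1 n lam mu) (ht' : t' ∈ P1 n lam mu) (ht'' : t'' ∈ P1 n lam mu) : t'' = t := by
  refine lowerUpper_injOn hn ht'' ht ?_
  have hD := isHalves_lowerUpper hn ht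
  have htop := hD.noTopOverlap hpos
  have hD' := isHalves_lowerUpper hn ht'
  have he := h.oddRegions_eq hn hpos ht
  obtain ⟨k, hk, h⟩ := h
  obtain ⟨k', hk', h'⟩ := h'
  rw [he] at hk' h'
  have h1 := hk.1.isRegion_flip htop hD.interlaced hn
  rw [← h] at h1
  obtain rfl := h1.kind_unique hD'.interlaced hn hk'.1
  rw [h', h]
  exact hk.1.flip_flip_rowIn htop hD.interlaced hn

end IsPartner

theorem mem_P2_iff : t ∈ P2 n lam mu ↔
    t ∈ P1 n lam mu ∧ ¬ (oddRegions n (lowerUpper t)).Nonempty := by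
  refine and_congr_right fun _ => ?_
  constructor
  · rintro h ⟨V, k, hV⟩
    exact h k V hV
  · exact fun h k V hV => h ⟨V, k, hV⟩

theorem finite_P2 (n : ℕ) (lam mu : YoungDiagram) : (P2 n lam mu).Finite :=
  (finite_P1 n lam mu).subset fun _ h => h.1

theorem sum_P1_eq_sum_P2 (hn : 1 ≤ n) (hpos : depth lam mu ≤ n + 1) (a : ℂ) :
    ∑ t ∈ (finite_P1 n lam mu).toFinset, (Equiv.Perm.sign t.1 : ℤ) * tupleWeight t a =
      ∑ t ∈ (finite_P2 n lam mu).toFinset, tupleWeight t a := by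
  classical
  have hsub : (finite_P2 n lam mu).toFinset ⊆ (finite_P1 n lam mu).toFinset := fun t ht => by
    rw [Set.Finite.mem_toFinset] at ht ⊢
    exact ht.1
  have mem : ∀ {t}, t ∈ (finite_P1 n lam mu).toFinset \ (finite_P2 n lam mu).toFinset ↔
      t ∈ P1 n lam mu ∧ (oddRegions n (lowerUpper t)).Nonempty := fun {t} => by
    rw [Finset.mem_sdiff, Set.Finite.mem_toFinset, Set.Finite.mem_toFinset, mem_P2_iff]
    tauto
  rw [← Finset.sum_sdiff hsub]
  have h2 : ∑ t ∈ (finite_P2 n lam mu).toFinset, ((Equiv.Perm.sign t.1 : ℤ) : ZRing n) *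
      tupleWeight t a = ∑ t ∈ (finite_P2 n lam mu).toFinset, tupleWeight t a := by
    refine Finset.sum_congr rfl fun t ht => ?_
    rw [Set.Finite.mem_toFinset] at ht
    have he := even_overlapCount ((isHalves_lowerUpper hn ht.1).noTopOverlap hpos) ht.2
    rw [sign_eq_overlapCount hn ht.1, he.neg_one_pow]
    simp
  rw [h2, add_eq_right]
  choose! g hg1 hg2 using fun t (ht : t ∈ (finite_P1 n lam mu).toFinset \
    (finite_P2 n lam mu).toFinset) => exists_isPartner hn hpos (mem.1 ht).1 (mem.1 ht).2
  have hmem : ∀ t ∈ (finite_P1 n lam mu).toFinset \ (finite_P2 n lam mu).toFinset,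
      g t ∈ (finite_P1 n lam mu).toFinset \ (finite_P2 n lam mu).toFinset := fun t ht =>
    mem.2 ⟨hg1 t ht, by
      rw [(hg2 t ht).oddRegions_eq hn hpos (mem.1 ht).1]
      exact (mem.1 ht).2⟩
  refine Finset.sum_involution (fun t _ => g t) (fun t ht => ?_) (fun t ht _ h => ?_) hmem
    fun t ht => ?_
  · have key : ∀ {R : Type} [CommRing R] (s w : R), s * w + -s * w = 0 := fun s w => by ring
    rw [(hg2 t ht).tupleWeight_eq hn (mem.1 ht).1 (hg1 t ht),
      (hg2 t ht).sign_eq hn hpos (mem.1 ht).1 (hg1 t ht), Units.val_neg, Int.cast_neg]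
    exact key _ _
  · have := (hg2 t ht).sign_eq hn hpos (mem.1 ht).1 (hg1 t ht)
    rw [h] at this
    exact absurd this (by rcases Int.units_eq_one_or (Equiv.Perm.sign t.1) with e | e <;> simp [e])
  · exact (hg2 t ht).eq_of_isPartner (hg2 _ (hmem t ht)) hn hpos (mem.1 ht).1 (hg1 t ht)
      (hg1 _ (hmem t ht))

end

end TypeC

theorem mainTheorem4 (n : ℕ) (hn : 1 ≤ n) (lam mu : YoungDiagram) (hmu : mu ≤ lam)
    (hpos : TypeC.depth lam mu ≤ n + 1) (a : ℂ) :
    (TypeC.P2 n lam mu).Finite ∧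
      TypeC.chi n lam mu a = ∑ᶠ t ∈ TypeC.P2 n lam mu, TypeC.tupleWeight t a := by
  refine ⟨TypeC.finite_P2 n lam mu, ?_⟩
  rw [TypeC.chi_eq_sum_P1 hn, TypeC.sum_P1_eq_sum_P2 hn hpos,
    finsum_mem_eq_finite_toFinset_sum _ (TypeC.finite_P2 n lam mu)]
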